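/- **Setting.** For every $n\ge 1$ let $p=p_n$ and $M=M_n\ge 1$ be integers, $N=nM$, and let $(X_{m,i},Y_{m,i})$, $1\le m\le M$, $1\le i\le n$, be i.i.d. observations in $\mathbb R^p\times\mathbb R$, of which the $m$-th worker holds $(X_{m,1},Y_{m,1}),\dots,(X_{m,n},Y_{m,n})$; their law and all objects below may depend on $n$. Let $\ell(x,y;\theta)$ be a loss function, $\Theta\subset\mathbb R^p$ the parameter space, $\mathcal L_{(m)}(\theta)=n^{-1}\sum_i\ell(X_{m,i},Y_{m,i};\theta)$, $\mathcal L=M^{-1}\sum_m\mathcal L_{(m)}$. Let $\theta_0$, $\hat\theta_{(m)}$, $\hat\theta_{\rm ge}$ be minimizers over $\Theta$ of $E\,\ell(X,Y;\theta)$, $\mathcal L_{(m)}$, $\mathcal L$. Dots denote derivatives in $\theta$, with $\dddot f(\theta)(u\otimes I_p)=\sum_j u_j\partial_j\ddot f(\theta)$; $\|\cdot\|_2$ is the spectral norm; $\Omega(\theta)=E\,\ddot\ell(X,Y;\theta)$. **Estimators.** For $s,y\in\mathbb R^p$ and a matrix $H$, the BFGS update of $H$ is $V^\top HV+\rho ss^\top$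 with $\rho=1/(s^\top y)$, $V=I_p-\rho\,ys^\top$. The SR1 update is $H+vv^\top/(v^\top y)$ with $v=s-Hy$ if $|v^\top y|\ge c_1\|v\|\|y\|$, or if $H$ is invertible and $|r^\top s|\ge c_1\|r\|\|s\|$ for $r=y-H^{-1}s$; otherwise $H$ is kept. Here $0<c_1<1$ is fixed. (Correction terms with denominator $0$ are omitted.) The $m$-th worker runs $\theta^{(t+1)}=\theta^{(t)}-H^{(t)}_{(m,0)}\dot{\mathcal L}_{(m)}(\theta^{(t)})$ from some starting point $(\theta^{(0)},H^{(0)}_{(m,0)})$, where $H^{(t+1)}_{(m,0)}$ is the (BFGS or SR1) update of $H^{(t)}_{(m,0)}$ with $s=\theta^{(t+1)}-\theta^{(t)}$, $y=\dot{\mathcal L}_{(m)}(\theta^{(t+1)})-\dot{\mathcal L}_{(m)}(\theta^{(t)})$; $H_{(m,0)}=\lim_t H_{(m,0)}^{(t)}$. Put $\hat\theta_{\rm stage,0}=M^{-1}\sum_m\hat\theta_{(m)}$, $\hat\theta_{\rm stage,1}=\hat\theta_{\rm stage,0}-M^{-1}\sum_m H_{(m,0)}\dot{\mathcal L}(\hat\theta_{\rm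 stage,0})$ and $\hat\theta_{\rm stage,2}=\hat\theta_{\rm stage,1}-H_1\dot{\mathcal L}(\hat\theta_{\rm stage,1})$. With $s_0=\hat\theta_{\rm stage,1}-\hat\theta_{\rm stage,0}$ and $y_0=\dot{\mathcal L}(\hat\theta_{\rm stage,1})-\dot{\mathcal L}(\hat\theta_{\rm stage,0})$, the matrix $H_1$ is either the average over $m$ of the BFGS updates of $H_{(m,0)}$, or the SR1 update of $H_0=M^{-1}\sum_mH_{(m,0)}$. **Assumptions**, with positive constants $\delta,\tau_{\min},\tau_{\max},C_G,C_H,C_{\max}$ not depending on $n$, and $B=\{\theta:\|\theta-\theta_0\|\le\delta\}$: 1. $\Theta$ is compact and convex and $B\subset\Theta$; $\ell(x,y;\cdot)$ is convex on $\Theta$ for all $(x,y)$, and $E\,\ell(X,Y;\theta)$ is finite for $\theta\in\Theta$. 2. All eigenvalues of $\Omega(\theta_0)$ lie in $[\tau_{\min},\tau_{\max}]$. 3. $\ell(x,y;\cdot)$ is $C^3$ around every point of $B$; for $\theta\in B$, $E\|\dot\ell(X,Y;\theta)\|^8\le C_G^8$ and $E\|\ddot\ell(X,Y;\theta)-\Omega(\theta)\|_2^8\le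 C_H^8$; and there is a function $C(x,y)$ with $E\,C(X,Y)^8\le C_{\max}^8$ such that for all $(x,y)$, $\theta',\theta''\in B$, $u\in\mathbb R^p$: $\|\ddot\ell(x,y;\theta')-\ddot\ell(x,y;\theta'')\|_2\le C(x,y)\|\theta'-\theta''\|$ and $\|\{\dddot\ell(x,y;\theta')-\dddot\ell(x,y;\theta'')\}(u\otimes I_p)\|_2\le C(x,y)\|\theta'-\theta''\|\|u\|$. 4. With probability tending to one, for all $m\le M$ the matrix $\ddot{\mathcal L}_{(m)}(\hat\theta_{(m)})$ is invertible and $\|H^{(t)}_{(m,0)}-\{\ddot{\mathcal L}_{(m)}(\hat\theta_{(m)})\}^{-1}\|_2\to0$ as $t\to\infty$. 5. $p\sqrt{\log p}/n\to0$ and $N/n^8\to0$ as $n\to\infty$. **Theorem.** There is a constant $\kappa_2>0$, depending only on $\delta,\tau_{\min},\tau_{\max},C_G,C_H,C_{\max},c_1$, such that with probability tending to one as $n\to\infty$ $$\|\hat\theta_{\rm stage,2}-\hat\theta_{\rm ge}\|\le\kappa_2\big(A+\|\hat\theta_{\rm stage,0}-\theta_0\|\big)\,\|\hat\theta_{\rm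 stage,1}-\hat\theta_{\rm ge}\|,$$ $$A=\frac1M\sum_{m=1}^M\Big[\|\hat\theta_{(m)}-\theta_0\|^2+\|\ddot{\mathcal L}_{(m)}(\theta_0)-\Omega(\theta_0)\|_2^2+\big\|\{\dddot{\mathcal L}_{(m)}(\theta_0)-\dot\Omega(\theta_0)\}\{(\hat\theta_{(m)}-\theta_0)\otimes I_p\}\big\|_2\Big].$$ If moreover $Np^4(\log p)^3/n^6\to0$ and $N/n^6\to0$ (the latter follows from the former when $p\ge2$), then $\|\hat\theta_{\rm stage,2}-\hat\theta_{\rm ge}\|=o_p(N^{-1/2})$. -/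

import Mathlib

open MeasureTheory ProbabilityTheory Filter Topology

noncomputable section

namespace DQN

/-! ### Vectors, matrices, derivatives -/

/-- Euclidean space `ℝ^p`. -/
abbrev Vec (p : ℕ) := EuclideanSpace ℝ (Fin p)

/-- `p × p` matrices, as linear maps of `ℝ^p`; their norm is the spectral norm `‖·‖₂`. -/
abbrev Mat (p : ℕ) := Vec p →L[ℝ] Vec p

/-- One observation `(X, Y)` with `X ∈ ℝ^p` and `Y ∈ ℝ`. -/
abbrev Obs (p : ℕ) := Vec p × ℝ

/-- The Hessian matrix of `f` at `θ`. -/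
def hess {p : ℕ} (f : Vec p → ℝ) (θ : Vec p) : Mat p := fderiv ℝ (gradient f) θ

/-- The third derivative of `f` at `θ`: `third f θ u` is the `p × p` matrix
`∑ j, u_j ∂_j (hess f)(θ)`, that is, the third-derivative array multiplied by `u ⊗ I_p`. -/
def third {p : ℕ} (f : Vec p → ℝ) (θ : Vec p) : Vec p →L[ℝ] Mat p := fderiv ℝ (hess f) θ

/-- The rank-one matrix `u vᵀ`. -/
def outer {p : ℕ} (u v : Vec p) : Mat p := InnerProductSpace.rankOne ℝ u v

/-! ### Quasi-Newton updates of an approximate inverse Hessian -/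

/-- The BFGS update of `H`, with `s` the increment of the parameter and `y` that of the gradient. -/
def bfgs {p : ℕ} (H : Mat p) (s y : Vec p) : Mat p :=
  let ρ : ℝ := 1 / inner ℝ s y
  let V : Mat p := 1 - ρ • outer y s
  ContinuousLinearMap.adjoint V * H * V + ρ • outer s s

/-- The SR1 update of `H` is regarded as well defined, at level `c₁`. The first alternative is the
test in terms of `H`, the second one the test in terms of `B = H⁻¹`. -/
def SR1Accept {p : ℕ} (c₁ : ℝ) (H : Mat p) (s y : Vec p) : Prop :=
  c₁ * ‖s - H y‖ * ‖y‖ ≤ |inner ℝ (s - H y) y| ∨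
    (IsUnit H ∧
      c₁ * ‖y - Ring.inverse H s‖ * ‖s‖ ≤ |inner ℝ (y - Ring.inverse H s) s|)

open Classical in
/-- The SR1 update of `H`; the matrix is kept if the update is not well defined. -/
def sr1 {p : ℕ} (c₁ : ℝ) (H : Mat p) (s y : Vec p) : Mat p :=
  if SR1Accept c₁ H s y then
    H + (1 / inner ℝ (s - H y) y : ℝ) • outer (s - H y) (s - H y)
  else H

/-- The two updating strategies. -/
inductive Strategy
  | bfgs
  | sr1

/-- The update of `H` according to a strategy. -/
def update {p : ℕ} (c₁ : ℝ) : Strategy → Mat p → Vec p → Vec p → Mat p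
  | .bfgs, H, s, y => DQN.bfgs H s y
  | .sr1, H, s, y => DQN.sr1 c₁ H s y

/-- The quasi-Newton iteration `(θ^(t), H^(t))` for a loss `f`, started at `(θinit, Hinit)`. -/
def qnIter {p : ℕ} (c₁ : ℝ) (S : Strategy) (f : Vec p → ℝ) (θinit : Vec p) (Hinit : Mat p) :
    ℕ → Vec p × Mat p
  | 0 => (θinit, Hinit)
  | t + 1 =>
    let θ := (qnIter c₁ S f θinit Hinit t).1
    let H := (qnIter c₁ S f θinit Hinit t).2
    let θ' := θ - H (gradient f θ)
    (θ', update c₁ S H (θ' - θ) (gradient f θ' - gradient f θ))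

/-- The approximate inverse Hessian that the quasi-Newton iteration has at convergence. -/
def qnLimit {p : ℕ} (c₁ : ℝ) (S : Strategy) (f : Vec p → ℝ) (θinit : Vec p) (Hinit : Mat p) :
    Mat p :=
  limUnder atTop fun t => (qnIter c₁ S f θinit Hinit t).2

/-! ### The DQN estimators -/

/-- The averaged loss of a finite data set. -/
def empLoss {p : ℕ} {ι : Type*} [Fintype ι] (ℓ : Obs p → Vec p → ℝ) (z : ι → Obs p)
    (θ : Vec p) : ℝ :=
  (Fintype.card ι : ℝ)⁻¹ * ∑ i, ℓ (z i) θ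

/-- The loss of the `m`-th worker; `z m i` is its `i`-th observation. -/
def localLoss {p M n : ℕ} (ℓ : Obs p → Vec p → ℝ) (z : Fin M → Fin n → Obs p) (m : Fin M) :
    Vec p → ℝ :=
  empLoss ℓ (z m)

/-- The global loss, the average over all `N = M n` observations. -/
def globalLoss {p M n : ℕ} (ℓ : Obs p → Vec p → ℝ) (z : Fin M → Fin n → Obs p) : Vec p → ℝ :=
  empLoss ℓ fun k : Fin M × Fin n => z k.1 k.2

/-- The average `M⁻¹ ∑ m, a m`. -/
def avg {V : Type*} [AddCommGroup V] [Module ℝ V] {M : ℕ} (a : Fin M → V) : V :=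
  (M : ℝ)⁻¹ • ∑ m, a m

/-- The initial (one-shot) estimator, the average of the local estimators. -/
def stage0 {p M : ℕ} (θloc : Fin M → Vec p) : Vec p := avg θloc

/-- The one-stage DQN estimator for the global loss `L`, where `H m` is the approximate inverse
Hessian of the `m`-th worker and `θ₀` the initial estimator. -/
def stage1 {p M : ℕ} (L : Vec p → ℝ) (H : Fin M → Mat p) (θ₀ : Vec p) : Vec p :=
  θ₀ - avg fun m => H m (gradient L θ₀)

/-- The two-stage DQN estimator, from the initial estimator `θ₀` and the one-stage estimator `θ₁`.
With BFGS every worker updates its own matrix. With SR1 the updating vector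
`v = M⁻¹ ∑ m, (s - H m y)` and the direction are averaged over the workers, which amounts to the
update of the averaged matrix. -/
def stage2 {p M : ℕ} (c₁ : ℝ) (S : Strategy) (L : Vec p → ℝ) (H : Fin M → Mat p)
    (θ₀ θ₁ : Vec p) : Vec p :=
  let s := θ₁ - θ₀
  let y := gradient L θ₁ - gradient L θ₀
  match S with
  | .bfgs => θ₁ - avg fun m => bfgs (H m) s y (gradient L θ₁)
  | .sr1 => θ₁ - sr1 c₁ (avg H) s y (gradient L θ₁)

/-! ### The statistical model -/

/-- A parametric estimation problem: the law of an observation, the loss `ℓ(x, y; θ)`, the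
parameter space and the true parameter. -/
structure Model (p : ℕ) where
  law : Measure (Obs p)
  loss : Obs p → Vec p → ℝ
  Θ : Set (Vec p)
  θ₀ : Vec p

/-- `Ω(θ)`, the expected Hessian of the loss. -/
def Model.Omega {p : ℕ} (D : Model p) (θ : Vec p) : Mat p := ∫ z, hess (D.loss z) θ ∂D.law

/-- `E ‖f‖⁸ ≤ C⁸`, the expectation being finite. -/
def MomentLE {𝓧 V : Type*} [MeasurableSpace 𝓧] [Norm V] (μ : Measure 𝓧) (f : 𝓧 → V) (C : ℝ) :
    Prop :=
  Integrable (fun z => ‖f z‖ ^ 8) μ ∧ ∫ z, ‖f z‖ ^ 8 ∂μ ≤ C ^ 8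

/-- The regularity conditions on the model, with their constants. -/
structure Model.Regular {p : ℕ} (D : Model p) (δ τmin τmax CG CH Cmax : ℝ) : Prop where
  prob : IsProbabilityMeasure D.law
  meas : ∀ θ, Measurable fun z => D.loss z θ
  -- the expected loss is defined, and `θ₀` minimizes it
  integrable : ∀ θ ∈ D.Θ, Integrable (fun z => D.loss z θ) D.law
  isMin : IsMinOn (fun θ => ∫ z, D.loss z θ ∂D.law) D.Θ D.θ₀
  -- parameters
  compact : IsCompact D.Θ
  convex : Convex ℝ D.Θ
  ball_subset : Metric.closedBall D.θ₀ δ ⊆ D.Θ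
  -- convexity of the loss, and local strong convexity
  loss_convex : ∀ z, ConvexOn ℝ D.Θ (D.loss z)
  eig : ∀ τ : ℝ, Module.End.HasEigenvalue (D.Omega D.θ₀ : Vec p →ₗ[ℝ] Vec p) τ →
    τmin ≤ τ ∧ τ ≤ τmax
  -- smoothness
  smooth : ∀ z, ∀ θ ∈ Metric.closedBall D.θ₀ δ, ContDiffAt ℝ 3 (D.loss z) θ
  grad_moment : ∀ θ ∈ Metric.closedBall D.θ₀ δ,
    MomentLE D.law (fun z => gradient (D.loss z) θ) CG
  hess_moment : ∀ θ ∈ Metric.closedBall D.θ₀ δ,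
    MomentLE D.law (fun z => hess (D.loss z) θ - D.Omega θ) CH
  lipschitz : ∃ C : Obs p → ℝ, Measurable C ∧ MomentLE D.law C Cmax ∧
    ∀ z, ∀ θ ∈ Metric.closedBall D.θ₀ δ, ∀ θ' ∈ Metric.closedBall D.θ₀ δ,
      ‖hess (D.loss z) θ - hess (D.loss z) θ'‖ ≤ C z * ‖θ - θ'‖ ∧
      ∀ u : Vec p,
        ‖(third (D.loss z) θ - third (D.loss z) θ') u‖ ≤ C z * ‖θ - θ'‖ * ‖u‖

/-- The averaged error term of the local estimators, Hessians and third derivatives. -/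
def Model.errTerm {p M n : ℕ} (D : Model p) (z : Fin M → Fin n → Obs p)
    (θloc : Fin M → Vec p) : ℝ :=
  avg fun m =>
    ‖θloc m - D.θ₀‖ ^ 2
      + ‖hess (localLoss D.loss z m) D.θ₀ - D.Omega D.θ₀‖ ^ 2
      + ‖(third (localLoss D.loss z m) D.θ₀ - fderiv ℝ D.Omega D.θ₀) (θloc m - D.θ₀)‖

/-- `θ` is a minimizer of `f` over the parameter space `Θ`. -/
def IsArgmin {p : ℕ} (f : Vec p → ℝ) (Θ : Set (Vec p)) (θ : Vec p) : Prop :=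
  θ ∈ Θ ∧ IsMinOn f Θ θ

/-- The event that, on every worker, the local approximate inverse Hessians converge to the inverse
of the local Hessian at the local estimator. -/
def HessConverges {p M n : ℕ} (c₁ : ℝ) (S : Strategy) (ℓ : Obs p → Vec p → ℝ)
    (z : Fin M → Fin n → Obs p) (θloc : Fin M → Vec p)
    (θinit : Fin M → Vec p) (Hinit : Fin M → Mat p) : Prop :=
  ∀ m, IsUnit (hess (localLoss ℓ z m) (θloc m)) ∧
    Tendsto (fun t => (qnIter c₁ S (localLoss ℓ z m) (θinit m) (Hinit m) t).2) atTop
      (𝓝 (Ring.inverse (hess (localLoss ℓ z m) (θloc m))))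

/-- The one-stage DQN estimator computed from the data, the local estimators and the starting
points of the local quasi-Newton iterations. -/
def est1 {p M n : ℕ} (c₁ : ℝ) (S : Strategy) (ℓ : Obs p → Vec p → ℝ)
    (z : Fin M → Fin n → Obs p) (θloc θinit : Fin M → Vec p) (Hinit : Fin M → Mat p) : Vec p :=
  stage1 (globalLoss ℓ z) (fun m => qnLimit c₁ S (localLoss ℓ z m) (θinit m) (Hinit m))
    (stage0 θloc)

/-- The two-stage DQN estimator computed from the same input; `S` is the strategy of the local
iterations and `S'` that of the extra update. -/
def est2 {p M n : ℕ} (c₁ : ℝ) (S S' : Strategy) (ℓ : Obs p → Vec p → ℝ)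
    (z : Fin M → Fin n → Obs p) (θloc θinit : Fin M → Vec p) (Hinit : Fin M → Mat p) : Vec p :=
  stage2 c₁ S' (globalLoss ℓ z)
    (fun m => qnLimit c₁ S (localLoss ℓ z m) (θinit m) (Hinit m))
    (stage0 θloc) (est1 c₁ S ℓ z θloc θinit Hinit)

end DQN

end

/-! The argument splits into a deterministic analysis on a good event and moment bounds for that
event and for the error terms.

Deterministic part (`Localized`). Suppose that for every worker the gradient at `θ₀` is small, the
Hessian at `θ₀` is close to `Ω`, and the Hessian and third derivative are Lipschitz near `θ₀` with a
bounded constant. By convexity all minimizers are then stationary points close to `θ₀`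
(`SmoothLoss.argmin_near`). Let `P` be the global Hessian at `θ₀` and `Q` its inverse. Since the
global gradient vanishes at `θge`, a step `x - B ∇L(x)` multiplies the distance to `θge` by at most
a constant times `‖B - Q‖` plus the radius of the neighbourhood (`norm_step_sub_ge_le`). It remains
to show that the matrices in use are within `O(a)` of `Q`, where `a` is the error term `A` plus
`‖stage0 - θ₀‖`.

For the averaged local inverses this follows by expanding each inverse to second order around `Ω⁻¹`
(`norm_avg_H_sub_le`). The linear terms cancel against those of `Q`, up to a third-derivative term
whose mean part acts on the average of the local errors, that is, on `stage0 - θ₀`. An update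
preserves closeness to `Q`, because the increments satisfy `y ≈ P s`: if `y = P s` exactly, the BFGS
update fixes `Q`, and the SR1 correction is bounded through the acceptance test
(`norm_secant_update_sub_le`, `norm_sr1_sub_le`). BFGS is affine in the matrix, so averaging the
updates is updating the average (`avg_bfgs`). This gives the first claim, and the two steps chained
give an error `O(a² ‖stage0 - θge‖)`.

Probabilistic part. Eight moments and a truncation argument (`measure_norm_sum_gt_le`) show that one
worker is bad with probability `O(n⁻⁷)`. The union bound over `M` workers costs `M n⁻⁷ = N / n⁸`,
which tends to zero. The condition on `p` enters only as `p / n → 0`, which makes the expected error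
of the local Hessians small.

For the rate, three expectations are needed. The error term has mean `O((p + 1) / n)`. The squared
global gradient at `θ₀` has mean `O(1 / N)`. Finally `‖stage0 - θge‖` is controlled by products of a
centered mean matrix and a centered mean vector; the off-diagonal part of such a product is a
degenerate U-statistic, so its mean norm is `O(1 / n)` with no factor `p`
(`integral_norm_mean_apply_mean_le`). Markov's inequality turns `√N a² ‖stage0 - θge‖` into terms of
order `√N (p + 1)² / n³`, `√N / n³` and `√N / (N n)`, all of which vanish. -/

noncomputable section

namespace DQN

/-! ### Integration over independent pairs -/

section Independence

variable {Ω α β V : Type*} [MeasurableSpace Ω] [MeasurableSpace α] [MeasurableSpace β]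
  [NormedAddCommGroup V] {P : Measure Ω} [IsProbabilityMeasure P]

/-- Independence allows the two variables to be read off separate coordinates of `P.prod P`. Fubini
can then integrate out one variable while the other is frozen, which replaces conditional
expectations throughout. -/
theorem map_pair_eq_of_indepFun {X : Ω → α} {Y : Ω → β} (h : IndepFun X Y P)
    (hX : Measurable X) (hY : Measurable Y) :
    P.map (fun ω => (X ω, Y ω)) = (P.prod P).map (fun q => (X q.1, Y q.2)) := by
  rw [h.map_prod_eq_prod_map_map hX.aemeasurable hY.aemeasurable]
  exact (Measure.map_prod_map P P hX hY)

theorem integral_of_indepFun [NormedSpace ℝ V] {X : Ω → α} {Y : Ω → β} (h : IndepFun X Y P)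
    (hX : Measurable X) (hY : Measurable Y) {f : α × β → V} (hf : StronglyMeasurable f) :
    ∫ ω, f (X ω, Y ω) ∂P = ∫ q, f (X q.1, Y q.2) ∂(P.prod P) := by
  rw [← integral_map (φ := fun ω => (X ω, Y ω)) (hX.prodMk hY).aemeasurable
    hf.aestronglyMeasurable, map_pair_eq_of_indepFun h hX hY]
  exact integral_map ((hX.comp measurable_fst).prodMk (hY.comp measurable_snd)).aemeasurable
    hf.aestronglyMeasurable

theorem integrable_iff_of_indepFun {X : Ω → α} {Y : Ω → β} (h : IndepFun X Y P)
    (hX : Measurable X) (hY : Measurable Y) {f : α × β → V} (hf : StronglyMeasurable f) :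
    Integrable (fun ω => f (X ω, Y ω)) P ↔
      Integrable (fun q : Ω × Ω => f (X q.1, Y q.2)) (P.prod P) := by
  have h1 := integrable_map_measure (μ := P) (f := fun ω => (X ω, Y ω)) (g := f)
    hf.aestronglyMeasurable (hX.prodMk hY).aemeasurable
  have h2 := integrable_map_measure (μ := P.prod P) (f := fun q : Ω × Ω => (X q.1, Y q.2)) (g := f)
    hf.aestronglyMeasurable ((hX.comp measurable_fst).prodMk (hY.comp measurable_snd)).aemeasurable
  rw [map_pair_eq_of_indepFun h hX hY] at h1
  exact h1.symm.trans h2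

end Independence

/-! ### Tail bounds for norms of sums with eight moments -/

section Tail

/-- The second-order Taylor remainder of the exponential is at most `t² exp |t|`. After centering,
only the quadratic term survives integration. -/
theorem exp_le_of_abs_le {t c : ℝ} (h : |t| ≤ c) : Real.exp t ≤ 1 + t + t ^ 2 * Real.exp c := by
  have := Complex.norm_exp_sub_sum_le_norm_mul_exp (t : ℂ) 2
  simp only [Finset.sum_range_succ, Finset.sum_range_zero, pow_zero, pow_one, Nat.factorial] at this
  norm_num at this
  rw [show Complex.exp t - (1 + (t : ℂ)) = ((Real.exp t - (1 + t) : ℝ) : ℂ) by push_cast; ring, Complex.norm_real, Real.norm_eq_abs] at this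
  have h3 : t ^ 2 * Real.exp |t| ≤ t ^ 2 * Real.exp c := by gcongr
  linarith [le_abs_self (Real.exp t - (1 + t))]

variable {Ω E : Type*} [MeasurableSpace Ω] {P : Measure Ω} [IsProbabilityMeasure P]
  [NormedAddCommGroup E] [MeasurableSpace E] [BorelSpace E]
  [SecondCountableTopology E]

/-- Bernstein-type bound for the moment generating function of a bounded variable that is
close to a constant. -/
theorem mgf_le_of_abs_sub_le {W R : Ω → ℝ} (hW : Measurable W) (hR : Measurable R) {c b σ l : ℝ}
    (hWR : ∀ ω, |W ω - c| ≤ R ω) (hRb : ∀ ω, R ω ≤ b) (hσ : ∫ ω, R ω ^ 2 ∂P ≤ σ ^ 2)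
    (hl : 0 ≤ l) :
    ∫ ω, Real.exp (l * W ω) ∂P ≤
      Real.exp (l * (∫ ω, W ω ∂P) + l ^ 2 * σ ^ 2 * Real.exp (2 * l * b)) := by
  have hR0 : ∀ ω, 0 ≤ R ω := fun ω => (abs_nonneg _).trans (hWR ω)
  have hb0 : 0 ≤ b := by
    obtain ⟨ω⟩ : Nonempty Ω := nonempty_of_isProbabilityMeasure P
    exact (hR0 ω).trans (hRb ω)
  have iR2 : Integrable (fun ω => R ω ^ 2) P := by
    refine Integrable.of_bound (hR.pow_const 2).aestronglyMeasurable (b ^ 2) (ae_of_all _ fun ω => ?_)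
    rw [Real.norm_eq_abs, abs_of_nonneg (sq_nonneg _)]
    exact pow_le_pow_left₀ (hR0 ω) (hRb ω) 2
  have iW : Integrable W P := by
    refine Integrable.of_bound hW.aestronglyMeasurable (|c| + b) (ae_of_all _ fun ω => ?_)
    have h1 := (hWR ω).trans (hRb ω)
    have h2 : W ω = c + (W ω - c) := by ring
    rw [Real.norm_eq_abs, h2]
    exact (abs_add_le _ _).trans (by linarith)
  set w := ∫ ω, W ω ∂P with hw
  have hwc : |w - c| ≤ b := by
    have : w - c = ∫ ω, (W ω - c) ∂P := by
      rw [integral_sub iW (integrable_const _)]; simp [hw]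
    rw [this]
    refine (abs_integral_le_integral_abs).trans ?_
    have := integral_mono (iW.sub (integrable_const c)).abs (integrable_const b)
      (fun ω => (hWR ω).trans (hRb ω))
    simpa using this
  have iWw : Integrable (fun ω => W ω - w) P := iW.sub (integrable_const w)
  set d : Ω → ℝ := fun ω => l * (W ω - w) with hd
  have hdb : ∀ ω, |d ω| ≤ 2 * l * b := fun ω => by
    have h1 := (hWR ω).trans (hRb ω)
    have : |W ω - w| ≤ 2 * b := by
      rw [show W ω - w = (W ω - c) - (w - c) by ring]
      exact (abs_sub _ _).trans (by linarith)
    rw [hd]; simp only [abs_mul, abs_of_nonneg hl]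
    nlinarith
  have id2 : Integrable (fun ω => (W ω - w) ^ 2) P := by
    refine Integrable.of_bound ((hW.sub_const w).pow_const 2).aestronglyMeasurable ((2 * b) ^ 2)
      (ae_of_all _ fun ω => ?_)
    have h1 := (hWR ω).trans (hRb ω)
    have : |W ω - w| ≤ 2 * b := by
      rw [show W ω - w = (W ω - c) - (w - c) by ring]
      exact (abs_sub _ _).trans (by linarith)
    rw [Real.norm_eq_abs, abs_of_nonneg (sq_nonneg _), ← sq_abs]
    exact pow_le_pow_left₀ (abs_nonneg _) this 2
  -- The mean minimizes the second moment, so the variance is at most the second moment about `c`,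
  -- which `R` controls.
  have hvar : ∫ ω, (W ω - w) ^ 2 ∂P ≤ σ ^ 2 := by
    have h1 : ∫ ω, ((W ω - w) ^ 2 + 2 * (w - c) * (W ω - w) + (w - c) ^ 2) ∂P ≤ ∫ ω, R ω ^ 2 ∂P := by
      refine integral_mono ((id2.add (iWw.const_mul _)).add
        (integrable_const _)) iR2 fun ω => ?_
      have := pow_le_pow_left₀ (abs_nonneg _) (hWR ω) 2
      rw [sq_abs] at this
      nlinarith
    have h2 : ∫ ω, ((W ω - w) ^ 2 + 2 * (w - c) * (W ω - w) + (w - c) ^ 2) ∂P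
        = ∫ ω, (W ω - w) ^ 2 ∂P + (w - c) ^ 2 := by
      have i1 : Integrable (fun ω => 2 * (w - c) * (W ω - w)) P := iWw.const_mul _
      have i2 : Integrable (fun ω => (W ω - w) ^ 2 + 2 * (w - c) * (W ω - w)) P := id2.add i1
      rw [integral_add i2 (integrable_const _), integral_add id2 i1, integral_const_mul,
        integral_sub iW (integrable_const w)]
      simp [← hw]
    nlinarith [sq_nonneg (w - c)]
  have key : ∫ ω, Real.exp (d ω) ∂P ≤ Real.exp (l ^ 2 * σ ^ 2 * Real.exp (2 * l * b)) := by
    have h1 : ∫ ω, Real.exp (d ω) ∂P ≤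
        ∫ ω, (1 + l * (W ω - w) + (W ω - w) ^ 2 * (l ^ 2 * Real.exp (2 * l * b))) ∂P := by
      refine integral_mono ?_ (((integrable_const (1:ℝ) |>.add
        (iWw.const_mul l))).add (id2.mul_const _)) fun ω => ?_
      · refine Integrable.of_bound (by fun_prop) (Real.exp (2 * l * b))
          (ae_of_all _ fun ω => ?_)
        rw [Real.norm_eq_abs, Real.abs_exp]
        exact Real.exp_le_exp.mpr ((le_abs_self _).trans (hdb ω))
      · refine (exp_le_of_abs_le (hdb ω)).trans (le_of_eq ?_)
        simp only [hd]; ring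
    have h2 : ∫ ω, (1 + l * (W ω - w) + (W ω - w) ^ 2 * (l ^ 2 * Real.exp (2 * l * b))) ∂P
        = 1 + (∫ ω, (W ω - w) ^ 2 ∂P) * (l ^ 2 * Real.exp (2 * l * b)) := by
      have i1 : Integrable (fun ω => l * (W ω - w)) P := iWw.const_mul _
      have i2 : Integrable (fun ω => 1 + l * (W ω - w)) P := (integrable_const (1 : ℝ)).add i1
      rw [integral_add i2 (id2.mul_const _), integral_add (integrable_const _) i1,
        integral_const_mul, integral_mul_const, integral_sub iW (integrable_const w)]
      simp [← hw]
    have h3 : (∫ ω, (W ω - w) ^ 2 ∂P) * (l ^ 2 * Real.exp (2 * l * b)) ≤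
        σ ^ 2 * (l ^ 2 * Real.exp (2 * l * b)) := by gcongr
    have h4 := Real.add_one_le_exp (l ^ 2 * σ ^ 2 * Real.exp (2 * l * b))
    linarith
  have : ∀ ω, Real.exp (l * W ω) = Real.exp (l * w) * Real.exp (d ω) := fun ω => by
    rw [← Real.exp_add]; congr 1; simp only [hd]; ring
  simp_rw [this]
  rw [integral_const_mul, Real.exp_add]
  gcongr

/-- Moment generating function of a Lipschitz function of a sum of independent bounded vectors. -/
theorem mgf_lipschitz_sum_le {ι : Type*} {X : ι → Ω → E} (hX : ∀ i, Measurable (X i))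
    (hind : iIndepFun X P) {b σ l : ℝ} (hb : ∀ i ω, ‖X i ω‖ ≤ b)
    (hσ : ∀ i, ∫ ω, ‖X i ω‖ ^ 2 ∂P ≤ σ ^ 2) (hl : 0 ≤ l) (s : Finset ι) :
    ∀ F : E → ℝ, LipschitzWith 1 F →
      ∫ ω, Real.exp (l * F (∑ i ∈ s, X i ω)) ∂P ≤
        Real.exp (l * (∫ ω, F (∑ i ∈ s, X i ω) ∂P) +
          s.card * (l ^ 2 * σ ^ 2 * Real.exp (2 * l * b))) := by
  classical
  have hsumb : ∀ (s : Finset ι) ω, ‖∑ i ∈ s, X i ω‖ ≤ s.card * b := fun s ω => by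
    refine (norm_sum_le _ _).trans ((Finset.sum_le_sum fun i _ => hb i ω).trans ?_)
    simp
  have hsm : ∀ s : Finset ι, Measurable fun ω => ∑ i ∈ s, X i ω := fun s => by fun_prop
  have hFb : ∀ F : E → ℝ, LipschitzWith 1 F → ∀ x, |F x| ≤ |F 0| + ‖x‖ := fun F hF x => by
    have := hF.dist_le_mul x 0
    rw [Real.dist_eq, dist_zero_right] at this
    have h2 : F x = F 0 + (F x - F 0) := by ring
    rw [h2]
    refine (abs_add_le _ _).trans ?_
    simpa using this
  induction s using Finset.induction_on with
  | empty => intro F hF; simp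
  | insert a s ha ih =>
    intro F hF
    have hFm : Measurable F := hF.continuous.measurable
    -- Integrating out the last summand leaves a function of the remaining sum that is again
    -- 1-Lipschitz. This is why the induction is over all `F` at once.
    set G : E → ℝ := fun x => ∫ ω, F (x + X a ω) ∂P with hG
    have iF : ∀ x, Integrable (fun ω => F (x + X a ω)) P := fun x => by
      refine Integrable.of_bound (hFm.comp ((hX a).const_add x)).aestronglyMeasurable
        (|F 0| + (‖x‖ + b)) (ae_of_all _ fun ω => ?_)
      refine (hFb F hF _).trans ?_
      have := norm_add_le x (X a ω)
      linarith [hb a ω]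
    have hGL : LipschitzWith 1 G := by
      refine LipschitzWith.of_dist_le_mul fun x y => ?_
      rw [Real.dist_eq, hG]
      simp only
      rw [← integral_sub (iF x) (iF y)]
      refine abs_integral_le_integral_abs.trans ?_
      refine (integral_mono ((iF x).sub (iF y)).abs (integrable_const (dist x y))
        fun ω => ?_).trans (by simp)
      have := hF.dist_le_mul (x + X a ω) (y + X a ω)
      simpa [Real.dist_eq] using this
    have hindep : IndepFun (fun ω => ∑ i ∈ s, X i ω) (X a) P := by
      have := hind.indepFun_finsetSum_of_notMem hX ha
      convert this using 1
      ext ω; simp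
    have e1 : ∀ ω, F (∑ i ∈ insert a s, X i ω) = F (∑ i ∈ s, X i ω + X a ω) := fun ω => by
      rw [Finset.sum_insert ha, add_comm]
    simp_rw [e1]
    have bd : ∀ ω ω', |F (∑ i ∈ s, X i ω + X a ω')| ≤ |F 0| + (s.card * b + b) := fun ω ω' => by
      refine (hFb F hF _).trans ?_
      have := norm_add_le (∑ i ∈ s, X i ω) (X a ω')
      linarith [hb a ω', hsumb s ω]
    have hm2 : Measurable fun q : Ω × Ω => F (∑ i ∈ s, X i q.1 + X a q.2) :=
      hFm.comp (((hsm s).comp measurable_fst).add ((hX a).comp measurable_snd))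
    have E1 : ∫ ω, F (∑ i ∈ s, X i ω + X a ω) ∂P = ∫ ω, G (∑ i ∈ s, X i ω) ∂P := by
      have := integral_of_indepFun hindep (hsm s) (hX a) (f := fun q : E × E => F (q.1 + q.2))
        (hFm.comp (measurable_fst.add measurable_snd)).stronglyMeasurable
      rw [this, integral_prod]
      refine Integrable.of_bound hm2.aestronglyMeasurable (|F 0| + (s.card * b + b)) ?_
      exact ae_of_all _ fun q => bd q.1 q.2
    have iE : Integrable (fun q : Ω × Ω => Real.exp (l * F (∑ i ∈ s, X i q.1 + X a q.2)))
        (P.prod P) := by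
      refine Integrable.of_bound (Real.measurable_exp.comp (hm2.const_mul l)).aestronglyMeasurable
        (Real.exp (l * (|F 0| + (s.card * b + b)))) (ae_of_all _ fun q => ?_)
      rw [Real.norm_eq_abs, Real.abs_exp]
      refine Real.exp_le_exp.mpr (mul_le_mul_of_nonneg_left ((le_abs_self _).trans (bd q.1 q.2)) hl)
    have E2 : ∫ ω, Real.exp (l * F (∑ i ∈ s, X i ω + X a ω)) ∂P =
        ∫ ω, ∫ ω', Real.exp (l * F (∑ i ∈ s, X i ω + X a ω')) ∂P ∂P := by
      have := integral_of_indepFun hindep (hsm s) (hX a)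
        (f := fun q : E × E => Real.exp (l * F (q.1 + q.2)))
        (Real.measurable_exp.comp ((hFm.comp (measurable_fst.add measurable_snd)).const_mul
          l)).stronglyMeasurable
      rw [this, integral_prod _ iE]
    rw [E1, E2]
    set φ := l ^ 2 * σ ^ 2 * Real.exp (2 * l * b) with hφ
    have step : ∀ ω, ∫ ω', Real.exp (l * F (∑ i ∈ s, X i ω + X a ω')) ∂P ≤
        Real.exp φ * Real.exp (l * G (∑ i ∈ s, X i ω)) := fun ω => by
      rw [← Real.exp_add, add_comm]
      refine mgf_le_of_abs_sub_le (R := fun ω => ‖X a ω‖) (c := F (∑ i ∈ s, X i ω))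
        (hFm.comp ((hX a).const_add _)) (hX a).norm (fun ω' => ?_) (hb a) (hσ a) hl
      have := hF.dist_le_mul (∑ i ∈ s, X i ω + X a ω') (∑ i ∈ s, X i ω)
      simpa [Real.dist_eq] using this
    refine (integral_mono iE.integral_prod_left (g := fun ω => Real.exp φ *
      Real.exp (l * G (∑ i ∈ s, X i ω))) ?_ step).trans ?_
    · refine Integrable.const_mul ?_ _
      refine Integrable.of_bound (Real.measurable_exp.comp ((hGL.continuous.measurable.comp
        (hsm s)).const_mul l)).aestronglyMeasurable (Real.exp (l * (|G 0| + s.card * b)))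
        (ae_of_all _ fun ω => ?_)
      rw [Real.norm_eq_abs, Real.abs_exp]
      refine Real.exp_le_exp.mpr (mul_le_mul_of_nonneg_left ((le_abs_self _).trans
        ((hFb G hGL _).trans ?_)) hl)
      linarith [hsumb s ω]
    · rw [integral_const_mul, Finset.card_insert_of_notMem ha]
      refine (mul_le_mul_of_nonneg_left (ih G hGL) (Real.exp_pos _).le).trans (le_of_eq ?_)
      rw [← Real.exp_add]
      congr 1
      push_cast
      ring

/-- With `u = x² / K²` this is `u ≤ 3/4 + u⁴/4`. The weights are such that integrating against an
eighth moment of at most `K⁸` returns exactly `K²`, with no loss over Hölder's inequality. -/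
theorem sq_le_of_moment {x K : ℝ} (hK : 0 < K) :
    x ^ 2 ≤ K ^ 2 * (3 / 4) + K ^ 2 / (4 * K ^ 8) * x ^ 8 := by
  set u := x ^ 2 / K ^ 2 with hu
  have hx : x ^ 2 = K ^ 2 * u := by rw [hu]; field_simp
  have h8 : x ^ 8 = K ^ 8 * u ^ 4 := by
    calc x ^ 8 = (x ^ 2) ^ 4 := by ring
      _ = _ := by rw [hx]; ring
  rw [h8, hx]
  have h1 : K ^ 2 / (4 * K ^ 8) * (K ^ 8 * u ^ 4) = K ^ 2 * (u ^ 4 / 4) := by field_simp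
  rw [h1, ← mul_add]
  refine mul_le_mul_of_nonneg_left ?_ (by positivity)
  nlinarith [sq_nonneg (u - 1), sq_nonneg (u ^ 2 - 1), sq_nonneg u]

theorem MomentLE.integrable_sq {𝓧 V : Type*} [MeasurableSpace 𝓧] [NormedAddCommGroup V]
    {μ : Measure 𝓧} [IsProbabilityMeasure μ] {f : 𝓧 → V} {K : ℝ} (hK : 0 < K)
    (h : MomentLE μ f K) (hf : AEStronglyMeasurable f μ) :
    Integrable (fun z => ‖f z‖ ^ 2) μ := by
  refine Integrable.mono' ((integrable_const (K ^ 2 * (3 / 4))).add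
    (h.1.const_mul (K ^ 2 / (4 * K ^ 8)))) (hf.norm.pow 2) (ae_of_all _ fun z => ?_)
  rw [Real.norm_eq_abs, abs_of_nonneg (sq_nonneg _)]
  exact sq_le_of_moment hK

theorem MomentLE.integral_sq_le {𝓧 V : Type*} [MeasurableSpace 𝓧] [NormedAddCommGroup V]
    {μ : Measure 𝓧} [IsProbabilityMeasure μ] {f : 𝓧 → V} {K : ℝ} (hK : 0 < K)
    (h : MomentLE μ f K) (hf : AEStronglyMeasurable f μ) :
    ∫ z, ‖f z‖ ^ 2 ∂μ ≤ K ^ 2 := by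
  have h1 := integral_mono (h.integrable_sq hK hf) ((integrable_const (K ^ 2 * (3 / 4))).add
    (h.1.const_mul (K ^ 2 / (4 * K ^ 8)))) (fun z => sq_le_of_moment (x := ‖f z‖) hK)
  refine h1.trans ?_
  simp only [Pi.add_apply]
  rw [integral_add (integrable_const _) (h.1.const_mul _), integral_const_mul (K ^ 2 / (4 * K ^ 8))]
  have h2 : K ^ 2 / (4 * K ^ 8) * ∫ z, ‖f z‖ ^ 8 ∂μ ≤ K ^ 2 / (4 * K ^ 8) * K ^ 8 :=
    mul_le_mul_of_nonneg_left h.2 (by positivity)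
  have h3 : K ^ 2 / (4 * K ^ 8) * K ^ 8 = K ^ 2 / 4 := by field_simp
  simp only [integral_const, probReal_univ, one_smul]
  linarith

theorem MomentLE.integrable {𝓧 V : Type*} [MeasurableSpace 𝓧] [NormedAddCommGroup V]
    {μ : Measure 𝓧} [IsProbabilityMeasure μ] {f : 𝓧 → V} {K : ℝ} (hK : 0 < K)
    (h : MomentLE μ f K) (hf : AEStronglyMeasurable f μ) : Integrable f μ :=
  ((memLp_two_iff_integrable_sq_norm hf).2 (h.integrable_sq hK hf)).integrable (by norm_num)

/-- The constant in the tail bound `measure_norm_sum_gt_le`. -/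
def tailConst (ε K : ℝ) : ℝ :=
  K ^ 8 / (ε / 56) ^ 8 + Real.exp (K ^ 2 / (ε / 56) ^ 2) + (2 * K ^ 2 / (ε / 56 * ε)) ^ 7

/-- Apply `log y ≤ y` to the fourth root of `x`. -/
theorem log_sq_le_sqrt {x : ℝ} (hx : 1 ≤ x) : Real.log x ^ 2 ≤ 16 * √x := by
  have h1 := Real.log_le_self (x := √(√x)) (by positivity)
  rw [Real.log_sqrt (by positivity), Real.log_sqrt (by positivity)] at h1
  have h0 := Real.log_nonneg hx
  have h2 : Real.log x ≤ 4 * √(√x) := by linarith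
  calc Real.log x ^ 2 ≤ (4 * √(√x)) ^ 2 := pow_le_pow_left₀ h0 h2 2
    _ = 16 * √x := by rw [mul_pow, Real.sq_sqrt (by positivity)]; norm_num

/-- A Fuk–Nagaev-type inequality: the norm of a sum of independent vectors with eight moments
exceeds its mean by `k ε` with probability `O(k⁻⁷)`. -/
theorem measure_norm_sum_gt_le {𝓧 ι : Type*} [MeasurableSpace 𝓧] [Fintype ι] [Nonempty ι]
    (μ : Measure 𝓧) [IsProbabilityMeasure μ] {φ : 𝓧 → E} (hφ : Measurable φ) {ε K : ℝ}
    (hε : 0 < ε) (hK : 0 < K) (hm : MomentLE μ φ K) :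
    (Measure.pi fun _ : ι => μ).real
      {z | ∫ z, ‖∑ i, φ (z i)‖ ∂(Measure.pi fun _ : ι => μ) + Fintype.card ι * ε
        < ‖∑ i, φ (z i)‖} ≤ tailConst ε K / (Fintype.card ι : ℝ) ^ 7 := by
  classical
  set ν := Measure.pi fun _ : ι => μ with hν
  set k : ℝ := (Fintype.card ι : ℝ) with hk
  have hk1 : 1 ≤ k := by rw [hk]; exact_mod_cast Fintype.card_pos
  have hk0 : 0 < k := by linarith
  -- Truncation is at height `c k` and the exponential parameter is `log k / (4 c k)`. Exceeding the
  -- mean by `k ε / 2` then costs `(ε / (8 c)) log k`, so `56 = 8 * 7` yields the factor `k⁻⁷`.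
  set c : ℝ := ε / 56 with hc
  have hc0 : 0 < c := by positivity
  have hcε : ε = 56 * c := by rw [hc]; ring
  have hT : tailConst ε K = K ^ 8 / c ^ 8 + Real.exp (K ^ 2 / c ^ 2) +
    (2 * K ^ 2 / (c * ε)) ^ 7 := rfl
  -- For such few summands the last term of `tailConst` already makes the bound at least one.
  -- Otherwise `k` is large enough for the truncation bias to be at most `k ε / 2`.
  by_cases hsmall : k < 2 * K ^ 2 / (c * ε)
  · refine measureReal_le_one.trans ?_
    rw [le_div_iff₀ (by positivity), one_mul, hT]
    have h1 : k ^ 7 ≤ (2 * K ^ 2 / (c * ε)) ^ 7 := pow_le_pow_left₀ hk0.le hsmall.le 7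
    have h2 : 0 < K ^ 8 / c ^ 8 + Real.exp (K ^ 2 / c ^ 2) := by positivity
    linarith
  rw [not_lt] at hsmall
  set b : ℝ := c * k with hb
  have hb0 : 0 < b := by positivity
  -- truncation
  set ψ : 𝓧 → E := fun x => if ‖φ x‖ ≤ b then φ x else 0 with hψ
  have hψm : Measurable ψ :=
    Measurable.ite (measurableSet_le hφ.norm measurable_const) hφ measurable_const
  have hψb : ∀ x, ‖ψ x‖ ≤ b := fun x => by
    simp only [hψ]; split_ifs with h
    · exact h
    · simpa using hb0.le
  have hψφ : ∀ x, ‖ψ x‖ ≤ ‖φ x‖ := fun x => by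
    simp only [hψ]; split_ifs with h
    · exact le_rfl
    · simp
  have hdiff : ∀ x, ‖ψ x - φ x‖ ≤ ‖φ x‖ ^ 2 / b := fun x => by
    simp only [hψ]; split_ifs with h
    · simp; positivity
    · rw [zero_sub, norm_neg, le_div_iff₀ hb0, sq]
      exact mul_le_mul_of_nonneg_left (not_le.mp h).le (norm_nonneg _)
  have iφ2 := hm.integrable_sq hK hφ.aestronglyMeasurable
  have iφ := hm.integrable hK hφ.aestronglyMeasurable
  have hφ2 := hm.integral_sq_le hK hφ.aestronglyMeasurable
  have ev : ∀ i, MeasurePreserving (Function.eval i) ν μ := fun i => measurePreserving_eval _ i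
  have hind : iIndepFun (fun i (z : ι → 𝓧) => ψ (z i)) ν :=
    iIndepFun_pi (μ := fun _ : ι => μ) (X := fun _ => ψ) fun i => hψm.aemeasurable
  have isum : Integrable (fun z : ι → 𝓧 => ‖∑ i, φ (z i)‖) ν :=
    (integrable_finsetSum _ fun i _ => (ev i).integrable_comp_of_integrable iφ).norm
  have iψ2 : Integrable (fun x => ‖ψ x‖ ^ 2) μ :=
    iφ2.mono' (hψm.norm.pow_const 2).aestronglyMeasurable (ae_of_all _ fun x => by
      rw [Real.norm_eq_abs, abs_of_nonneg (sq_nonneg _)]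
      exact pow_le_pow_left₀ (norm_nonneg _) (hψφ x) 2)
  have hσ : ∀ i, ∫ z, ‖ψ (z i)‖ ^ 2 ∂ν ≤ K ^ 2 := fun i => by
    rw [integral_comp_eval (i := i) (f := fun x => ‖ψ x‖ ^ 2) (μ := fun _ : ι => μ)
      (hψm.norm.pow_const 2).aestronglyMeasurable]
    exact (integral_mono iψ2 iφ2 fun x => pow_le_pow_left₀ (norm_nonneg _) (hψφ x) 2).trans hφ2
  set m := ∫ z, ‖∑ i, φ (z i)‖ ∂ν with hmdef
  -- With this parameter the factor `exp (2 l b)` of the Bernstein bound is `√k`. The variance term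
  -- is then of order `log² k / √k`, hence bounded.
  set l : ℝ := Real.log k / (4 * b) with hl
  have hl0 : 0 ≤ l := div_nonneg (Real.log_nonneg hk1) (by positivity)
  have mψ : Measurable fun z : ι → 𝓧 => ‖∑ i, ψ (z i)‖ :=
    (Finset.measurable_sum _ fun i _ => hψm.comp (measurable_pi_apply i)).norm
  have hmgf := mgf_lipschitz_sum_le (X := fun i (z : ι → 𝓧) => ψ (z i)) (P := ν)
    (fun i => hψm.comp (measurable_pi_apply i)) hind (b := b) (σ := K) (l := l)
    (fun i z => hψb _) hσ hl0 Finset.univ (fun x => ‖x‖) lipschitzWith_one_norm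
  have hbs : ∀ z : ι → 𝓧, ‖∑ i, ψ (z i)‖ ≤ k * b := fun z => by
    refine (norm_sum_le _ _).trans ((Finset.sum_le_sum fun i _ => hψb (z i)).trans ?_)
    simp [hk]
  have iψs : Integrable (fun z : ι → 𝓧 => ‖∑ i, ψ (z i)‖) ν := by
    refine Integrable.of_bound mψ.aestronglyMeasurable (k * b) (ae_of_all _ fun z => ?_)
    rw [norm_norm]; exact hbs z
  -- Each truncated part is at most `‖φ‖² / b` in norm, so truncation shifts the mean by at most `k
  -- K² / b = K² / c`.
  have hmψ : ∫ z, ‖∑ i, ψ (z i)‖ ∂ν ≤ m + k * ε / 2 := by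
    have i2 : ∀ i : ι, Integrable (fun z : ι → 𝓧 => ‖φ (z i)‖ ^ 2 / b) ν := fun i =>
      ((ev i).integrable_comp_of_integrable iφ2).div_const b
    have i3 : Integrable (fun z : ι → 𝓧 => ∑ i, ‖φ (z i)‖ ^ 2 / b) ν :=
      integrable_finsetSum _ fun i _ => i2 i
    have h1 : ∫ z, ‖∑ i, ψ (z i)‖ ∂ν ≤
        ∫ z, (‖∑ i, φ (z i)‖ + ∑ i, ‖φ (z i)‖ ^ 2 / b) ∂ν := by
      refine integral_mono iψs (isum.add i3) fun z => ?_
      have h2 : ∑ i, ψ (z i) = ∑ i, φ (z i) + ∑ i, (ψ (z i) - φ (z i)) := by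
        rw [← Finset.sum_add_distrib]; exact Finset.sum_congr rfl fun i _ => by abel
      simp only
      rw [h2]
      refine (norm_add_le _ _).trans (add_le_add le_rfl ?_)
      exact (norm_sum_le _ _).trans (Finset.sum_le_sum fun i _ => hdiff _)
    refine h1.trans ?_
    rw [integral_add isum i3, integral_finsetSum _ fun i _ => i2 i]
    have h4 : ∀ i : ι, ∫ z : ι → 𝓧, ‖φ (z i)‖ ^ 2 / b ∂ν ≤ K ^ 2 / b := fun i => by
      rw [integral_div, integral_comp_eval (i := i) (f := fun x => ‖φ x‖ ^ 2)
        (μ := fun _ : ι => μ) (hφ.norm.pow_const 2).aestronglyMeasurable]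
      gcongr
    have h5 : ∑ i : ι, ∫ z : ι → 𝓧, ‖φ (z i)‖ ^ 2 / b ∂ν ≤ k * (K ^ 2 / b) := by
      refine (Finset.sum_le_sum fun i _ => h4 i).trans ?_
      simp [hk]
    have h6 : k * (K ^ 2 / b) ≤ k * ε / 2 := by
      rw [hb]
      have : k * (K ^ 2 / (c * k)) = K ^ 2 / c := by field_simp
      rw [this, div_le_div_iff₀ hc0 (by norm_num)]
      rw [div_le_iff₀ (by positivity)] at hsmall
      nlinarith
    linarith
  have hcheb : ν.real {z | (∫ z, ‖∑ i, ψ (z i)‖ ∂ν) + k * ε / 2 ≤ ‖∑ i, ψ (z i)‖} ≤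
      Real.exp (K ^ 2 / c ^ 2) / k ^ 7 := by
    refine (measure_ge_le_exp_mul_mgf _ hl0 ?_).trans ?_
    · refine Integrable.of_bound (Real.measurable_exp.comp (mψ.const_mul l)).aestronglyMeasurable
        (Real.exp (l * (k * b))) (ae_of_all _ fun z => ?_)
      rw [Real.norm_eq_abs, Real.abs_exp]
      exact Real.exp_le_exp.mpr (mul_le_mul_of_nonneg_left (hbs z) hl0)
    · rw [mgf]
      refine (mul_le_mul_of_nonneg_left hmgf (Real.exp_pos _).le).trans ?_
      rw [← Real.exp_add, le_div_iff₀ (by positivity)]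
      have hk7 : k ^ 7 = Real.exp (7 * Real.log k) := by
        rw [← Real.exp_log (pow_pos hk0 7), Real.log_pow]; norm_num
      rw [hk7, ← Real.exp_add]
      refine Real.exp_le_exp.mpr ?_
      have e1 : l * (k * ε / 2) = 7 * Real.log k := by
        rw [hl, hb, hcε]; field_simp; ring
      have e2 : Real.exp (2 * l * b) = √k := by
        have : 2 * l * b = Real.log k / 2 := by rw [hl]; field_simp; ring
        rw [this, ← Real.log_sqrt hk0.le, Real.exp_log (by positivity)]
      have e3 : (Finset.univ : Finset ι).card * (l ^ 2 * K ^ 2 * Real.exp (2 * l * b)) ≤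
          K ^ 2 / c ^ 2 := by
        rw [e2, Finset.card_univ, ← hk, hl, hb]
        have h1 := log_sq_le_sqrt hk1
        have h2 : k * ((Real.log k / (4 * (c * k))) ^ 2 * K ^ 2 * √k) =
          K ^ 2 / c ^ 2 * (Real.log k ^ 2 * √k / (16 * k)) := by field_simp; norm_num
        rw [h2]
        refine mul_le_of_le_one_right (by positivity) ?_
        rw [div_le_one (by positivity)]
        calc Real.log k ^ 2 * √k ≤ 16 * √k * √k := by gcongr
          _ = 16 * k := by rw [mul_assoc, Real.mul_self_sqrt hk0.le]
      have e4 : -l * (∫ z, ‖∑ i, ψ (z i)‖ ∂ν + k * ε / 2) =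
        - (l * ∫ z, ‖∑ i, ψ (z i)‖ ∂ν) - 7 * Real.log k := by rw [← e1]; ring
      linarith
  -- Markov for the eighth moment. Summed over the `k` observations with `b = c k`, this is again of
  -- order `k⁻⁷`.
  have hlarge : ∀ i : ι, ν.real {z | b < ‖φ (z i)‖} ≤ K ^ 8 / b ^ 8 := fun i => by
    have h1 : ν.real {z : ι → 𝓧 | b ^ 8 ≤ ‖φ (z i)‖ ^ 8} * b ^ 8 ≤ K ^ 8 := by
      have h2 := mul_meas_ge_le_integral_of_nonneg (μ := ν) (f := fun z : ι → 𝓧 => ‖φ (z i)‖ ^ 8)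
        (ae_of_all _ fun z => by positivity) ((ev i).integrable_comp_of_integrable hm.1) (b ^ 8)
      rw [integral_comp_eval (i := i) (f := fun x => ‖φ x‖ ^ 8)
        (μ := fun _ : ι => μ) (hφ.norm.pow_const 8).aestronglyMeasurable] at h2
      rw [mul_comm]
      exact h2.trans hm.2
    rw [le_div_iff₀ (by positivity)]
    refine le_trans (mul_le_mul_of_nonneg_right (measureReal_mono ?_) (by positivity)) h1
    intro z hz
    exact pow_le_pow_left₀ hb0.le (le_of_lt hz) 8
  have hsub : {z : ι → 𝓧 | m + k * ε < ‖∑ i, φ (z i)‖} ⊆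
      (⋃ i, {z | b < ‖φ (z i)‖}) ∪
        {z | (∫ z, ‖∑ i, ψ (z i)‖ ∂ν) + k * ε / 2 ≤ ‖∑ i, ψ (z i)‖} := by
    intro z hz
    by_cases h : ∃ i, b < ‖φ (z i)‖
    · exact Or.inl (Set.mem_iUnion.mpr h)
    · right
      push Not at h
      have : ∑ i, ψ (z i) = ∑ i, φ (z i) :=
        Finset.sum_congr rfl fun i _ => by simp only [hψ]; rw [if_pos (h i)]
      simp only [Set.mem_ofPred_eq, this] at hz ⊢
      linarith
  refine (measureReal_mono hsub).trans ((measureReal_union_le _ _).trans ?_)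
  have hU : ν.real (⋃ i, {z : ι → 𝓧 | b < ‖φ (z i)‖}) ≤ K ^ 8 / c ^ 8 / k ^ 7 := by
    refine (measureReal_iUnion_fintype_le _).trans ((Finset.sum_le_sum fun i _ => hlarge i).trans ?_)
    simp only [Finset.sum_const, Finset.card_univ, nsmul_eq_mul, ← hk]
    rw [hb]
    refine le_of_eq ?_
    field_simp
  refine (add_le_add hU hcheb).trans ?_
  rw [← add_div, hT]
  have : 0 ≤ (2 * K ^ 2 / (c * ε)) ^ 7 := by positivity
  exact div_le_div_of_nonneg_right (by linarith) (by positivity)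

end Tail

instance (p : ℕ) : SecondCountableTopology (Mat p) :=
  haveI : ProperSpace (Mat p) := FiniteDimensional.proper ℝ _
  secondCountable_of_proper

/-! ### Second moments of sums of centered vectors -/

section SecondMoment

/-- Integrate the inequality `‖f‖ ≤ ‖f‖² / (2 s) + s / 2`. -/
theorem integral_norm_le_of_sq {Ω V : Type*} [MeasurableSpace Ω] [NormedAddCommGroup V]
    {P : Measure Ω} [IsProbabilityMeasure P] {f : Ω → V} (hf : MemLp f 2 P) {s : ℝ} (hs : 0 < s)
    (h : ∫ ω, ‖f ω‖ ^ 2 ∂P ≤ s ^ 2) : ∫ ω, ‖f ω‖ ∂P ≤ s := by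
  have i2 : Integrable (fun ω => ‖f ω‖ ^ 2) P := (memLp_two_iff_integrable_sq_norm hf.1).1 hf
  have h1 : ∫ ω, ‖f ω‖ ∂P ≤ ∫ ω, (‖f ω‖ ^ 2 * (1 / (2 * s)) + s / 2) ∂P := by
    refine integral_mono (hf.integrable (by norm_num)).norm
      ((i2.mul_const _).add (integrable_const _)) fun ω => ?_
    have : ‖f ω‖ ^ 2 * (1 / (2 * s)) + s / 2 - ‖f ω‖ = (‖f ω‖ - s) ^ 2 / (2 * s) := by
      field_simp; ring
    have h0 : 0 ≤ (‖f ω‖ - s) ^ 2 / (2 * s) := by positivity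
    simp only
    linarith
  rw [integral_add (i2.mul_const _) (integrable_const _), integral_mul_const] at h1
  simp only [integral_const, probReal_univ, one_smul] at h1
  have h2 : (∫ ω, ‖f ω‖ ^ 2 ∂P) * (1 / (2 * s)) ≤ s ^ 2 * (1 / (2 * s)) := by gcongr
  have h3 : s ^ 2 * (1 / (2 * s)) = s / 2 := by field_simp
  linarith

variable {Ω α β V : Type*} [MeasurableSpace Ω] [MeasurableSpace α] [MeasurableSpace β]
  {P : Measure Ω} [IsProbabilityMeasure P]
  [NormedAddCommGroup V] [InnerProductSpace ℝ V] [CompleteSpace V]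

/-- Pythagoras for a centered increment that depends on an independent variable. -/
theorem integral_norm_add_sq_of_indepFun {X : Ω → α} {Y : Ω → β} (h : IndepFun X Y P)
    (hX : Measurable X) (hY : Measurable Y) {F : α → V} {G : α × β → V}
    (hF : StronglyMeasurable F) (hG : StronglyMeasurable G)
    (hF2 : MemLp (fun ω => F (X ω)) 2 P) (hG2 : MemLp (fun ω => G (X ω, Y ω)) 2 P)
    (hGi : ∀ x, Integrable (fun ω => G (x, Y ω)) P) (hG0 : ∀ x, ∫ ω, G (x, Y ω) ∂P = 0) :
    ∫ ω, ‖F (X ω) + G (X ω, Y ω)‖ ^ 2 ∂P =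
      ∫ ω, ‖F (X ω)‖ ^ 2 ∂P + ∫ ω, ‖G (X ω, Y ω)‖ ^ 2 ∂P := by
  have i1 : Integrable (fun ω => ‖F (X ω)‖ ^ 2) P :=
    (memLp_two_iff_integrable_sq_norm hF2.1).1 hF2
  have i2 : Integrable (fun ω => ‖G (X ω, Y ω)‖ ^ 2) P :=
    (memLp_two_iff_integrable_sq_norm hG2.1).1 hG2
  have ic : Integrable (fun ω => inner ℝ (F (X ω)) (G (X ω, Y ω))) P := by
    refine Integrable.mono' (i1.add i2) (hF2.1.inner hG2.1) (ae_of_all _ fun ω => ?_)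
    have h1 := norm_inner_le_norm (𝕜 := ℝ) (F (X ω)) (G (X ω, Y ω))
    simp only [Pi.add_apply]
    nlinarith [sq_nonneg (‖F (X ω)‖ - ‖G (X ω, Y ω)‖), sq_nonneg ‖F (X ω)‖,
      sq_nonneg ‖G (X ω, Y ω)‖]
  have hm : StronglyMeasurable (fun q : α × β => inner ℝ (F q.1) (G q)) :=
    (hF.comp_measurable measurable_fst).inner hG
  have c0 : ∫ ω, inner ℝ (F (X ω)) (G (X ω, Y ω)) ∂P = 0 := by
    have h1 := integral_of_indepFun h hX hY hm
    have h2 := (integrable_iff_of_indepFun h hX hY hm).1 ic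
    simp only at h1 h2
    rw [h1, integral_prod _ h2]
    have : ∀ ω, ∫ ω', inner ℝ (F (X ω)) (G (X ω, Y ω')) ∂P = 0 := fun ω => by
      rw [integral_inner (hGi _), hG0, inner_zero_right]
    simp [this]
  have i3 : Integrable (fun ω => 2 * inner ℝ (F (X ω)) (G (X ω, Y ω))) P := ic.const_mul 2
  have i4 : Integrable (fun ω => ‖F (X ω)‖ ^ 2 + 2 * inner ℝ (F (X ω)) (G (X ω, Y ω))) P :=
    i1.add i3
  simp_rw [norm_add_sq_real]
  rw [integral_add i4 i2, integral_add i1 i3, integral_const_mul, c0]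
  ring

variable {𝓧 ι : Type*} [MeasurableSpace 𝓧] [Fintype ι] {μ : Measure 𝓧} [IsProbabilityMeasure μ]

theorem memLp_comp_eval {W : Type*} [NormedAddCommGroup W] {φ : 𝓧 → W} (h : MemLp φ 2 μ) (i : ι) :
    MemLp (fun z : ι → 𝓧 => φ (z i)) 2 (Measure.pi fun _ : ι => μ) :=
  h.comp_measurePreserving (measurePreserving_eval _ i)

theorem memLp_sum_eval {W : Type*} [NormedAddCommGroup W] {φ : 𝓧 → W} (h : MemLp φ 2 μ)
    (s : Finset ι) :
    MemLp (fun z : ι → 𝓧 => ∑ i ∈ s, φ (z i)) 2 (Measure.pi fun _ : ι => μ) :=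
  memLp_finsetSum s fun i _ => memLp_comp_eval h i

theorem indepFun_sum_eval {E : Type*} [AddCommMonoid E] [MeasurableSpace E] [MeasurableAdd₂ E]
    {φ : 𝓧 → E} (hφ : Measurable φ) {s : Finset ι} {a : ι} (ha : a ∉ s) :
    IndepFun (fun z : ι → 𝓧 => ∑ i ∈ s, φ (z i)) (fun z => φ (z a))
      (Measure.pi fun _ : ι => μ) := by
  have hind : iIndepFun (fun i (z : ι → 𝓧) => φ (z i)) (Measure.pi fun _ : ι => μ) :=
    iIndepFun_pi (μ := fun _ : ι => μ) (X := fun _ => φ) fun i => hφ.aemeasurable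
  have := hind.indepFun_finsetSum_of_notMem (fun i => hφ.comp (measurable_pi_apply i)) ha
  convert this using 1
  ext ω; simp

/-- Second moment of a sum of centered i.i.d. vectors. -/
theorem integral_norm_sum_sq_le [MeasurableSpace V] [BorelSpace V] [SecondCountableTopology V]
    {φ : 𝓧 → V} (hφ : Measurable φ) (h2 : MemLp φ 2 μ) (h0 : ∫ x, φ x ∂μ = 0) (s : Finset ι) :
    ∫ z, ‖∑ i ∈ s, φ (z i)‖ ^ 2 ∂(Measure.pi fun _ : ι => μ) = s.card * ∫ x, ‖φ x‖ ^ 2 ∂μ := by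
  classical
  induction s using Finset.induction_on with
  | empty => simp
  | insert a s ha ih =>
    have key := integral_norm_add_sq_of_indepFun (indepFun_sum_eval (μ := μ) hφ ha)
      (Finset.measurable_sum _ fun i _ => hφ.comp (measurable_pi_apply i))
      (hφ.comp (measurable_pi_apply a)) (F := fun x : V => x) (G := fun q : V × V => q.2)
      stronglyMeasurable_id measurable_snd.stronglyMeasurable (memLp_sum_eval h2 s)
      (memLp_comp_eval h2 a)
      (fun _ => (memLp_comp_eval h2 a).integrable (by norm_num))
      (fun _ => by
        rw [integral_comp_eval (i := a) (f := φ) (μ := fun _ : ι => μ) hφ.aestronglyMeasurable, h0])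
    simp only at key
    have e : ∀ z : ι → 𝓧, ∑ i ∈ insert a s, φ (z i) = ∑ i ∈ s, φ (z i) + φ (z a) := fun z => by
      rw [Finset.sum_insert ha, add_comm]
    simp_rw [e]
    rw [key, ih, integral_comp_eval (i := a) (f := fun x => ‖φ x‖ ^ 2) (μ := fun _ : ι => μ)
      (hφ.norm.pow_const 2).aestronglyMeasurable, Finset.card_insert_of_notMem ha]
    push_cast
    ring

end SecondMoment

/-! ### Products of a centered mean matrix and a centered mean vector -/

section UStatistic

variable {p : ℕ} {𝓧 ι : Type*} [MeasurableSpace 𝓧] [Fintype ι] {μ : Measure 𝓧}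
  [IsProbabilityMeasure μ]

/-- Second moment of the off-diagonal part of the product of a sum of centered i.i.d. matrices and
a sum of centered i.i.d. vectors. -/
theorem integral_norm_offDiag_sq_le {A : 𝓧 → Mat p} {b : 𝓧 → Vec p} (hA : Measurable A)
    (hb : Measurable b) (hA2 : MemLp A 2 μ) (hb2 : MemLp b 2 μ) (hA0 : ∫ x, A x ∂μ = 0)
    (hb0 : ∫ x, b x ∂μ = 0) (s : Finset ι) :
    MemLp (fun z : ι → 𝓧 => (∑ i ∈ s, A (z i)) (∑ i ∈ s, b (z i)) - ∑ i ∈ s, A (z i) (b (z i))) 2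
      (Measure.pi fun _ : ι => μ) ∧
    ∫ z, ‖(∑ i ∈ s, A (z i)) (∑ i ∈ s, b (z i)) - ∑ i ∈ s, A (z i) (b (z i))‖ ^ 2
      ∂(Measure.pi fun _ : ι => μ) ≤
      2 * (s.card : ℝ) ^ 2 * ((∫ x, ‖A x‖ ^ 2 ∂μ) * ∫ x, ‖b x‖ ^ 2 ∂μ) := by
  classical
  set ν := Measure.pi fun _ : ι => μ with hν
  set a2 := ∫ x, ‖A x‖ ^ 2 ∂μ with ha2
  set b2 := ∫ x, ‖b x‖ ^ 2 ∂μ with hb2'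
  have a0 : 0 ≤ a2 := integral_nonneg fun x => by positivity
  have b0 : 0 ≤ b2 := integral_nonneg fun x => by positivity
  have iA2 : Integrable (fun x => ‖A x‖ ^ 2) μ := (memLp_two_iff_integrable_sq_norm hA2.1).1 hA2
  have ib2 : Integrable (fun x => ‖b x‖ ^ 2) μ := (memLp_two_iff_integrable_sq_norm hb2.1).1 hb2
  have app : Continuous fun q : Mat p × Vec p => q.1 q.2 := isBoundedBilinearMap_apply.continuous
  induction s using Finset.induction_on with
  | empty => simp
  | insert a s ha ih =>
    obtain ⟨ihM, ihB⟩ := ih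
    -- Matrix, vector and diagonal term are bundled, so that all partial sums are a function of one
    -- variable independent of the new observation.
    set Ψ : 𝓧 → Mat p × Vec p × Vec p := fun x => (A x, b x, A x (b x)) with hΨ
    have hΨm : Measurable Ψ :=
      hA.prodMk (hb.prodMk (app.measurable.comp (hA.prodMk hb)))
    have hind := indepFun_sum_eval (μ := μ) hΨm ha
    have hsum : ∀ z : ι → 𝓧, ∑ i ∈ s, Ψ (z i) =
        (∑ i ∈ s, A (z i), ∑ i ∈ s, b (z i), ∑ i ∈ s, A (z i) (b (z i))) := fun z => by
      simp only [hΨ]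
      ext1
      · rw [Prod.fst_sum]
      · ext1
        · rw [Prod.snd_sum, Prod.fst_sum]
        · rw [Prod.snd_sum, Prod.snd_sum]
    simp_rw [hsum] at hind
    have mS : Measurable fun z : ι → 𝓧 =>
        (∑ i ∈ s, A (z i), ∑ i ∈ s, b (z i), ∑ i ∈ s, A (z i) (b (z i))) := by
      simp_rw [← hsum]
      exact Finset.measurable_sum _ fun i _ => hΨm.comp (measurable_pi_apply i)
    have ma : Measurable fun z : ι → 𝓧 => Ψ (z a) := hΨm.comp (measurable_pi_apply a)
    -- products of independent factors
    have hindA : IndepFun (fun z : ι → 𝓧 => ∑ i ∈ s, A (z i)) (fun z => b (z a)) ν :=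
      hind.comp (φ := Prod.fst) (ψ := fun q : Mat p × Vec p × Vec p => q.2.1) measurable_fst
        (measurable_fst.comp measurable_snd)
    have hindB : IndepFun (fun z : ι → 𝓧 => ∑ i ∈ s, b (z i)) (fun z => A (z a)) ν :=
      hind.comp (φ := fun q : Mat p × Vec p × Vec p => q.2.1) (ψ := Prod.fst)
        (measurable_fst.comp measurable_snd)
        measurable_fst
    have hindA2 : IndepFun (fun z : ι → 𝓧 => ‖∑ i ∈ s, A (z i)‖ ^ 2) (fun z => ‖b (z a)‖ ^ 2) ν :=
      hindA.comp (φ := fun x => ‖x‖ ^ 2) (ψ := fun x => ‖x‖ ^ 2) (measurable_norm.pow_const 2)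
        (measurable_norm.pow_const 2)
    have hindB2 : IndepFun (fun z : ι → 𝓧 => ‖∑ i ∈ s, b (z i)‖ ^ 2) (fun z => ‖A (z a)‖ ^ 2) ν :=
      hindB.comp (φ := fun x => ‖x‖ ^ 2) (ψ := fun x => ‖x‖ ^ 2) (measurable_norm.pow_const 2)
        (measurable_norm.pow_const 2)
    have mAs : Measurable fun z : ι → 𝓧 => ∑ i ∈ s, A (z i) := measurable_fst.comp mS
    have mbs : Measurable fun z : ι → 𝓧 => ∑ i ∈ s, b (z i) :=
      measurable_fst.comp (measurable_snd.comp mS)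
    have iAs : Integrable (fun z : ι → 𝓧 => ‖∑ i ∈ s, A (z i)‖ ^ 2) ν :=
      (memLp_two_iff_integrable_sq_norm (memLp_sum_eval hA2 s).1).1 (memLp_sum_eval hA2 s)
    have ibs : Integrable (fun z : ι → 𝓧 => ‖∑ i ∈ s, b (z i)‖ ^ 2) ν :=
      (memLp_two_iff_integrable_sq_norm (memLp_sum_eval hb2 s).1).1 (memLp_sum_eval hb2 s)
    have ev : MeasurePreserving (Function.eval a) ν μ := measurePreserving_eval _ a
    have iAa : Integrable (fun z : ι → 𝓧 => ‖A (z a)‖ ^ 2) ν := ev.integrable_comp_of_integrable iA2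
    have iba : Integrable (fun z : ι → 𝓧 => ‖b (z a)‖ ^ 2) ν := ev.integrable_comp_of_integrable ib2
    have eAa : ∫ z : ι → 𝓧, ‖A (z a)‖ ^ 2 ∂ν = a2 :=
      integral_comp_eval (i := a) (f := fun x => ‖A x‖ ^ 2) (μ := fun _ : ι => μ)
        (hA.norm.pow_const 2).aestronglyMeasurable
    have eba : ∫ z : ι → 𝓧, ‖b (z a)‖ ^ 2 ∂ν = b2 :=
      integral_comp_eval (i := a) (f := fun x => ‖b x‖ ^ 2) (μ := fun _ : ι => μ)
        (hb.norm.pow_const 2).aestronglyMeasurable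
    have iAsb : Integrable (fun z : ι → 𝓧 => ‖∑ i ∈ s, A (z i)‖ ^ 2 * ‖b (z a)‖ ^ 2) ν :=
      hindA2.integrable_mul iAs iba
    have iAbs : Integrable (fun z : ι → 𝓧 => ‖∑ i ∈ s, b (z i)‖ ^ 2 * ‖A (z a)‖ ^ 2) ν :=
      hindB2.integrable_mul ibs iAa
    have M1 : MemLp (fun z : ι → 𝓧 => (∑ i ∈ s, A (z i)) (b (z a))) 2 ν := by
      have m : Measurable fun z : ι → 𝓧 => (∑ i ∈ s, A (z i)) (b (z a)) :=
        app.measurable.comp (mAs.prodMk (hb.comp (measurable_pi_apply a)))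
      refine (memLp_two_iff_integrable_sq_norm m.aestronglyMeasurable).2
        (iAsb.mono' (m.norm.pow_const 2).aestronglyMeasurable (ae_of_all _ fun z => ?_))
      rw [Real.norm_eq_abs, abs_of_nonneg (sq_nonneg _), ← mul_pow]
      exact pow_le_pow_left₀ (norm_nonneg _) (ContinuousLinearMap.le_opNorm _ _) 2
    have M2 : MemLp (fun z : ι → 𝓧 => A (z a) (∑ i ∈ s, b (z i))) 2 ν := by
      have m : Measurable fun z : ι → 𝓧 => A (z a) (∑ i ∈ s, b (z i)) :=
        app.measurable.comp ((hA.comp (measurable_pi_apply a)).prodMk mbs)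
      refine (memLp_two_iff_integrable_sq_norm m.aestronglyMeasurable).2
        (iAbs.mono' (m.norm.pow_const 2).aestronglyMeasurable (ae_of_all _ fun z => ?_))
      rw [Real.norm_eq_abs, abs_of_nonneg (sq_nonneg _), ← mul_pow, mul_comm]
      exact pow_le_pow_left₀ (norm_nonneg _) (ContinuousLinearMap.le_opNorm _ _) 2
    have B2 : ∫ z : ι → 𝓧, ‖A (z a) (∑ i ∈ s, b (z i))‖ ^ 2 ∂ν ≤ s.card * (a2 * b2) := by
      have h1 : ∫ z : ι → 𝓧, ‖A (z a) (∑ i ∈ s, b (z i))‖ ^ 2 ∂ν ≤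
          ∫ z : ι → 𝓧, ‖∑ i ∈ s, b (z i)‖ ^ 2 * ‖A (z a)‖ ^ 2 ∂ν := by
        refine integral_mono ((memLp_two_iff_integrable_sq_norm M2.1).1 M2) iAbs fun z => ?_
        simp only
        rw [← mul_pow, mul_comm ‖∑ i ∈ s, b (z i)‖]
        exact pow_le_pow_left₀ (norm_nonneg _) (ContinuousLinearMap.le_opNorm _ _) 2
      refine h1.trans (le_of_eq ?_)
      rw [hindB2.integral_fun_mul_eq_mul_integral ibs.1 iAa.1, eAa,
        integral_norm_sum_sq_le hb hb2 hb0 s]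
      ring
    -- Freezing the new vector `v = b (z a)` first turns the sum of matrices into a sum of centered
    -- vectors `A v`. A bound through the operator norm of the sum would cost a factor `p`.
    have B1 : ∫ z : ι → 𝓧, ‖(∑ i ∈ s, A (z i)) (b (z a))‖ ^ 2 ∂ν ≤ s.card * (a2 * b2) := by
      have hm : StronglyMeasurable fun q : Mat p × Vec p => ‖q.1 q.2‖ ^ 2 :=
        (app.norm.pow 2).stronglyMeasurable
      have h1 := integral_of_indepFun hindA mAs (hb.comp (measurable_pi_apply a)) hm
      have h2 := (integrable_iff_of_indepFun hindA mAs (hb.comp (measurable_pi_apply a)) hm).1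
        ((memLp_two_iff_integrable_sq_norm M1.1).1 M1)
      simp only at h1 h2
      rw [h1, integral_prod_symm _ h2]
      have h3 : ∀ v : Vec p, ∫ z : ι → 𝓧, ‖(∑ i ∈ s, A (z i)) v‖ ^ 2 ∂ν ≤
          s.card * a2 * ‖v‖ ^ 2 := fun v => by
        have mv : Measurable fun x => A x v := app.measurable.comp (hA.prodMk measurable_const)
        have nv : ∀ x, ‖A x v‖ ^ 2 ≤ ‖A x‖ ^ 2 * ‖v‖ ^ 2 := fun x => by
          rw [← mul_pow]
          exact pow_le_pow_left₀ (norm_nonneg _) (ContinuousLinearMap.le_opNorm _ _) 2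
        have i2 : Integrable (fun x => ‖A x v‖ ^ 2) μ :=
          (iA2.mul_const (‖v‖ ^ 2)).mono' (mv.norm.pow_const 2).aestronglyMeasurable
            (ae_of_all _ fun x => by
              rw [Real.norm_eq_abs, abs_of_nonneg (sq_nonneg _)]; exact nv x)
        have h4 := integral_norm_sum_sq_le (ι := ι) mv
          ((memLp_two_iff_integrable_sq_norm mv.aestronglyMeasurable).2 i2)
          (by rw [← ContinuousLinearMap.integral_apply (hA2.integrable (by norm_num)), hA0]; rfl) s
        have h5 : ∀ z : ι → 𝓧, (∑ i ∈ s, A (z i)) v = ∑ i ∈ s, A (z i) v := fun z => by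
          rw [_root_.sum_apply]
        simp_rw [h5]
        rw [h4, mul_assoc]
        refine mul_le_mul_of_nonneg_left ?_ (Nat.cast_nonneg _)
        rw [ha2, ← integral_mul_const]
        exact integral_mono i2 (iA2.mul_const _) nv
      refine (integral_mono h2.integral_prod_right (iba.const_mul (s.card * a2))
        fun z => h3 (b (z a))).trans (le_of_eq ?_)
      rw [integral_const_mul, eba, mul_assoc]
    have e : ∀ z : ι → 𝓧, (∑ i ∈ insert a s, A (z i)) (∑ i ∈ insert a s, b (z i)) -
        ∑ i ∈ insert a s, A (z i) (b (z i)) =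
        ((∑ i ∈ s, A (z i)) (∑ i ∈ s, b (z i)) - ∑ i ∈ s, A (z i) (b (z i))) +
          ((∑ i ∈ s, A (z i)) (b (z a)) + A (z a) (∑ i ∈ s, b (z i))) := fun z => by
      rw [Finset.sum_insert ha, Finset.sum_insert ha, Finset.sum_insert ha]
      simp only [map_add, _root_.add_apply]
      abel
    simp_rw [e]
    refine ⟨ihM.add (M1.add M2), ?_⟩
    have iA := hA2.integrable (q := 2) (by norm_num)
    have ib := hb2.integrable (q := 2) (by norm_num)
    have iAav : Integrable (fun z : ι → 𝓧 => A (z a)) ν := ev.integrable_comp_of_integrable iA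
    have ibav : Integrable (fun z : ι → 𝓧 => b (z a)) ν := ev.integrable_comp_of_integrable ib
    have eA0 : ∫ z : ι → 𝓧, A (z a) ∂ν = 0 := by
      rw [← hA0]
      exact integral_comp_eval (i := a) (f := A) (μ := fun _ : ι => μ) hA.aestronglyMeasurable
    have eb0 : ∫ z : ι → 𝓧, b (z a) ∂ν = 0 := by
      rw [← hb0]
      exact integral_comp_eval (i := a) (f := b) (μ := fun _ : ι => μ) hb.aestronglyMeasurable
    -- Given the past, the increment of the off-diagonal part is linear in the centered pair of the
    -- new observation, so it is orthogonal to what came before.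
    have key := integral_norm_add_sq_of_indepFun hind mS ma
      (F := fun q : Mat p × Vec p × Vec p => q.1 q.2.1 - q.2.2)
      (G := fun q : (Mat p × Vec p × Vec p) × (Mat p × Vec p × Vec p) =>
        q.1.1 q.2.2.1 + q.2.1 q.1.2.1)
      (Continuous.stronglyMeasurable (by fun_prop)) (Continuous.stronglyMeasurable (by fun_prop))
      ihM (M1.add M2)
      (fun x => (x.1.integrable_comp ibav).add (iAav.apply_continuousLinearMap x.2.1))
      (fun x => by
        have i1 : Integrable (fun z : ι → 𝓧 => x.1 (b (z a))) ν := x.1.integrable_comp ibav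
        have i2 : Integrable (fun z : ι → 𝓧 => A (z a) x.2.1) ν :=
          iAav.apply_continuousLinearMap x.2.1
        simp only [hΨ]
        rw [integral_add i1 i2, x.1.integral_comp_comm ibav, eb0,
          ← ContinuousLinearMap.integral_apply iAav, eA0]
        simp)
    simp only [hΨ] at key
    rw [key]
    have iM1 := (memLp_two_iff_integrable_sq_norm M1.1).1 M1
    have iM2 := (memLp_two_iff_integrable_sq_norm M2.1).1 M2
    have h6 : ∫ z : ι → 𝓧, ‖(∑ i ∈ s, A (z i)) (b (z a)) + A (z a) (∑ i ∈ s, b (z i))‖ ^ 2 ∂ν ≤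
        ∫ z : ι → 𝓧, (2 * ‖(∑ i ∈ s, A (z i)) (b (z a))‖ ^ 2 +
          2 * ‖A (z a) (∑ i ∈ s, b (z i))‖ ^ 2) ∂ν := by
      refine integral_mono ((memLp_two_iff_integrable_sq_norm (M1.add M2).1).1 (M1.add M2))
        ((iM1.const_mul 2).add (iM2.const_mul 2)) fun z => ?_
      have h7 := pow_le_pow_left₀ (norm_nonneg _)
        (norm_add_le ((∑ i ∈ s, A (z i)) (b (z a))) (A (z a) (∑ i ∈ s, b (z i)))) 2
      simp only
      nlinarith [sq_nonneg (‖(∑ i ∈ s, A (z i)) (b (z a))‖ - ‖A (z a) (∑ i ∈ s, b (z i))‖)]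
    rw [integral_add (iM1.const_mul 2) (iM2.const_mul 2), integral_const_mul,
      integral_const_mul] at h6
    rw [Finset.card_insert_of_notMem ha, Nat.cast_add, Nat.cast_one]
    rw [← hν]
    -- The new observation adds at most `4 |s|` to the coefficient, and `2 |s|² + 4 |s| ≤ 2 (|s| +
    -- 1)²`.
    nlinarith [mul_nonneg a0 b0]

/-- The product of the mean of centered i.i.d. matrices and the mean of centered i.i.d. vectors is
of the order of the inverse of the sample size. -/
theorem integral_norm_mean_apply_mean_le [Nonempty ι] {A : 𝓧 → Mat p} {b : 𝓧 → Vec p}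
    (hA : Measurable A) (hb : Measurable b) (hA2 : MemLp A 2 μ) (hb2 : MemLp b 2 μ)
    (hA0 : ∫ x, A x ∂μ = 0) (hb0 : ∫ x, b x ∂μ = 0) {α β : ℝ} (hα : 0 < α) (hβ : 0 < β)
    (hAα : ∫ x, ‖A x‖ ^ 2 ∂μ ≤ α ^ 2) (hbβ : ∫ x, ‖b x‖ ^ 2 ∂μ ≤ β ^ 2) :
    Integrable (fun z : ι → 𝓧 => ‖(∑ i, A (z i)) (∑ i, b (z i))‖) (Measure.pi fun _ : ι => μ) ∧
    ∫ z, ‖(∑ i, A (z i)) (∑ i, b (z i))‖ ∂(Measure.pi fun _ : ι => μ) ≤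
      3 * (Fintype.card ι : ℝ) * (α * β) := by
  set ν := Measure.pi fun _ : ι => μ with hν
  set k : ℝ := (Fintype.card ι : ℝ) with hk
  have hk0 : 0 < k := by rw [hk]; exact_mod_cast Fintype.card_pos
  have iA2 : Integrable (fun x => ‖A x‖ ^ 2) μ := (memLp_two_iff_integrable_sq_norm hA2.1).1 hA2
  have ib2 : Integrable (fun x => ‖b x‖ ^ 2) μ := (memLp_two_iff_integrable_sq_norm hb2.1).1 hb2
  obtain ⟨M, B⟩ := integral_norm_offDiag_sq_le (ι := ι) hA hb hA2 hb2 hA0 hb0 Finset.univ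
  -- The off-diagonal part contributes `2 k α β`, as `2 k² ≤ (2 k)²`. The diagonal part contributes
  -- `k α β` by Young's inequality with weights adapted to `α` and `β`.
  have h1 : ∫ z, ‖(∑ i, A (z i)) (∑ i, b (z i)) - ∑ i, A (z i) (b (z i))‖ ∂ν ≤
      2 * k * (α * β) := by
    refine integral_norm_le_of_sq M (by positivity) (B.trans ?_)
    rw [Finset.card_univ, ← hk]
    have : (∫ x, ‖A x‖ ^ 2 ∂μ) * ∫ x, ‖b x‖ ^ 2 ∂μ ≤ α ^ 2 * β ^ 2 :=
      mul_le_mul hAα hbβ (integral_nonneg fun x => by positivity) (by positivity)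
    calc 2 * k ^ 2 * ((∫ x, ‖A x‖ ^ 2 ∂μ) * ∫ x, ‖b x‖ ^ 2 ∂μ) ≤ 2 * k ^ 2 * (α ^ 2 * β ^ 2) := by
          gcongr
      _ ≤ 4 * k ^ 2 * (α ^ 2 * β ^ 2) := by gcongr; norm_num
      _ = _ := by ring
  have app : Continuous fun q : Mat p × Vec p => q.1 q.2 := isBoundedBilinearMap_apply.continuous
  have mAb : Measurable fun x => A x (b x) := app.measurable.comp (hA.prodMk hb)
  have bd : ∀ x, ‖A x (b x)‖ ≤ ‖A x‖ ^ 2 * (β / (2 * α)) + ‖b x‖ ^ 2 * (α / (2 * β)) := fun x => by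
    refine (ContinuousLinearMap.le_opNorm _ _).trans ?_
    have : ‖A x‖ ^ 2 * (β / (2 * α)) + ‖b x‖ ^ 2 * (α / (2 * β)) - ‖A x‖ * ‖b x‖ =
      (β * ‖A x‖ - α * ‖b x‖) ^ 2 / (2 * α * β) := by field_simp; ring
    have h0 : 0 ≤ (β * ‖A x‖ - α * ‖b x‖) ^ 2 / (2 * α * β) := by positivity
    linarith
  have ibd : Integrable
      (fun x => ‖A x‖ ^ 2 * (β / (2 * α)) + ‖b x‖ ^ 2 * (α / (2 * β))) μ :=
    (iA2.mul_const _).add (ib2.mul_const _)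
  have iAb : Integrable (fun x => A x (b x)) μ :=
    ibd.mono' mAb.aestronglyMeasurable (ae_of_all _ bd)
  have eAb : ∫ x, ‖A x (b x)‖ ∂μ ≤ α * β := by
    refine (integral_mono iAb.norm ibd bd).trans ?_
    rw [integral_add (iA2.mul_const _) (ib2.mul_const _), integral_mul_const, integral_mul_const]
    calc _ ≤ α ^ 2 * (β / (2 * α)) + β ^ 2 * (α / (2 * β)) := by gcongr
      _ = α * β := by field_simp; ring
  have ie : ∀ i : ι, Integrable (fun z : ι → 𝓧 => ‖A (z i) (b (z i))‖) ν := fun i =>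
    (measurePreserving_eval (fun _ : ι => μ) i).integrable_comp_of_integrable iAb.norm
  have is : Integrable (fun z : ι → 𝓧 => ∑ i, ‖A (z i) (b (z i))‖) ν :=
    integrable_finsetSum _ fun i _ => ie i
  have h2 : ∫ z : ι → 𝓧, ∑ i, ‖A (z i) (b (z i))‖ ∂ν ≤ k * (α * β) := by
    rw [integral_finsetSum _ fun i _ => ie i]
    refine (Finset.sum_le_sum (g := fun _ => α * β) fun i _ => ?_).trans (by simp [hk])
    rw [integral_comp_eval (i := i) (f := fun x => ‖A x (b x)‖) (μ := fun _ : ι => μ)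
      mAb.norm.aestronglyMeasurable]
    exact eAb
  have iM : Integrable
      (fun z => ‖(∑ i, A (z i)) (∑ i, b (z i)) - ∑ i, A (z i) (b (z i))‖) ν :=
    (M.integrable (by norm_num)).norm
  have hle : ∀ z : ι → 𝓧, ‖(∑ i, A (z i)) (∑ i, b (z i))‖ ≤
      ‖(∑ i, A (z i)) (∑ i, b (z i)) - ∑ i, A (z i) (b (z i))‖ + ∑ i, ‖A (z i) (b (z i))‖ :=
    fun z => by
      have := norm_add_le ((∑ i, A (z i)) (∑ i, b (z i)) - ∑ i, A (z i) (b (z i)))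
        (∑ i, A (z i) (b (z i)))
      rw [sub_add_cancel] at this
      exact this.trans (add_le_add le_rfl (norm_sum_le _ _))
  have mQ : Measurable fun z : ι → 𝓧 => (∑ i, A (z i)) (∑ i, b (z i)) :=
    app.measurable.comp ((Finset.measurable_sum _ fun i _ => hA.comp (measurable_pi_apply i)).prodMk
      (Finset.measurable_sum _ fun i _ => hb.comp (measurable_pi_apply i)))
  have iQ : Integrable (fun z : ι → 𝓧 => ‖(∑ i, A (z i)) (∑ i, b (z i))‖) ν :=
    (iM.add is).mono' mQ.norm.aestronglyMeasurable (ae_of_all _ fun z => by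
      rw [norm_norm]; exact hle z)
  refine ⟨iQ, (integral_mono iQ (iM.add is) hle).trans ?_⟩
  simp only [Pi.add_apply]
  rw [integral_add iM is]
  linarith

end UStatistic

/-! ### Gradient, Hessian and third derivative -/

section Calculus

variable {p : ℕ}

/-- The Riesz isomorphism from functionals to vectors, as a continuous linear map. -/
def rieszMap (p : ℕ) : (Vec p →L[ℝ] ℝ) →L[ℝ] Vec p :=
  LinearMap.toContinuousLinearMap
    { toFun := (InnerProductSpace.toDual ℝ (Vec p)).symm
      map_add' := map_add _
      map_smul' := fun c x => by simp }

theorem gradient_eq_rieszMap (f : Vec p → ℝ) (θ : Vec p) :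
    gradient f θ = rieszMap p (fderiv ℝ f θ) := rfl

theorem inner_rieszMap (L : Vec p →L[ℝ] ℝ) (u : Vec p) : inner ℝ (rieszMap p L) u = L u :=
  InnerProductSpace.toDual_symm_apply

theorem inner_gradient (f : Vec p → ℝ) (θ u : Vec p) :
    inner ℝ (gradient f θ) u = fderiv ℝ f θ u := inner_rieszMap _ _

theorem contDiffAt_gradient {f : Vec p → ℝ} {θ : Vec p} (h : ContDiffAt ℝ 3 f θ) :
    ContDiffAt ℝ 2 (gradient f) θ :=
  (rieszMap p).contDiff.contDiffAt.comp θ (h.fderiv_right (m := 2) (by norm_num))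

theorem contDiffAt_hess {f : Vec p → ℝ} {θ : Vec p} (h : ContDiffAt ℝ 3 f θ) :
    ContDiffAt ℝ 1 (hess f) θ :=
  (contDiffAt_gradient h).fderiv_right (m := 1) (by norm_num)

theorem hasFDerivAt_gradient {f : Vec p → ℝ} {θ : Vec p} (h : ContDiffAt ℝ 3 f θ) :
    HasFDerivAt (gradient f) (hess f θ) θ :=
  ((contDiffAt_gradient h).differentiableAt (by norm_num)).hasFDerivAt

theorem hasFDerivAt_hess {f : Vec p → ℝ} {θ : Vec p} (h : ContDiffAt ℝ 3 f θ) :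
    HasFDerivAt (hess f) (third f θ) θ :=
  ((contDiffAt_hess h).differentiableAt (by norm_num)).hasFDerivAt

/-- Relates the Hessian, a derivative of the gradient vector, to the second derivative as a bilinear
form, for which Schwarz's theorem gives symmetry. -/
theorem hess_eq_rieszMap {f : Vec p → ℝ} {θ : Vec p} (h : ContDiffAt ℝ 3 f θ) (u : Vec p) :
    hess f θ u = rieszMap p (fderiv ℝ (fderiv ℝ f) θ u) := by
  have h1 : DifferentiableAt ℝ (fderiv ℝ f) θ :=
    (h.fderiv_right (m := 2) (by norm_num)).differentiableAt (by norm_num)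
  have h2 : HasFDerivAt (gradient f) ((rieszMap p).comp (fderiv ℝ (fderiv ℝ f) θ)) θ :=
    (rieszMap p).hasFDerivAt.comp θ h1.hasFDerivAt
  rw [(hasFDerivAt_gradient h).unique h2]
  rfl

theorem inner_hess_symm {f : Vec p → ℝ} {θ : Vec p} (h : ContDiffAt ℝ 3 f θ) (u v : Vec p) :
    inner ℝ (hess f θ u) v = inner ℝ u (hess f θ v) := by
  have h1 : IsSymmSndFDerivAt ℝ f θ := h.isSymmSndFDerivAt (by simp; norm_num)
  rw [real_inner_comm (hess f θ v) u, hess_eq_rieszMap h, hess_eq_rieszMap h, inner_rieszMap, inner_rieszMap]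
  exact h1.eq u v

variable {ι : Type*} [Fintype ι]

theorem gradient_smul_sum {f : ι → Vec p → ℝ} {θ : Vec p} (c : ℝ)
    (h : ∀ i, DifferentiableAt ℝ (f i) θ) :
    gradient (fun θ => c * ∑ i, f i θ) θ = c • ∑ i, gradient (f i) θ := by
  have h1 : HasFDerivAt (fun θ => c * ∑ i, f i θ) (c • ∑ i, fderiv ℝ (f i) θ) θ :=
    (HasFDerivAt.fun_sum fun i _ => (h i).hasFDerivAt).const_mul c
  simp_rw [gradient_eq_rieszMap]
  rw [h1.fderiv, map_smul, map_sum]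

/-- The formula for the gradient of a sum must hold on a neighbourhood in order to be differentiated
again; likewise for the Hessian. -/
theorem eventually_contDiffAt {f : ι → Vec p → ℝ} {θ : Vec p} (h : ∀ i, ContDiffAt ℝ 3 (f i) θ) :
    ∀ᶠ x in 𝓝 θ, ∀ i, ContDiffAt ℝ 3 (f i) x :=
  eventually_all.2 fun i => (h i).eventually (by simp)

theorem hess_smul_sum {f : ι → Vec p → ℝ} {θ : Vec p} (c : ℝ)
    (h : ∀ i, ContDiffAt ℝ 3 (f i) θ) :
    hess (fun θ => c * ∑ i, f i θ) θ = c • ∑ i, hess (f i) θ := by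
  have h1 : gradient (fun θ => c * ∑ i, f i θ) =ᶠ[𝓝 θ] fun x => c • ∑ i, gradient (f i) x :=
    (eventually_contDiffAt h).mono fun x hx =>
      gradient_smul_sum c fun i => (hx i).differentiableAt (by norm_num)
  have h2 : HasFDerivAt (fun x => c • ∑ i, gradient (f i) x) (c • ∑ i, hess (f i) θ) θ :=
    (HasFDerivAt.fun_sum fun i _ => hasFDerivAt_gradient (h i)).const_smul c
  rw [hess, h1.fderiv_eq, h2.fderiv]

theorem third_smul_sum {f : ι → Vec p → ℝ} {θ : Vec p} (c : ℝ)
    (h : ∀ i, ContDiffAt ℝ 3 (f i) θ) :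
    third (fun θ => c * ∑ i, f i θ) θ = c • ∑ i, third (f i) θ := by
  have h1 : hess (fun θ => c * ∑ i, f i θ) =ᶠ[𝓝 θ] fun x => c • ∑ i, hess (f i) x :=
    (eventually_contDiffAt h).mono fun x hx => hess_smul_sum c hx
  have h2 : HasFDerivAt (fun x => c • ∑ i, hess (f i) x) (c • ∑ i, third (f i) θ) θ :=
    (HasFDerivAt.fun_sum fun i _ => hasFDerivAt_hess (h i)).const_smul c
  rw [third, h1.fderiv_eq, h2.fderiv]

end Calculus

/-! ### Minimizers of smooth convex losses -/

section Losses

variable {p : ℕ}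

/-- A convex loss, three times differentiable near `θ₀` with Lipschitz second and third
derivatives. -/
structure SmoothLoss (Θ : Set (Vec p)) (θ₀ : Vec p) (δ K : ℝ) (f : Vec p → ℝ) : Prop where
  smooth : ∀ θ ∈ Metric.closedBall θ₀ δ, ContDiffAt ℝ 3 f θ
  convexOn : ConvexOn ℝ Θ f
  hess_lip : ∀ θ ∈ Metric.closedBall θ₀ δ, ∀ θ' ∈ Metric.closedBall θ₀ δ,
    ‖hess f θ - hess f θ'‖ ≤ K * ‖θ - θ'‖
  third_lip : ∀ θ ∈ Metric.closedBall θ₀ δ, ∀ θ' ∈ Metric.closedBall θ₀ δ,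
    ‖third f θ - third f θ'‖ ≤ K * ‖θ - θ'‖

variable {Θ : Set (Vec p)} {θ₀ : Vec p} {δ K : ℝ} {f : Vec p → ℝ}

/-- Mean value inequality for the gradient minus its linearization at `θ₀`: on the ball of radius
`r` the Hessian differs from its value at the center by at most `K r`. -/
theorem SmoothLoss.norm_gradient_sub_le (h : SmoothLoss Θ θ₀ δ K f) (hK : 0 ≤ K) {r : ℝ}
    (hr : r ≤ δ) {x y : Vec p} (hx : ‖x - θ₀‖ ≤ r) (hy : ‖y - θ₀‖ ≤ r) :
    ‖gradient f y - gradient f x - hess f θ₀ (y - x)‖ ≤ K * r * ‖y - x‖ := by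
  have hr0 : 0 ≤ r := (norm_nonneg _).trans hx
  refine Convex.norm_image_sub_le_of_norm_hasFDerivWithin_le' (s := Metric.closedBall θ₀ r)
    (f' := hess f) (fun z hz => ?_) (fun z hz => ?_) (convex_closedBall _ _)
    (by simpa [dist_eq_norm] using hx) (by simpa [dist_eq_norm] using hy)
  · exact (hasFDerivAt_gradient (h.smooth z
      (Metric.closedBall_subset_closedBall hr hz))).hasFDerivWithinAt
  · refine (h.hess_lip z (Metric.closedBall_subset_closedBall hr hz) θ₀
      (Metric.mem_closedBall_self (hr0.trans hr))).trans ?_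
    rw [Metric.mem_closedBall, dist_eq_norm] at hz
    gcongr

/-- The same mean value argument one order higher, on the ball whose radius is `‖x - θ₀‖` itself;
hence the square. -/
theorem SmoothLoss.norm_hess_sub_le (h : SmoothLoss Θ θ₀ δ K f) (hK : 0 ≤ K) {x : Vec p}
    (hx : ‖x - θ₀‖ ≤ δ) :
    ‖hess f x - hess f θ₀ - third f θ₀ (x - θ₀)‖ ≤ K * ‖x - θ₀‖ ^ 2 := by
  have hb := Metric.closedBall_subset_closedBall (x := θ₀) hx
  rw [sq, ← mul_assoc]
  refine Convex.norm_image_sub_le_of_norm_hasFDerivWithin_le'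
    (s := Metric.closedBall θ₀ ‖x - θ₀‖)
    (f' := third f) (fun z hz => ?_) (fun z hz => ?_) (convex_closedBall _ _)
    (Metric.mem_closedBall_self (norm_nonneg _)) (by simp [dist_eq_norm])
  · exact (hasFDerivAt_hess (h.smooth z (hb hz))).hasFDerivWithinAt
  · refine (h.third_lip z (hb hz) θ₀
      (Metric.mem_closedBall_self ((norm_nonneg _).trans hx))).trans ?_
    rw [Metric.mem_closedBall, dist_eq_norm] at hz
    gcongr

/-- The derivative of a convex function along a segment is nonpositive if its value at the end is
not larger. -/
theorem inner_gradient_nonpos_of_le (hf : ConvexOn ℝ Θ f) {x y : Vec p} (hx : x ∈ Θ) (hy : y ∈ Θ)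
    (hd : DifferentiableAt ℝ f x) (hle : f y ≤ f x) : inner ℝ (gradient f x) (y - x) ≤ 0 := by
  have hl : HasDerivAt (fun t : ℝ => f (x + t • (y - x))) (inner ℝ (gradient f x) (y - x)) 0 := by
    rw [inner_gradient]
    have h1 : HasDerivAt (fun t : ℝ => x + t • (y - x)) (y - x) 0 := by
      simpa using ((hasDerivAt_id (0 : ℝ)).smul_const (y - x)).const_add x
    have h2 : HasFDerivAt f (fderiv ℝ f x) (x + (0 : ℝ) • (y - x)) := by
      simpa using hd.hasFDerivAt
    exact h2.comp_hasDerivAt 0 h1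
  refine le_of_tendsto (hl.tendsto_slope_zero_right) ?_
  filter_upwards [Ioo_mem_nhdsGT (show (0 : ℝ) < 1 by norm_num)] with t ht
  have h3 := hf.2 hx hy (sub_nonneg.2 ht.2.le) ht.1.le (by ring)
  have h4 : (1 - t) • x + t • y = x + t • (y - x) := by
    rw [sub_smul, one_smul, smul_sub]; abel
  rw [h4] at h3
  simp only [zero_add, zero_smul, add_zero, smul_eq_mul] at h3 ⊢
  refine mul_nonpos_of_nonneg_of_nonpos (inv_nonneg.2 ht.1.le) ?_
  nlinarith [ht.1]

/-- A minimizer of a loss that is locally strongly convex near `θ₀` is close to `θ₀` if the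
gradient at `θ₀` is small. -/
theorem SmoothLoss.argmin_near (h : SmoothLoss Θ θ₀ δ K f) (hK : 0 ≤ K)
    (hB : Metric.closedBall θ₀ δ ⊆ Θ) {τ r : ℝ} (hτ : 0 < τ) (hr : 0 < r) (hrδ : r < δ)
    (hKr : K * r ≤ τ / 4) (hcoer : ∀ u, 3 * τ / 4 * ‖u‖ ^ 2 ≤ inner ℝ (hess f θ₀ u) u)
    (hg : ‖gradient f θ₀‖ < τ / 2 * r) {θ : Vec p} (hθ : IsArgmin f Θ θ) :
    gradient f θ = 0 ∧ ‖θ - θ₀‖ ≤ 2 / τ * ‖gradient f θ₀‖ ∧ ‖θ - θ₀‖ ≤ r := by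
  -- The Hessian at `θ₀` is coercive with constant `3 τ / 4`, and its variation over the ball
  -- consumes `τ / 4`.
  have hmono : ∀ x, ‖x - θ₀‖ ≤ r → τ / 2 * ‖x - θ₀‖ ^ 2 ≤
      inner ℝ (gradient f x - gradient f θ₀) (x - θ₀) := fun x hx => by
    have h1 := h.norm_gradient_sub_le hK hrδ.le (x := θ₀) (y := x) (by simpa using hr.le) hx
    have h2 := hcoer (x - θ₀)
    have h3 := abs_real_inner_le_norm (gradient f x - gradient f θ₀ - hess f θ₀ (x - θ₀)) (x - θ₀)
    have h4 : inner ℝ (gradient f x - gradient f θ₀) (x - θ₀) =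
        inner ℝ (gradient f x - gradient f θ₀ - hess f θ₀ (x - θ₀)) (x - θ₀) +
          inner ℝ (hess f θ₀ (x - θ₀)) (x - θ₀) := by
      rw [← inner_add_left, sub_add_cancel]
    have h5 : ‖gradient f x - gradient f θ₀ - hess f θ₀ (x - θ₀)‖ * ‖x - θ₀‖ ≤
        τ / 4 * ‖x - θ₀‖ ^ 2 := by
      rw [sq, ← mul_assoc]
      refine mul_le_mul_of_nonneg_right (h1.trans ?_) (norm_nonneg _)
      gcongr
    have h6 := neg_abs_le
      (inner ℝ (gradient f x - gradient f θ₀ - hess f θ₀ (x - θ₀)) (x - θ₀) : ℝ)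
    linarith
  have hδ : 0 ≤ δ := (hr.trans hrδ).le
  have h0 : θ₀ ∈ Θ := hB (Metric.mem_closedBall_self hδ)
  have hin : ‖θ - θ₀‖ < r := by
    -- If `θ` were at distance at least `r`, the segment from `θ₀` to `θ` would meet the sphere of
    -- radius `r` in a point `x`. There the derivative towards `θ₀` is negative by strong
    -- monotonicity, and the derivative towards `θ` is nonpositive by minimality. These directions
    -- are opposite, a contradiction.
    by_contra hcon
    rw [not_lt] at hcon
    set t : ℝ := r / ‖θ - θ₀‖ with ht
    have hn : 0 < ‖θ - θ₀‖ := hr.trans_le hcon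
    have ht0 : 0 < t := by positivity
    have ht1 : t ≤ 1 := by rw [ht, div_le_one hn]; exact hcon
    set x : Vec p := θ₀ + t • (θ - θ₀) with hx
    have hxθ : x - θ₀ = t • (θ - θ₀) := by rw [hx]; abel
    have hxn : ‖x - θ₀‖ = r := by
      rw [hxθ, norm_smul, Real.norm_eq_abs, abs_of_pos ht0, ht]
      field_simp
    have hxB : x ∈ Metric.closedBall θ₀ δ := by
      rw [Metric.mem_closedBall, dist_eq_norm, hxn]; exact hrδ.le
    have h1 : inner ℝ (gradient f x) (θ₀ - x) < 0 := by
      have h2 := hmono x hxn.le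
      rw [inner_sub_left] at h2
      have h3 := (neg_abs_le (inner ℝ (gradient f θ₀) (x - θ₀) : ℝ))
      have h4 := abs_real_inner_le_norm (gradient f θ₀) (x - θ₀)
      rw [hxn] at h2 h4
      have h5 : inner ℝ (gradient f x) (θ₀ - x) = - inner ℝ (gradient f x) (x - θ₀) := by
        rw [← inner_neg_right, neg_sub]
      rw [h5]
      nlinarith
    have h2 : inner ℝ (gradient f x) (θ - x) ≤ 0 :=
      inner_gradient_nonpos_of_le h.convexOn (hB hxB) hθ.1
        ((h.smooth x hxB).differentiableAt (by norm_num)) (hθ.2 (hB hxB))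
    have h3 : (0 : Vec p) = t • (θ - x) + (1 - t) • (θ₀ - x) := by
      rw [hx]; module
    have h4 : inner ℝ (gradient f x) (0 : Vec p) =
        t * inner ℝ (gradient f x) (θ - x) + (1 - t) * inner ℝ (gradient f x) (θ₀ - x) := by
      rw [h3, inner_add_right, inner_smul_right, inner_smul_right]
    rw [inner_zero_right] at h4
    -- If `t = 1`, the convex combination gives the direction to `θ₀` weight zero. In that case `x =
    -- θ`, which is interior because `r < δ`, so the gradient vanishes there.
    rcases eq_or_lt_of_le ht1 with ht1' | ht1'
    · have hxx : x = θ := by rw [hx, ht1']; module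
      have h5 := hmono x hxn.le
      have hloc : IsLocalMin f θ := by
        filter_upwards [Metric.ball_mem_nhds θ (sub_pos.2 (show ‖θ - θ₀‖ < δ by
          rw [← hxx, hxn]; exact hrδ))] with y hy
        refine hθ.2 (hB ?_)
        rw [Metric.mem_ball, dist_eq_norm] at hy
        rw [Metric.mem_closedBall, dist_eq_norm]
        have := norm_add_le (y - θ) (θ - θ₀)
        rw [sub_add_sub_cancel] at this
        linarith
      have hgz : gradient f θ = 0 := by rw [gradient_eq_rieszMap, hloc.fderiv_eq_zero, map_zero]
      rw [hxx, hgz, inner_zero_left] at h1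
      exact lt_irrefl _ h1
    · nlinarith
  have hloc : IsLocalMin f θ := by
    filter_upwards [Metric.ball_mem_nhds θ (sub_pos.2 (hin.trans hrδ))] with y hy
    refine hθ.2 (hB ?_)
    rw [Metric.mem_ball, dist_eq_norm] at hy
    rw [Metric.mem_closedBall, dist_eq_norm]
    have := norm_add_le (y - θ) (θ - θ₀)
    rw [sub_add_sub_cancel] at this
    linarith
  have hgz : gradient f θ = 0 := by rw [gradient_eq_rieszMap, hloc.fderiv_eq_zero, map_zero]
  refine ⟨hgz, ?_, hin.le⟩
  have h1 := hmono θ hin.le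
  rw [hgz, zero_sub, inner_neg_left] at h1
  have h2 := (neg_abs_le (inner ℝ (gradient f θ₀) (θ - θ₀) : ℝ))
  have h3 := abs_real_inner_le_norm (gradient f θ₀) (θ - θ₀)
  rcases eq_or_lt_of_le (norm_nonneg (θ - θ₀)) with h4 | h4
  · rw [← h4]; positivity
  · have h5 : τ / 2 * ‖θ - θ₀‖ ≤ ‖gradient f θ₀‖ := by
      by_contra hc
      rw [not_le] at hc
      nlinarith
    rw [div_mul_eq_mul_div, le_div_iff₀ hτ]
    linarith

end Losses

/-! ### Averages over workers -/

section Average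

variable {M : ℕ} {V W : Type*} [NormedAddCommGroup V] [NormedSpace ℝ V] [NormedAddCommGroup W]
  [NormedSpace ℝ W]

theorem norm_avg_le (a : Fin M → V) : ‖avg a‖ ≤ avg fun m => ‖a m‖ := by
  rw [avg, norm_smul, Real.norm_eq_abs, abs_of_nonneg (by positivity)]
  exact mul_le_mul_of_nonneg_left (norm_sum_le _ _) (by positivity)

theorem avg_mono {a b : Fin M → ℝ} (h : ∀ m, a m ≤ b m) : avg a ≤ avg b :=
  mul_le_mul_of_nonneg_left (Finset.sum_le_sum fun m _ => h m) (by positivity)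

theorem avg_nonneg {a : Fin M → ℝ} (h : ∀ m, 0 ≤ a m) : 0 ≤ avg a :=
  mul_nonneg (by positivity) (Finset.sum_nonneg fun m _ => h m)

theorem avg_add (a b : Fin M → V) : avg (fun m => a m + b m) = avg a + avg b := by
  simp only [avg, Finset.sum_add_distrib, smul_add]

theorem avg_sub (a b : Fin M → V) : avg (fun m => a m - b m) = avg a - avg b := by
  simp only [avg, Finset.sum_sub_distrib, smul_sub]

theorem avg_const (hM : 0 < M) (v : V) : avg (fun _ : Fin M => v) = v := by
  have : (M : ℝ) ≠ 0 := by positivity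
  rw [avg, Finset.sum_const, Finset.card_univ, Fintype.card_fin, ← Nat.cast_smul_eq_nsmul ℝ,
    smul_smul, inv_mul_cancel₀ this, one_smul]

theorem avg_const_mul (c : ℝ) (a : Fin M → ℝ) : avg (fun m => c * a m) = c * avg a := by
  simp only [avg, smul_eq_mul, ← Finset.mul_sum]; ring

theorem map_avg (L : V →L[ℝ] W) (a : Fin M → V) : L (avg a) = avg fun m => L (a m) := by
  simp only [avg, map_smul, map_sum]

theorem avg_apply (a : Fin M → V →L[ℝ] W) (x : V) : avg a x = avg fun m => a m x := by
  simp only [avg, _root_.smul_apply, _root_.sum_apply]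

theorem avg_le_of_le (hM : 0 < M) {a : Fin M → ℝ} {c : ℝ} (h : ∀ m, a m ≤ c) : avg a ≤ c :=
  (avg_mono h).trans (avg_const hM c).le

theorem norm_avg_le_of_le (hM : 0 < M) {a : Fin M → V} {c : ℝ} (h : ∀ m, ‖a m‖ ≤ c) :
    ‖avg a‖ ≤ c :=
  (norm_avg_le a).trans (avg_le_of_le hM h)

theorem norm_avg_sq_le (hM : 0 < M) (a : Fin M → V) : ‖avg a‖ ^ 2 ≤ avg fun m => ‖a m‖ ^ 2 := by
  have hM' : (0 : ℝ) < M := by exact_mod_cast hM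
  have h1 := pow_le_pow_left₀ (norm_nonneg _) (norm_avg_le a) 2
  refine h1.trans ?_
  have h2 := sq_sum_le_card_mul_sum_sq (s := Finset.univ) (f := fun m => ‖a m‖)
  rw [Finset.card_univ, Fintype.card_fin] at h2
  simp only [avg, smul_eq_mul]
  rw [mul_pow]
  calc ((M : ℝ)⁻¹) ^ 2 * (∑ m, ‖a m‖) ^ 2 ≤ ((M : ℝ)⁻¹) ^ 2 * (M * ∑ m, ‖a m‖ ^ 2) := by gcongr
    _ = _ := by field_simp

end Average

/-! ### Inverses of coercive matrices and their perturbation -/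

section LinearAlgebra

variable {p : ℕ}

/-- Coercivity gives `c ‖u‖ ≤ ‖P u‖`, hence injectivity, hence bijectivity in finite dimension.
Symmetry plays no role. -/
theorem exists_inverse_of_coercive {P : Mat p} {c : ℝ} (hc : 0 < c)
    (h : ∀ u, c * ‖u‖ ^ 2 ≤ inner ℝ (P u) u) :
    ∃ Q : Mat p, P * Q = 1 ∧ Q * P = 1 ∧ ‖Q‖ ≤ 1 / c := by
  have hlow : ∀ u, c * ‖u‖ ≤ ‖P u‖ := fun u => by
    rcases eq_or_lt_of_le (norm_nonneg u) with h0 | h0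
    · rw [← h0]; simp
    · have h1 := (h u).trans (real_inner_le_norm _ _)
      rw [sq, ← mul_assoc] at h1
      exact le_of_mul_le_mul_right h1 h0
  have hinj : Function.Injective (P : Vec p →ₗ[ℝ] Vec p) := by
    rw [← LinearMap.ker_eq_bot, LinearMap.ker_eq_bot']
    intro u hu
    have h1 := hlow u
    rw [show P u = 0 from hu, norm_zero] at h1
    exact norm_le_zero_iff.1 (by nlinarith [norm_nonneg u])
  set e := LinearEquiv.ofInjectiveEndo (P : Vec p →ₗ[ℝ] Vec p) hinj with he
  have hPe : ∀ x, P x = e x := fun x => rfl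
  set Q : Mat p := LinearMap.toContinuousLinearMap (e.symm : Vec p →ₗ[ℝ] Vec p) with hQ
  have hQe : ∀ x, Q x = e.symm x := fun x => rfl
  refine ⟨Q, ?_, ?_, ?_⟩
  · ext1 x
    show P (Q x) = x
    rw [hPe, hQe, e.apply_symm_apply]
  · ext1 x
    show Q (P x) = x
    rw [hPe, hQe, e.symm_apply_apply]
  · refine ContinuousLinearMap.opNorm_le_bound _ (by positivity) fun x => ?_
    have h1 := hlow (Q x)
    have h2 : P (Q x) = x := by rw [hPe, hQe, e.apply_symm_apply]
    rw [h2] at h1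
    rw [div_mul_eq_mul_div, one_mul, le_div_iff₀ hc]
    linarith

theorem norm_le_of_coercive_of_mul_eq_one {P H : Mat p} {c : ℝ} (hc : 0 < c)
    (h : ∀ u, c * ‖u‖ ^ 2 ≤ inner ℝ (P u) u) (hPH : P * H = 1) : ‖H‖ ≤ 1 / c := by
  obtain ⟨Q, -, hQP, hQ⟩ := exists_inverse_of_coercive hc h
  rwa [← left_inv_eq_right_inv hQP hPH]

theorem coercive_of_norm_sub_le {P P' : Mat p} {c e : ℝ}
    (h : ∀ u, c * ‖u‖ ^ 2 ≤ inner ℝ (P u) u) (hPP : ‖P' - P‖ ≤ e) (u : Vec p) :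
    (c - e) * ‖u‖ ^ 2 ≤ inner ℝ (P' u) u := by
  have h1 : inner ℝ (P' u) u = inner ℝ (P u) u + inner ℝ ((P' - P) u) u := by
    rw [← inner_add_left]; congr 1; simp
  have h2 := abs_real_inner_le_norm ((P' - P) u) u
  have h3 := neg_abs_le (inner ℝ ((P' - P) u) u : ℝ)
  have h4 : ‖(P' - P) u‖ * ‖u‖ ≤ e * ‖u‖ ^ 2 := by
    rw [sq, ← mul_assoc]
    exact mul_le_mul_of_nonneg_right (((P' - P).le_opNorm u).trans
      (mul_le_mul_of_nonneg_right hPP (norm_nonneg _))) (norm_nonneg _)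
  nlinarith [h u]

theorem symm_of_inverse {P Q : Mat p} (h : ∀ u v, inner ℝ (P u) v = inner ℝ u (P v))
    (hPQ : P * Q = 1) (u v : Vec p) : inner ℝ (Q u) v = inner ℝ u (Q v) := by
  have e : ∀ x, P (Q x) = x := fun x => by
    have := congrArg (fun T : Mat p => T x) hPQ
    simpa using this
  calc inner ℝ (Q u) v = inner ℝ (Q u) (P (Q v)) := by rw [e]
    _ = inner ℝ (P (Q u)) (Q v) := (h _ _).symm
    _ = inner ℝ u (Q v) := by rw [e]

/-- Second-order expansion of the inverse of a perturbed matrix. -/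
theorem norm_inverse_sub_le {X O H R : Mat p} {τ : ℝ} (hτ : 0 < τ) (hXH : X * H = 1)
    (hRO : R * O = 1) (hH : ‖H‖ ≤ 2 / τ) (hR : ‖R‖ ≤ 1 / τ) :
    ‖H - R‖ ≤ 2 / τ ^ 2 * ‖X - O‖ ∧
      ‖H - R + R * (X - O) * R‖ ≤ 2 / τ ^ 3 * ‖X - O‖ ^ 2 := by
  set E := X - O with hE
  -- The resolvent identity. Substituting it into itself once isolates the linear term and leaves
  -- the quadratic remainder `R E R E H`.
  have h1 : R * E * H = R - H := by
    rw [hE, mul_sub, sub_mul, mul_assoc, hXH, hRO, mul_one, one_mul]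
  have h2 : H - R = -(R * E * H) := by rw [h1]; abel
  have h3 : H - R + R * E * R = R * E * (R * E * H) := by
    rw [h1, mul_sub (R * E) R H, h1]; abel
  have nE := norm_nonneg E
  have b1 : ‖R * E * H‖ ≤ 2 / τ ^ 2 * ‖E‖ := by
    calc ‖R * E * H‖ ≤ ‖R‖ * ‖E‖ * ‖H‖ :=
          (norm_mul_le _ _).trans (mul_le_mul_of_nonneg_right (norm_mul_le _ _) (norm_nonneg _))
      _ ≤ 1 / τ * ‖E‖ * (2 / τ) := by gcongr
      _ = _ := by field_simp
  refine ⟨by rw [h2, norm_neg]; exact b1, ?_⟩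
  rw [h3]
  calc ‖R * E * (R * E * H)‖ ≤ ‖R‖ * ‖E‖ * ‖R * E * H‖ :=
        (norm_mul_le _ _).trans (mul_le_mul_of_nonneg_right (norm_mul_le _ _) (norm_nonneg _))
    _ ≤ 1 / τ * ‖E‖ * (2 / τ ^ 2 * ‖E‖) := by gcongr
    _ = _ := by field_simp

theorem mat_mul_apply (A B : Mat p) (x : Vec p) : (A * B) x = A (B x) := rfl

theorem mat_one_apply (x : Vec p) : (1 : Mat p) x = x := rfl

theorem mat_zero_smul (A : Mat p) : (0 : ℝ) • A = 0 := zero_smul ℝ A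

theorem outer_apply (u v x : Vec p) : outer u v x = (inner ℝ v x : ℝ) • u := by
  simp [outer]

theorem norm_outer (u v : Vec p) : ‖outer u v‖ = ‖u‖ * ‖v‖ := by
  simp [outer]

theorem adjoint_outer (u v : Vec p) : ContinuousLinearMap.adjoint (outer u v) = outer v u := by
  simp [outer]

end LinearAlgebra

/-! ### Stability of the BFGS and SR1 updates -/

section QuasiNewton

variable {p : ℕ} {P Q H : Mat p} {s y : Vec p} {τ Λ h γ c₁ : ℝ}

/-- The approximate secant equation of two matrices that are close to a symmetric positive
definite matrix `P` and to its inverse `Q`. -/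
structure NearSecant (P Q H : Mat p) (s y : Vec p) (τ Λ h γ : ℝ) : Prop where
  pos : 0 < τ
  coercive : ∀ u, τ / 2 * ‖u‖ ^ 2 ≤ inner ℝ (P u) u
  mul_inv : P * Q = 1
  inv_mul : Q * P = 1
  norm_P : ‖P‖ ≤ Λ
  norm_Q : ‖Q‖ ≤ 2 / τ
  norm_H : ‖H‖ ≤ 2 / τ
  symm_P : ∀ u v, inner ℝ (P u) v = inner ℝ u (P v)
  symm_H : ∀ u v, inner ℝ (H u) v = inner ℝ u (H v)
  dist : ‖H - Q‖ ≤ h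
  secant : ‖y - P s‖ ≤ γ * ‖s‖
  γ_le : γ ≤ τ / 4
  γ_le' : γ ≤ Λ
  γ_nonneg : 0 ≤ γ

namespace NearSecant

variable (N : NearSecant P Q H s y τ Λ h γ)
include N

theorem h_nonneg : 0 ≤ h := (norm_nonneg _).trans N.dist

theorem Λ_nonneg : 0 ≤ Λ := (norm_nonneg _).trans N.norm_P

theorem inner_ge : τ / 4 * ‖s‖ ^ 2 ≤ inner ℝ s y := by
  have h1 : inner ℝ s y = inner ℝ (P s) s + inner ℝ (y - P s) s := by
    rw [← inner_add_left, real_inner_comm]; congr 1; abel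
  have h2 := abs_real_inner_le_norm (y - P s) s
  have h3 := neg_abs_le (inner ℝ (y - P s) s : ℝ)
  have h4 : ‖y - P s‖ * ‖s‖ ≤ τ / 4 * ‖s‖ ^ 2 := by
    rw [sq, ← mul_assoc]
    refine mul_le_mul_of_nonneg_right (N.secant.trans ?_) (norm_nonneg _)
    exact mul_le_mul_of_nonneg_right N.γ_le (norm_nonneg _)
  nlinarith [N.coercive s]

theorem norm_y_le : ‖y‖ ≤ 2 * Λ * ‖s‖ := by
  have h1 : y = P s + (y - P s) := by abel
  rw [h1]
  refine (norm_add_le _ _).trans ?_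
  have h2 := N.secant
  have h3 := (P.le_opNorm s).trans (mul_le_mul_of_nonneg_right N.norm_P (norm_nonneg s))
  have h4 := mul_le_mul_of_nonneg_right N.γ_le' (norm_nonneg s)
  linarith

theorem le_norm_y : τ / 4 * ‖s‖ ≤ ‖y‖ := by
  rcases eq_or_lt_of_le (norm_nonneg s) with h0 | h0
  · rw [← h0]; simp
  · have h1 := N.inner_ge.trans (real_inner_le_norm s y)
    rw [sq, ← mul_assoc, mul_comm ‖s‖] at h1
    exact le_of_mul_le_mul_right h1 h0

/-- As `Q P s = s`, the vector `s - H y` only sees the error of `H` as an inverse of `P` and the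
error in the secant equation. -/
theorem norm_v_le : ‖s - H y‖ ≤ (h * Λ + 2 / τ * γ) * ‖s‖ := by
  have hs : Q (P s) = s := by
    have := congrArg (fun T : Mat p => T s) N.inv_mul
    simpa using this
  have e : s - H y = -((H - Q) (P s)) - H (y - P s) := by
    simp only [_root_.sub_apply, map_sub, hs]; abel
  have hτ := N.pos
  rw [e]
  refine (norm_sub_le _ _).trans ?_
  rw [norm_neg]
  have h1 : ‖(H - Q) (P s)‖ ≤ h * (Λ * ‖s‖) :=
    ((H - Q).le_opNorm _).trans (mul_le_mul N.dist
      ((P.le_opNorm s).trans (mul_le_mul_of_nonneg_right N.norm_P (norm_nonneg s)))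
      (norm_nonneg _) N.h_nonneg)
  have h2 : ‖H (y - P s)‖ ≤ 2 / τ * (γ * ‖s‖) :=
    (H.le_opNorm _).trans (mul_le_mul N.norm_H N.secant (norm_nonneg _) (by positivity))
  linarith

/-- The correction has norm `‖v‖² / |v · y|` with `‖v‖` at most a small multiple `ζ` of `‖s‖`. The
first acceptance test bounds the denominator below by `c₁ ‖v‖ ‖y‖`, and `‖y‖` is at least of order
`‖s‖`. For the second test the denominator is rewritten in terms of `r`; only there is the smallness
of `ζ` needed. -/
theorem norm_sr1_sub_le (hc : 0 < c₁) (hsmall : h * Λ + 2 / τ * γ ≤ c₁ / 2) :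
    ‖sr1 c₁ H s y - Q‖ ≤ h + 4 / (c₁ * τ) * (h * Λ + 2 / τ * γ) := by
  have hτ := N.pos
  have hh := N.h_nonneg
  have hΛ := N.Λ_nonneg
  have hγ := N.γ_nonneg
  set ζ := h * Λ + 2 / τ * γ with hζ
  have hζ0 : 0 ≤ ζ := by positivity
  have hv := N.norm_v_le
  rw [← hζ] at hv
  rw [sr1]
  split_ifs with hacc
  swap
  · refine N.dist.trans ?_
    have : 0 ≤ 4 / (c₁ * τ) * ζ := by positivity
    linarith
  set v := s - H y with hvdef
  have e : H + (1 / inner ℝ v y : ℝ) • outer v v - Q = (H - Q) + (1 / inner ℝ v y : ℝ) • outer v v :=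
    by abel
  rw [e]
  refine (norm_add_le _ _).trans (add_le_add N.dist ?_)
  rw [norm_smul, norm_outer, Real.norm_eq_abs, abs_div, abs_one, one_div_mul_eq_div]
  -- Division by zero gives zero, so in this case the correction is omitted.
  by_cases hvy : (inner ℝ v y : ℝ) = 0
  · rw [hvy]; simp; positivity
  have hpos : 0 < |(inner ℝ v y : ℝ)| := abs_pos.2 hvy
  have hv0 : 0 < ‖v‖ := norm_pos_iff.2 fun h0 => hvy (by rw [h0, inner_zero_left])
  have hs0 : 0 < ‖s‖ := by
    rcases eq_or_lt_of_le (norm_nonneg s) with h0 | h0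
    · rw [← h0, mul_zero] at hv; exact absurd hv (not_le.2 hv0)
    · exact h0
  have hy := N.le_norm_y
  rw [div_le_iff₀ hpos]
  rcases hacc with hacc | ⟨hu, hacc⟩
  · rw [← hvdef] at hacc
    calc ‖v‖ * ‖v‖ ≤ ‖v‖ * (ζ * ‖s‖) := by gcongr
      _ = 4 / (c₁ * τ) * ζ * (c₁ * ‖v‖ * (τ / 4 * ‖s‖)) := by field_simp
      _ ≤ 4 / (c₁ * τ) * ζ * (c₁ * ‖v‖ * ‖y‖) := by gcongr
      _ ≤ _ := by gcongr
  · set r := y - Ring.inverse H s with hr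
    have hHr : H r = -v := by
      have h1 : H (Ring.inverse H s) = s := by
        have := congrArg (fun T : Mat p => T s) (Ring.mul_inverse_cancel H hu)
        simpa using this
      rw [hr, map_sub, h1, hvdef]; abel
    have hvr : ‖v‖ ≤ 2 / τ * ‖r‖ := by
      rw [← norm_neg v, ← hHr]
      exact (H.le_opNorm r).trans (mul_le_mul_of_nonneg_right N.norm_H (norm_nonneg _))
    -- From `H r = -v` and the symmetry of `H`. Here `r · v` is at most half the lower bound for `|r
    -- · s|`, so the test on `r` is inherited by `v · y` with constant `c₁ / 2`.
    have e1 : (inner ℝ v y : ℝ) = inner ℝ r v - inner ℝ r s := by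
      have h1 : v = -H r := by rw [hHr, neg_neg]
      have h2 : (inner ℝ v y : ℝ) = - inner ℝ r (H y) := by
        conv_lhs => rw [h1]
        rw [inner_neg_left, N.symm_H]
      have h3 : H y = s - v := by rw [hvdef]; abel
      rw [h2, h3, inner_sub_right]; ring
    have h4 : c₁ / 2 * ‖r‖ * ‖s‖ ≤ |(inner ℝ v y : ℝ)| := by
      have h5 := abs_real_inner_le_norm r v
      have h6 : |(inner ℝ r s : ℝ)| ≤ |(inner ℝ v y : ℝ)| + |(inner ℝ r v : ℝ)| := by
        have : (inner ℝ r s : ℝ) = inner ℝ r v - inner ℝ v y := by rw [e1]; ring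
        rw [this, add_comm]
        exact abs_sub _ _
      have h7 : ‖r‖ * ‖v‖ ≤ c₁ / 2 * ‖r‖ * ‖s‖ := by
        calc ‖r‖ * ‖v‖ ≤ ‖r‖ * (c₁ / 2 * ‖s‖) := by
              gcongr
              exact hv.trans (mul_le_mul_of_nonneg_right hsmall hs0.le)
          _ = _ := by ring
      linarith
    calc ‖v‖ * ‖v‖ ≤ (2 / τ * ‖r‖) * (ζ * ‖s‖) := by gcongr
      _ = 4 / (c₁ * τ) * ζ * (c₁ / 2 * ‖r‖ * ‖s‖) := by field_simp; ring
      _ ≤ _ := by gcongr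

/-- The update of `H` is that of `Q` plus `Vᵀ (H - Q) V`. The update of `Q` differs from `Q` only by
terms in `d = Q y - s`, which vanish under the exact secant equation. Positive curvature `s · y`
bounds `V` and the rank-one terms. -/
theorem norm_secant_update_sub_le :
    ‖bfgs H s y - Q‖ ≤
      (1 + 8 * Λ / τ) ^ 2 * h + (16 / τ ^ 2 + 64 * Λ / τ ^ 3) * γ := by
  have hτ := N.pos
  have hh := N.h_nonneg
  have hΛ := N.Λ_nonneg
  have hγ := N.γ_nonneg
  have hPQ : ∀ x, P (Q x) = x := fun x => by
    have := congrArg (fun T : Mat p => T x) N.mul_inv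
    simpa using this
  have hQP : ∀ x, Q (P x) = x := fun x => by
    have := congrArg (fun T : Mat p => T x) N.inv_mul
    simpa using this
  have hQs := symm_of_inverse N.symm_P N.mul_inv
  have hin := N.inner_ge
  have hyu := N.norm_y_le
  set ρ : ℝ := 1 / inner ℝ s y with hρ
  set V : Mat p := 1 - ρ • outer y s with hV
  have hρ0 : 0 ≤ ρ := one_div_nonneg.2 ((by positivity : 0 ≤ τ / 4 * ‖s‖ ^ 2).trans hin)
  have hρs : ρ * ‖s‖ ^ 2 ≤ 4 / τ := by
    rcases eq_or_lt_of_le (norm_nonneg s) with h0 | h0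
    · rw [← h0]; simp; positivity
    · have h1 : 0 < τ / 4 * ‖s‖ ^ 2 := by positivity
      have h2 : ρ ≤ 1 / (τ / 4 * ‖s‖ ^ 2) := one_div_le_one_div_of_le h1 hin
      calc ρ * ‖s‖ ^ 2 ≤ 1 / (τ / 4 * ‖s‖ ^ 2) * ‖s‖ ^ 2 := by gcongr
        _ = 4 / τ := by field_simp
  have hVn : ‖V‖ ≤ 1 + 8 * Λ / τ := by
    rw [hV]
    refine (norm_sub_le _ _).trans (add_le_add ContinuousLinearMap.norm_id_le ?_)
    rw [norm_smul, norm_outer, Real.norm_eq_abs, abs_of_nonneg hρ0]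
    calc ρ * (‖y‖ * ‖s‖) ≤ ρ * (2 * Λ * ‖s‖ * ‖s‖) := by gcongr
      _ = 2 * Λ * (ρ * ‖s‖ ^ 2) := by ring
      _ ≤ 2 * Λ * (4 / τ) := by gcongr
      _ = _ := by ring
  set d := Q (y - P s) with hd
  have hQy : Q y = s + d := by rw [hd, map_sub, hQP]; abel
  have hdn : ‖d‖ ≤ 2 / τ * γ * ‖s‖ := by
    rw [mul_assoc]
    exact (Q.le_opNorm _).trans (mul_le_mul N.norm_Q N.secant (norm_nonneg _) (by positivity))
  have hVadj : ContinuousLinearMap.adjoint V = 1 - ρ • outer s y := by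
    rw [hV, map_sub]
    congr 1
    · exact ContinuousLinearMap.adjoint_id
    · rw [map_smulₛₗ, adjoint_outer]; simp
  have key : ContinuousLinearMap.adjoint V * Q * V + ρ • outer s s - Q =
      (ρ ^ 2 * inner ℝ y d) • outer s s - ρ • outer s d - ρ • outer d s := by
    -- With `s = 0` the convention `1 / 0 = 0` gives `ρ = 0`, and both sides vanish.
    by_cases hs : s = 0
    · have h1 : ρ = 0 := by rw [hρ, hs, inner_zero_left, div_zero]
      rw [hVadj, hV, h1]
      simp only [mat_zero_smul, zero_pow (two_ne_zero), zero_mul, sub_zero, add_zero, one_mul,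
        mul_one, sub_self]
    have hs0 : (inner ℝ s y : ℝ) ≠ 0 := by
      have : 0 < ‖s‖ := norm_pos_iff.2 hs
      have : 0 < τ / 4 * ‖s‖ ^ 2 := by positivity
      linarith
    have hρ1 : ρ * inner ℝ s y = 1 := by rw [hρ]; field_simp
    rw [hVadj, hV]
    ext1 x
    have e1 : (inner ℝ y (Q x) : ℝ) = inner ℝ s x + inner ℝ d x := by
      rw [← hQs, hQy, inner_add_left]
    have e2 : (inner ℝ y (Q y) : ℝ) = inner ℝ s y + inner ℝ y d := by
      rw [hQy, inner_add_right, real_inner_comm]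
    simp only [_root_.sub_apply, _root_.add_apply, _root_.smul_apply, outer_apply,
      mat_mul_apply, mat_one_apply, map_sub, map_smul, e1, e2]
    rw [hQy]
    have e3 : ρ * ρ * inner ℝ s y = ρ := by rw [mul_assoc, hρ1, mul_one]
    set α : ℝ := inner ℝ s x
    set β : ℝ := inner ℝ d x
    set ω : ℝ := inner ℝ y d
    set σ : ℝ := inner ℝ s y
    rw [← sub_eq_zero]
    have e4 : ρ * (ρ * (α * σ)) = ρ * α := by
      calc ρ * (ρ * (α * σ)) = (ρ * ρ * σ) * α := by ring
        _ = ρ * α := by rw [e3]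
    have e5 : Q x - ρ • (α + β) • s - ρ • α • (s + d - ρ • (σ + ω) • s) + ρ • α • s - Q x -
        ((ρ ^ 2 * ω) • α • s - ρ • β • s - ρ • α • d) = (ρ * (ρ * (α * σ)) - ρ * α) • s := by
      module
    rw [e5, e4, sub_self, zero_smul]
  have hsplit : bfgs H s y - Q = ContinuousLinearMap.adjoint V * (H - Q) * V +
      (ContinuousLinearMap.adjoint V * Q * V + ρ • outer s s - Q) := by
    rw [bfgs]
    simp only [← hρ, ← hV, mul_sub, sub_mul]
    abel
  rw [hsplit, key]
  have n1 : ‖ContinuousLinearMap.adjoint V * (H - Q) * V‖ ≤ (1 + 8 * Λ / τ) ^ 2 * h := by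
    have : ‖ContinuousLinearMap.adjoint V‖ ≤ 1 + 8 * Λ / τ := by
      rw [LinearIsometryEquiv.norm_map]; exact hVn
    calc _ ≤ ‖ContinuousLinearMap.adjoint V‖ * ‖H - Q‖ * ‖V‖ :=
          (norm_mul_le _ _).trans (mul_le_mul_of_nonneg_right (norm_mul_le _ _) (norm_nonneg _))
      _ ≤ (1 + 8 * Λ / τ) * h * (1 + 8 * Λ / τ) := by
          gcongr
          exact N.dist
      _ = _ := by ring
  have n2 : ‖ρ • outer s d‖ ≤ 8 / τ ^ 2 * γ := by
    rw [norm_smul, norm_outer, Real.norm_eq_abs, abs_of_nonneg hρ0]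
    calc ρ * (‖s‖ * ‖d‖) ≤ ρ * (‖s‖ * (2 / τ * γ * ‖s‖)) := by gcongr
      _ = 2 / τ * γ * (ρ * ‖s‖ ^ 2) := by ring
      _ ≤ 2 / τ * γ * (4 / τ) := by gcongr
      _ = _ := by field_simp; ring
  have n3 : ‖ρ • outer d s‖ ≤ 8 / τ ^ 2 * γ := by
    rw [norm_smul, norm_outer, mul_comm ‖d‖, ← norm_outer s d, ← norm_smul]; exact n2
  have n4 : ‖(ρ ^ 2 * inner ℝ y d) • outer s s‖ ≤ 64 * Λ / τ ^ 3 * γ := by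
    rw [norm_smul, norm_outer, Real.norm_eq_abs, abs_mul, abs_of_nonneg (sq_nonneg ρ)]
    calc ρ ^ 2 * |inner ℝ y d| * (‖s‖ * ‖s‖) ≤
          ρ ^ 2 * ((2 * Λ * ‖s‖) * (2 / τ * γ * ‖s‖)) * (‖s‖ * ‖s‖) := by
          gcongr
          refine (abs_real_inner_le_norm y d).trans ?_
          gcongr
      _ = 4 * Λ / τ * γ * (ρ * ‖s‖ ^ 2) ^ 2 := by ring
      _ ≤ 4 * Λ / τ * γ * (4 / τ) ^ 2 := by gcongr
      _ = _ := by field_simp; ring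
  refine (norm_add_le _ _).trans ?_
  have n5 := norm_sub_le ((ρ ^ 2 * inner ℝ y d) • outer s s - ρ • outer s d) (ρ • outer d s)
  have n6 := norm_sub_le ((ρ ^ 2 * inner ℝ y d) • outer s s) (ρ • outer s d)
  have : (16 / τ ^ 2 + 64 * Λ / τ ^ 3) * γ = 8 / τ ^ 2 * γ + 8 / τ ^ 2 * γ + 64 * Λ / τ ^ 3 * γ := by
    ring
  linarith

end NearSecant

end QuasiNewton

/-! ### The global loss as an average, and the averaged update -/

section MeanLoss

variable {p M : ℕ} {Θ : Set (Vec p)} {θ₀ : Vec p} {δ K : ℝ} {f : Fin M → Vec p → ℝ}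

/-- The average of finitely many losses. -/
def meanLoss (f : Fin M → Vec p → ℝ) : Vec p → ℝ := fun θ => (M : ℝ)⁻¹ * ∑ m, f m θ

theorem hess_meanLoss (h : ∀ m, SmoothLoss Θ θ₀ δ K (f m)) {θ : Vec p}
    (hθ : θ ∈ Metric.closedBall θ₀ δ) : hess (meanLoss f) θ = avg fun m => hess (f m) θ :=
  hess_smul_sum _ fun m => (h m).smooth θ hθ

theorem gradient_meanLoss (h : ∀ m, SmoothLoss Θ θ₀ δ K (f m)) {θ : Vec p}
    (hθ : θ ∈ Metric.closedBall θ₀ δ) : gradient (meanLoss f) θ = avg fun m => gradient (f m) θ :=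
  gradient_smul_sum _ fun m => ((h m).smooth θ hθ).differentiableAt (by norm_num)

theorem third_meanLoss (h : ∀ m, SmoothLoss Θ θ₀ δ K (f m)) {θ : Vec p}
    (hθ : θ ∈ Metric.closedBall θ₀ δ) : third (meanLoss f) θ = avg fun m => third (f m) θ :=
  third_smul_sum _ fun m => (h m).smooth θ hθ

theorem convexOn_smul_sum {ι : Type*} [Fintype ι] {f : ι → Vec p → ℝ} {c : ℝ} (hc : 0 ≤ c)
    (hΘ : Convex ℝ Θ) (h : ∀ i, ConvexOn ℝ Θ (f i)) :
    ConvexOn ℝ Θ (fun θ => c * ∑ i, f i θ) := by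
  have : ∀ s : Finset ι, ConvexOn ℝ Θ (fun θ => ∑ i ∈ s, f i θ) := by
    classical
    intro s
    induction s using Finset.induction_on with
    | empty => simpa using convexOn_const 0 hΘ
    | insert a s ha ih =>
      simp_rw [Finset.sum_insert ha]
      exact (h a).add ih
  exact (this Finset.univ).smul hc

theorem smoothLoss_meanLoss (hM : 0 < M) (hΘ : Convex ℝ Θ)
    (h : ∀ m, SmoothLoss Θ θ₀ δ K (f m)) : SmoothLoss Θ θ₀ δ K (meanLoss f) where
  smooth θ hθ := contDiffAt_const.mul (ContDiffAt.sum fun m _ => (h m).smooth θ hθ)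
  convexOn := convexOn_smul_sum (by positivity) hΘ fun m => (h m).convexOn
  hess_lip θ hθ θ' hθ' := by
    rw [hess_meanLoss h hθ, hess_meanLoss h hθ', ← avg_sub]
    exact norm_avg_le_of_le hM fun m => (h m).hess_lip θ hθ θ' hθ'
  third_lip θ hθ θ' hθ' := by
    rw [third_meanLoss h hθ, third_meanLoss h hθ']
    refine (congrArg norm (avg_sub (fun m => third (f m) θ) fun m => third (f m) θ').symm).trans_le ?_
    exact norm_avg_le_of_le hM fun m => (h m).third_lip θ hθ θ' hθ'

end MeanLoss

theorem avg_mul_mul {p M : ℕ} (A B : Mat p) (a : Fin M → Mat p) :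
    (avg fun m => A * a m * B) = A * avg a * B := by
  ext1 x
  rw [avg_apply]
  simp only [mat_mul_apply]
  rw [avg_apply, map_avg]

/-- For fixed `s` and `y` the BFGS update is affine in the matrix, so it commutes with averaging.
Both strategies thus become a single update of the averaged matrix. -/
theorem avg_bfgs {p M : ℕ} (hM : 0 < M) (H : Fin M → Mat p) (s y : Vec p) :
    avg (fun m => bfgs (H m) s y) = bfgs (avg H) s y := by
  simp only [bfgs]
  rw [avg_add, avg_const hM]
  rw [avg_mul_mul]

theorem stage2_eq {p M : ℕ} (hM : 0 < M) (c₁ : ℝ) (S : Strategy) (L : Vec p → ℝ)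
    (H : Fin M → Mat p) (x x' : Vec p) :
    stage2 c₁ S L H x x' =
      x' - update c₁ S (avg H) (x' - x) (gradient L x' - gradient L x) (gradient L x') := by
  cases S with
  | bfgs => simp only [stage2, update]; rw [← avg_apply, avg_bfgs hM]
  | sr1 => simp only [stage2, update]

/-- The error term built from local estimators, Hessians and third derivatives. -/
def errSum {p M : ℕ} (f : Fin M → Vec p → ℝ) (θ₀ : Vec p) (Ω : Mat p) (T : Vec p →L[ℝ] Mat p)
    (θloc : Fin M → Vec p) : ℝ :=
  avg fun m => ‖θloc m - θ₀‖ ^ 2 + ‖hess (f m) θ₀ - Ω‖ ^ 2 +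
    ‖(third (f m) θ₀ - T) (θloc m - θ₀)‖

/-- The second-order error of a loss at `θ₀`, where `R` is the inverse of the expected Hessian. -/
def secondOrder {p : ℕ} (f : Vec p → ℝ) (θ₀ : Vec p) (Ω R : Mat p) : ℝ :=
  ‖(hess f θ₀ - Ω) (R (gradient f θ₀))‖ + ‖gradient f θ₀‖ ^ 2

/-- The local losses have small gradients and accurate Hessians at `θ₀`, relative to the radius `r`
of a neighbourhood in which the analysis takes place. -/
structure Localized {p M : ℕ} (Θ : Set (Vec p)) (θ₀ : Vec p) (δ K τ Λ r ε : ℝ)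
    (f : Fin M → Vec p → ℝ) (Ω : Mat p) (T : Vec p →L[ℝ] Mat p) (θloc : Fin M → Vec p)
    (θge : Vec p) (H : Fin M → Mat p) : Prop where
  hM : 0 < M
  hτ : 0 < τ
  hK : 0 < K
  hr : 0 < r
  hrδ : r < δ
  hKr : K * r ≤ τ / 8
  hετ : ε ≤ τ / 8
  hεr : ε < τ / 2 * r
  hεr' : ε ≤ r
  convex : Convex ℝ Θ
  ball : Metric.closedBall θ₀ δ ⊆ Θ
  loss : ∀ m, SmoothLoss Θ θ₀ δ K (f m)
  coercive : ∀ u, τ * ‖u‖ ^ 2 ≤ inner ℝ (Ω u) u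
  norm_Ω : ‖Ω‖ ≤ Λ
  norm_T : ‖T‖ ≤ K
  norm_gradient : ∀ m, ‖gradient (f m) θ₀‖ ≤ ε
  norm_hess : ∀ m, ‖hess (f m) θ₀ - Ω‖ ≤ ε
  argmin_loc : ∀ m, IsArgmin (f m) Θ (θloc m)
  argmin_ge : IsArgmin (meanLoss f) Θ θge
  mul_inv : ∀ m, hess (f m) (θloc m) * H m = 1

/-! ### Expansions on the good event -/

namespace Localized

variable {p M : ℕ} {Θ : Set (Vec p)} {θ₀ : Vec p} {δ K τ Λ r ε : ℝ}
  {f : Fin M → Vec p → ℝ} {Ω : Mat p} {T : Vec p →L[ℝ] Mat p} {θloc : Fin M → Vec p}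
  {θge : Vec p} {H : Fin M → Mat p} (h : Localized Θ θ₀ δ K τ Λ r ε f Ω T θloc θge H)
include h

theorem Λ_nonneg : 0 ≤ Λ := (norm_nonneg _).trans h.norm_Ω

omit h in
theorem mem_ball {x : Vec p} {ρ : ℝ} (hx : ‖x - θ₀‖ ≤ ρ) (hρ : ρ ≤ δ) :
    x ∈ Metric.closedBall θ₀ δ := by
  rw [Metric.mem_closedBall, dist_eq_norm]; exact hx.trans hρ

theorem center_mem : θ₀ ∈ Metric.closedBall θ₀ δ :=
  Metric.mem_closedBall_self (h.hr.trans h.hrδ).le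

theorem mean : SmoothLoss Θ θ₀ δ K (meanLoss f) := smoothLoss_meanLoss h.hM h.convex h.loss

theorem mean_hess_sub :
    hess (meanLoss f) θ₀ - Ω = avg fun m => hess (f m) θ₀ - Ω := by
  rw [hess_meanLoss h.loss h.center_mem, avg_sub, avg_const h.hM]

theorem norm_mean_hess : ‖hess (meanLoss f) θ₀ - Ω‖ ≤ ε := by
  rw [h.mean_hess_sub]
  exact norm_avg_le_of_le h.hM h.norm_hess

theorem norm_mean_gradient : ‖gradient (meanLoss f) θ₀‖ ≤ ε := by
  rw [gradient_meanLoss h.loss h.center_mem]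
  exact norm_avg_le_of_le h.hM h.norm_gradient

theorem coercive_of_near {P : Mat p} (hP : ‖P - Ω‖ ≤ ε) (u : Vec p) :
    3 * τ / 4 * ‖u‖ ^ 2 ≤ inner ℝ (P u) u := by
  have h1 := coercive_of_norm_sub_le h.coercive hP u
  have h2 := h.hετ
  have h3 : 3 * τ / 4 * ‖u‖ ^ 2 ≤ (τ - ε) * ‖u‖ ^ 2 := by
    gcongr; linarith [h.hτ]
  linarith

theorem argmin_facts {g : Vec p → ℝ} (hg : SmoothLoss Θ θ₀ δ K g) (hgr : ‖gradient g θ₀‖ ≤ ε)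
    (hgh : ‖hess g θ₀ - Ω‖ ≤ ε) {θ : Vec p} (hθ : IsArgmin g Θ θ) :
    gradient g θ = 0 ∧ ‖θ - θ₀‖ ≤ 2 / τ * ‖gradient g θ₀‖ ∧ ‖θ - θ₀‖ ≤ r :=
  hg.argmin_near h.hK.le h.ball h.hτ h.hr h.hrδ (by linarith [h.hKr, h.hτ]) (h.coercive_of_near hgh)
    (hgr.trans_lt h.hεr) hθ

theorem loc_facts (m : Fin M) : gradient (f m) (θloc m) = 0 ∧
    ‖θloc m - θ₀‖ ≤ 2 / τ * ‖gradient (f m) θ₀‖ ∧ ‖θloc m - θ₀‖ ≤ r :=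
  h.argmin_facts (h.loss m) (h.norm_gradient m) (h.norm_hess m) (h.argmin_loc m)

theorem ge_facts : gradient (meanLoss f) θge = 0 ∧
    ‖θge - θ₀‖ ≤ 2 / τ * ‖gradient (meanLoss f) θ₀‖ ∧ ‖θge - θ₀‖ ≤ r :=
  h.argmin_facts h.mean h.norm_mean_gradient h.norm_mean_hess h.argmin_ge

theorem stage0_sub : stage0 θloc - θ₀ = avg fun m => θloc m - θ₀ := by
  rw [avg_sub, avg_const h.hM]; rfl

theorem norm_stage0_sub : ‖stage0 θloc - θ₀‖ ≤ r := by
  rw [h.stage0_sub]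
  exact norm_avg_le_of_le h.hM fun m => (h.loc_facts m).2.2

/-- First-order expansion of the estimating equation. -/
theorem first_order {g : Vec p → ℝ} (hg : SmoothLoss Θ θ₀ δ K g) {θ : Vec p}
    (hθ : gradient g θ = 0) (hθr : ‖θ - θ₀‖ ≤ r) :
    ‖gradient g θ₀ + hess g θ₀ (θ - θ₀)‖ ≤ K * ‖θ - θ₀‖ ^ 2 := by
  have h1 := hg.norm_gradient_sub_le h.hK.le (r := ‖θ - θ₀‖) (x := θ₀) (y := θ)
    (hθr.trans h.hrδ.le) (by simp) le_rfl
  rw [hθ, zero_sub, ← neg_add', norm_neg] at h1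
  rw [sq, ← mul_assoc]
  exact h1

theorem exists_inverse_Ω : ∃ R : Mat p, Ω * R = 1 ∧ R * Ω = 1 ∧ ‖R‖ ≤ 1 / τ :=
  exists_inverse_of_coercive h.hτ h.coercive

theorem exists_inverse_mean : ∃ Q : Mat p, hess (meanLoss f) θ₀ * Q = 1 ∧
    Q * hess (meanLoss f) θ₀ = 1 ∧ ‖Q‖ ≤ 2 / τ := by
  obtain ⟨Q, h1, h2, h3⟩ := exists_inverse_of_coercive (c := 3 * τ / 4) (by linarith [h.hτ])
    (h.coercive_of_near h.norm_mean_hess)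
  refine ⟨Q, h1, h2, h3.trans ?_⟩
  have hτ := h.hτ
  rw [div_le_div_iff₀ (by linarith) hτ]
  linarith

theorem norm_hess_loc_sub (m : Fin M) :
    ‖hess (f m) (θloc m) - Ω‖ ≤ ‖hess (f m) θ₀ - Ω‖ + K * ‖θloc m - θ₀‖ := by
  have h1 := (h.loss m).hess_lip (θloc m) (mem_ball (h.loc_facts m).2.2 h.hrδ.le) θ₀ h.center_mem
  have h2 : hess (f m) (θloc m) - Ω = (hess (f m) (θloc m) - hess (f m) θ₀) +
    (hess (f m) θ₀ - Ω) := by abel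
  rw [h2]
  exact (norm_add_le _ _).trans (by linarith)

/-- At the local estimator the Hessian is within `ε + K r ≤ τ / 4` of `Ω`, so it is coercive with
constant at least `τ / 2`. -/
theorem norm_H_le (m : Fin M) : ‖H m‖ ≤ 2 / τ := by
  have hτ := h.hτ
  have h1 : ‖hess (f m) (θloc m) - Ω‖ ≤ τ / 4 := by
    refine (h.norm_hess_loc_sub m).trans ?_
    have h2 := h.norm_hess m
    have h3 := mul_le_mul_of_nonneg_left (h.loc_facts m).2.2 h.hK.le
    linarith [h.hKr, h.hετ]
  have h2 : ∀ u, τ / 2 * ‖u‖ ^ 2 ≤ inner ℝ (hess (f m) (θloc m) u) u := fun u => by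
    refine le_trans ?_ (coercive_of_norm_sub_le h.coercive h1 u)
    gcongr; linarith
  have h3 := norm_le_of_coercive_of_mul_eq_one (by linarith) h2 (h.mul_inv m)
  refine h3.trans (le_of_eq ?_)
  field_simp

theorem norm_avg_H_le : ‖avg H‖ ≤ 2 / τ := norm_avg_le_of_le h.hM h.norm_H_le

theorem H_symm (m : Fin M) (u v : Vec p) : inner ℝ (H m u) v = inner ℝ u (H m v) :=
  symm_of_inverse (inner_hess_symm ((h.loss m).smooth _
    (mem_ball (h.loc_facts m).2.2 h.hrδ.le))) (h.mul_inv m) u v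

theorem avg_H_symm (u v : Vec p) : inner ℝ (avg H u) v = inner ℝ u (avg H v) := by
  rw [avg_apply, avg_apply]
  simp only [avg]
  rw [inner_smul_left, inner_smul_right, sum_inner, inner_sum]
  simp only [h.H_symm]
  rfl

omit h in
theorem avg_sq_le_errSum : (avg fun m => ‖θloc m - θ₀‖ ^ 2) + (avg fun m => ‖hess (f m) θ₀ - Ω‖ ^ 2)
    + (avg fun m => ‖(third (f m) θ₀ - T) (θloc m - θ₀)‖) = errSum f θ₀ Ω T θloc := by
  rw [errSum, avg_add, avg_add]

omit h in
theorem errSum_nonneg : 0 ≤ errSum f θ₀ Ω T θloc := avg_nonneg fun m => by positivity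

/-- The averaged inverse Hessian is close to the inverse of the global Hessian. -/
theorem norm_avg_H_sub_le {Q : Mat p} (hPQ : hess (meanLoss f) θ₀ * Q = 1) (hQ : ‖Q‖ ≤ 2 / τ) :
    ‖avg H - Q‖ ≤ ((6 + 4 * K ^ 2) / τ ^ 3 + (1 + K) / τ ^ 2) *
      (errSum f θ₀ Ω T θloc + ‖stage0 θloc - θ₀‖) := by
  obtain ⟨R, hΩR, hRΩ, hR⟩ := h.exists_inverse_Ω
  have hτ := h.hτ
  have hK := h.hK
  set A := errSum f θ₀ Ω T θloc with hA
  set E : Fin M → Mat p := fun m => hess (f m) (θloc m) - Ω with hE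
  set D := hess (meanLoss f) θ₀ - Ω with hD
  set A1 := avg fun m => ‖θloc m - θ₀‖ ^ 2 with hA1
  set A2 := avg fun m => ‖hess (f m) θ₀ - Ω‖ ^ 2 with hA2
  set A3 := avg fun m => ‖(third (f m) θ₀ - T) (θloc m - θ₀)‖ with hA3
  have hsum : A1 + A2 + A3 = A := avg_sq_le_errSum
  have A1n : 0 ≤ A1 := avg_nonneg fun m => by positivity
  have A2n : 0 ≤ A2 := avg_nonneg fun m => by positivity
  have A3n : 0 ≤ A3 := avg_nonneg fun m => by positivity
  have h1 : ∀ m, ‖H m - R + R * E m * R‖ ≤ 2 / τ ^ 3 * ‖E m‖ ^ 2 := fun m =>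
    (norm_inverse_sub_le hτ (h.mul_inv m) hRΩ (h.norm_H_le m) hR).2
  have h2 : ‖Q - R + R * D * R‖ ≤ 2 / τ ^ 3 * ‖D‖ ^ 2 :=
    (norm_inverse_sub_le hτ hPQ hRΩ hQ hR).2
  -- Both sides are expanded around `R = Ω⁻¹`. After the quadratic remainders are split off, the
  -- linear terms leave only `avg E - D`, the mean change of the local Hessians between `θ₀` and the
  -- local estimators.
  have h3 : avg H - Q = (avg fun m => H m - R + R * E m * R) - (Q - R + R * D * R) -
      R * (avg E - D) * R := by
    have e1 : (avg fun m => H m - R + R * E m * R) = avg H - R + R * avg E * R := by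
      rw [avg_add, avg_sub, avg_const h.hM, avg_mul_mul]
    rw [e1, mul_sub R (avg E) D, sub_mul (R * avg E) (R * D) R]
    abel
  have h4 : ‖avg fun m => H m - R + R * E m * R‖ ≤ 2 / τ ^ 3 * (2 * A2 + 2 * K ^ 2 * A1) := by
    refine (norm_avg_le _).trans ?_
    have : ∀ m, ‖H m - R + R * E m * R‖ ≤
        2 / τ ^ 3 * (2 * ‖hess (f m) θ₀ - Ω‖ ^ 2 + 2 * K ^ 2 * ‖θloc m - θ₀‖ ^ 2) := fun m => by
      refine (h1 m).trans (mul_le_mul_of_nonneg_left ?_ (by positivity))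
      have h5 := pow_le_pow_left₀ (norm_nonneg _) (h.norm_hess_loc_sub m) 2
      refine h5.trans ?_
      nlinarith [sq_nonneg (‖hess (f m) θ₀ - Ω‖ - K * ‖θloc m - θ₀‖)]
    refine (avg_mono this).trans (le_of_eq ?_)
    rw [avg_const_mul, avg_add, avg_const_mul, avg_const_mul]
  have h5 : ‖D‖ ^ 2 ≤ A2 := by
    rw [hD, h.mean_hess_sub]
    exact norm_avg_sq_le h.hM _
  -- The change of each Hessian is linearized and its third derivative is split into the mean `T`
  -- and a deviation. Since `T` is common to the workers, it acts on the averaged error `stage0 -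
  -- θ₀`.
  have h6 : ‖avg E - D‖ ≤ A3 + K * ‖stage0 θloc - θ₀‖ + K * A1 := by
    have e1 : avg E - D = (avg fun m => (third (f m) θ₀ - T) (θloc m - θ₀)) +
        T (stage0 θloc - θ₀) +
        avg fun m => hess (f m) (θloc m) - hess (f m) θ₀ - third (f m) θ₀ (θloc m - θ₀) := by
      rw [hD, h.mean_hess_sub, ← avg_sub, h.stage0_sub, map_avg, ← avg_add, ← avg_add]
      congr 1
      funext m
      have e2 : ∀ a o b t k : Mat p, a - o - (b - o) = (t - k) + k + (a - b - t) :=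
        fun a o b t k => by abel
      exact e2 _ _ _ _ _
    rw [e1]
    refine (norm_add_le _ _).trans (add_le_add ((norm_add_le _ _).trans (add_le_add
      (norm_avg_le _) ?_)) ?_)
    · exact (T.le_opNorm _).trans (mul_le_mul_of_nonneg_right h.norm_T (norm_nonneg _))
    · refine (norm_avg_le _).trans ?_
      rw [hA1, ← avg_const_mul]
      exact avg_mono fun m => (h.loss m).norm_hess_sub_le hK.le
        ((h.loc_facts m).2.2.trans h.hrδ.le)
  have h7 : ‖R * (avg E - D) * R‖ ≤ 1 / τ ^ 2 * (A3 + K * ‖stage0 θloc - θ₀‖ + K * A1) := by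
    calc ‖R * (avg E - D) * R‖ ≤ ‖R‖ * ‖avg E - D‖ * ‖R‖ :=
          (norm_mul_le _ _).trans (mul_le_mul_of_nonneg_right (norm_mul_le _ _) (norm_nonneg _))
      _ ≤ 1 / τ * (A3 + K * ‖stage0 θloc - θ₀‖ + K * A1) * (1 / τ) := by gcongr
      _ = _ := by ring
  rw [h3]
  refine (norm_sub_le _ _).trans ((add_le_add ((norm_sub_le _ _).trans
    (add_le_add h4 (h2.trans (mul_le_mul_of_nonneg_left h5 (by positivity))))) h7).trans ?_)
  set b := ‖stage0 θloc - θ₀‖ with hb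
  have bn : 0 ≤ b := norm_nonneg _
  have i1 : 2 / τ ^ 3 * (2 * A2 + 2 * K ^ 2 * A1) + 2 / τ ^ 3 * A2 ≤
      (6 + 4 * K ^ 2) / τ ^ 3 * (A + b) := by
    have : 2 / τ ^ 3 * (2 * A2 + 2 * K ^ 2 * A1) + 2 / τ ^ 3 * A2 =
      (6 * A2 + 4 * K ^ 2 * A1) / τ ^ 3 := by ring
    rw [this, div_mul_eq_mul_div]
    gcongr
    nlinarith [sq_nonneg K, mul_nonneg (sq_nonneg K) A2n, mul_nonneg (sq_nonneg K) A3n,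
      mul_nonneg (sq_nonneg K) bn]
  have i2 : 1 / τ ^ 2 * (A3 + K * b + K * A1) ≤ (1 + K) / τ ^ 2 * (A + b) := by
    rw [div_mul_eq_mul_div, div_mul_eq_mul_div, one_mul]
    gcongr
    nlinarith [mul_nonneg hK.le A2n, mul_nonneg hK.le A3n]
  linarith

/-- A crude bound for the distance of the averaged inverse Hessian to the inverse of the global
Hessian. -/
theorem norm_avg_H_sub_le_radius {Q : Mat p} (hPQ : hess (meanLoss f) θ₀ * Q = 1)
    (hQ : ‖Q‖ ≤ 2 / τ) : ‖avg H - Q‖ ≤ 2 / τ ^ 2 * (2 + K) * r := by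
  obtain ⟨R, hΩR, hRΩ, hR⟩ := h.exists_inverse_Ω
  have hτ := h.hτ
  have hK := h.hK
  have h1 : ∀ m, ‖H m - R‖ ≤ 2 / τ ^ 2 * (r + K * r) := fun m => by
    refine ((norm_inverse_sub_le hτ (h.mul_inv m) hRΩ (h.norm_H_le m) hR).1).trans ?_
    gcongr
    refine (h.norm_hess_loc_sub m).trans (add_le_add ((h.norm_hess m).trans h.hεr') ?_)
    exact mul_le_mul_of_nonneg_left (h.loc_facts m).2.2 hK.le
  have h2 : ‖Q - R‖ ≤ 2 / τ ^ 2 * r := by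
    refine ((norm_inverse_sub_le hτ hPQ hRΩ hQ hR).1).trans ?_
    gcongr
    exact h.norm_mean_hess.trans h.hεr'
  have h3 : avg H - Q = (avg fun m => H m - R) - (Q - R) := by
    rw [avg_sub, avg_const h.hM]; abel
  rw [h3]
  refine (norm_sub_le _ _).trans ((add_le_add (norm_avg_le_of_le h.hM h1) h2).trans
    (le_of_eq ?_))
  ring

/-- The global estimator is as close to `θ₀` as the error terms of the local estimators. -/
theorem norm_mean_gradient_le : ‖gradient (meanLoss f) θ₀‖ ≤
    (1 + K + Λ) * (errSum f θ₀ Ω T θloc + ‖stage0 θloc - θ₀‖) := by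
  have hK := h.hK
  -- Replacing the local Hessian by `Ω` in the estimating equation costs only quadratic terms. With
  -- `Ω` common to all workers the equation can be averaged, which yields the global gradient and
  -- `stage0`.
  have h1 : ∀ m, ‖gradient (f m) θ₀ + Ω (θloc m - θ₀)‖ ≤
      (1 + K) * (‖θloc m - θ₀‖ ^ 2 + ‖hess (f m) θ₀ - Ω‖ ^ 2 +
        ‖(third (f m) θ₀ - T) (θloc m - θ₀)‖) := fun m => by
    have h2 := h.first_order (h.loss m) (h.loc_facts m).1 (h.loc_facts m).2.2
    have h3 : gradient (f m) θ₀ + Ω (θloc m - θ₀) = (gradient (f m) θ₀ +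
        hess (f m) θ₀ (θloc m - θ₀)) - (hess (f m) θ₀ - Ω) (θloc m - θ₀) := by
      rw [_root_.sub_apply]; abel
    rw [h3]
    have h4 := (hess (f m) θ₀ - Ω).le_opNorm (θloc m - θ₀)
    have h5 : ‖hess (f m) θ₀ - Ω‖ * ‖θloc m - θ₀‖ ≤
        ‖θloc m - θ₀‖ ^ 2 + ‖hess (f m) θ₀ - Ω‖ ^ 2 := by
      nlinarith [sq_nonneg (‖hess (f m) θ₀ - Ω‖ - ‖θloc m - θ₀‖), sq_nonneg ‖θloc m - θ₀‖,
        sq_nonneg ‖hess (f m) θ₀ - Ω‖]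
    refine (norm_sub_le _ _).trans ?_
    nlinarith [mul_nonneg hK.le (sq_nonneg ‖hess (f m) θ₀ - Ω‖),
      mul_nonneg hK.le (norm_nonneg ((third (f m) θ₀ - T) (θloc m - θ₀))),
      norm_nonneg ((third (f m) θ₀ - T) (θloc m - θ₀))]
  have h2 : ‖gradient (meanLoss f) θ₀ + Ω (stage0 θloc - θ₀)‖ ≤
      (1 + K) * errSum f θ₀ Ω T θloc := by
    rw [gradient_meanLoss h.loss h.center_mem, h.stage0_sub, map_avg, ← avg_add, errSum,
      ← avg_const_mul]
    exact (norm_avg_le _).trans (avg_mono h1)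
  have h3 : gradient (meanLoss f) θ₀ = (gradient (meanLoss f) θ₀ + Ω (stage0 θloc - θ₀)) -
    Ω (stage0 θloc - θ₀) := by abel
  rw [h3]
  refine (norm_sub_le _ _).trans ?_
  have h4 := (Ω.le_opNorm (stage0 θloc - θ₀)).trans
    (mul_le_mul_of_nonneg_right h.norm_Ω (norm_nonneg _))
  nlinarith [mul_nonneg hK.le (norm_nonneg (stage0 θloc - θ₀)), norm_nonneg (stage0 θloc - θ₀),
    mul_nonneg h.Λ_nonneg (errSum_nonneg (f := f) (θ₀ := θ₀) (Ω := Ω) (T := T)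
      (θloc := θloc))]

/-- The estimating equation up to second-order errors. -/
theorem norm_linearized_le {R : Mat p} (hRΩ : R * Ω = 1) (hR : ‖R‖ ≤ 1 / τ)
    {g : Vec p → ℝ} (hg : SmoothLoss Θ θ₀ δ K g) (hgh : ‖hess g θ₀ - Ω‖ ≤ ε) {θ : Vec p}
    (hθ : gradient g θ = 0) (hθg : ‖θ - θ₀‖ ≤ 2 / τ * ‖gradient g θ₀‖) (hθr : ‖θ - θ₀‖ ≤ r) :
    ‖gradient g θ₀ + Ω (θ - θ₀)‖ ≤ (2 + 8 * K / τ ^ 2) * secondOrder g θ₀ Ω R := by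
  have hτ := h.hτ
  have hK := h.hK
  set D := hess g θ₀ - Ω with hD
  set u := θ - θ₀ with hu
  set ξ := gradient g θ₀ + hess g θ₀ u with hξ
  have h1 : ‖ξ‖ ≤ K * ‖u‖ ^ 2 := h.first_order hg hθ hθr
  have hRO : ∀ x, R (Ω x) = x := fun x => congrArg (fun T : Mat p => T x) hRΩ
  have e1 : u = R ξ - R (gradient g θ₀) - R (D u) := by
    have : D u = ξ - gradient g θ₀ - Ω u := by rw [hD, _root_.sub_apply, hξ]; abel
    rw [this, map_sub, map_sub, hRO]; abel
  -- The linearized equation is solved for `u` and inserted into `D u`. As `D R` contracts by `1 /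
  -- 2`, the last term is absorbed. What remains is `D R ∇g(θ₀)`, a product of centered means,
  -- instead of `‖D‖ ‖u‖`, which would cost a power of `p`.
  have e2 : D u = D (R ξ) - D (R (gradient g θ₀)) - D (R (D u)) := by
    rw [← map_sub, ← map_sub, ← e1]
  have hD4 : ∀ x, ‖D (R x)‖ ≤ 1 / 2 * ‖x‖ := fun x => by
    calc ‖D (R x)‖ ≤ ‖D‖ * (‖R‖ * ‖x‖) :=
          (D.le_opNorm _).trans (mul_le_mul_of_nonneg_left (R.le_opNorm _) (norm_nonneg _))
      _ ≤ (τ / 2) * (1 / τ * ‖x‖) := by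
          gcongr
          exact hgh.trans (h.hετ.trans (by linarith))
      _ = 1 / 2 * ‖x‖ := by field_simp
  have h2 : ‖D u‖ ≤ K * ‖u‖ ^ 2 + 2 * ‖D (R (gradient g θ₀))‖ := by
    have h3 := norm_sub_le (D (R ξ) - D (R (gradient g θ₀))) (D (R (D u)))
    rw [← e2] at h3
    have h4 := norm_sub_le (D (R ξ)) (D (R (gradient g θ₀)))
    have h5 := hD4 ξ
    have h6 := hD4 (D u)
    linarith
  have e3 : gradient g θ₀ + Ω u = ξ - D u := by
    rw [hξ, hD, _root_.sub_apply]; abel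
  have h3 : ‖u‖ ^ 2 ≤ 4 / τ ^ 2 * ‖gradient g θ₀‖ ^ 2 := by
    refine (pow_le_pow_left₀ (norm_nonneg _) hθg 2).trans (le_of_eq ?_)
    rw [mul_pow, div_pow]; norm_num
  rw [e3, secondOrder, ← hD]
  refine (norm_sub_le _ _).trans ?_
  have h4 := mul_le_mul_of_nonneg_left h3 hK.le
  have h5 : 0 ≤ 8 * K / τ ^ 2 * ‖D (R (gradient g θ₀))‖ := by positivity
  have h6 : K * (4 / τ ^ 2 * ‖gradient g θ₀‖ ^ 2) = 8 * K / τ ^ 2 * ‖gradient g θ₀‖ ^ 2 / 2 := by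
    ring
  have h7 := sq_nonneg ‖gradient g θ₀‖
  nlinarith

/-- The initial estimator and the global estimator agree up to second-order errors. -/
theorem norm_stage0_sub_ge_le {R : Mat p} (hRΩ : R * Ω = 1) (hR : ‖R‖ ≤ 1 / τ) :
    ‖stage0 θloc - θge‖ ≤ (2 + 8 * K / τ ^ 2) / τ *
      ((avg fun m => secondOrder (f m) θ₀ Ω R) + secondOrder (meanLoss f) θ₀ Ω R) := by
  have hτ := h.hτ
  have hK := h.hK
  have h1 : ‖gradient (meanLoss f) θ₀ + Ω (stage0 θloc - θ₀)‖ ≤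
      (2 + 8 * K / τ ^ 2) * avg fun m => secondOrder (f m) θ₀ Ω R := by
    rw [gradient_meanLoss h.loss h.center_mem, h.stage0_sub, map_avg, ← avg_add, ← avg_const_mul]
    exact (norm_avg_le _).trans (avg_mono fun m => h.norm_linearized_le hRΩ hR (h.loss m)
      (h.norm_hess m) (h.loc_facts m).1 (h.loc_facts m).2.1 (h.loc_facts m).2.2)
  have h2 := h.norm_linearized_le hRΩ hR h.mean h.norm_mean_hess h.ge_facts.1 h.ge_facts.2.1
    h.ge_facts.2.2
  have hRO : ∀ x, R (Ω x) = x := fun x => congrArg (fun T : Mat p => T x) hRΩ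
  -- Both estimators solve the same linear equation up to second order, and the common global
  -- gradient cancels.
  have e : stage0 θloc - θge = R ((gradient (meanLoss f) θ₀ + Ω (stage0 θloc - θ₀)) -
      (gradient (meanLoss f) θ₀ + Ω (θge - θ₀))) := by
    rw [add_sub_add_left_eq_sub, ← map_sub, hRO]; abel
  rw [e]
  refine (R.le_opNorm _).trans ?_
  refine (mul_le_mul hR ((norm_sub_le _ _).trans (add_le_add h1 h2)) (norm_nonneg _)
    (by positivity)).trans (le_of_eq ?_)
  ring

end Localized

/-- The constant in `norm_avg_H_sub_le`. -/
def invConst (τ K : ℝ) : ℝ := (6 + 4 * K ^ 2) / τ ^ 3 + (1 + K) / τ ^ 2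

/-- The constant in `norm_ge_sub_le`. -/
def geConst (τ Λ K : ℝ) : ℝ := 2 / τ * (1 + K + Λ)

/-- The constant in `norm_increment_le`. -/
def incrConst (τ Λ : ℝ) : ℝ := 2 / τ * (Λ + 2 * τ)

/-- The constant in `norm_stage1_sub_ge_le`. -/
def stage1Const (τ Λ K : ℝ) : ℝ :=
  invConst τ K * (Λ + 2 * τ) + 2 / τ * K * (1 + geConst τ Λ K)

/-- The points of the quasi-Newton step are within this multiple of the error terms from `θ₀`. -/
def radiusConst (τ Λ K : ℝ) : ℝ := 1 + incrConst τ Λ * (1 + geConst τ Λ K) + geConst τ Λ K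

/-- The constant in `norm_update_sub_le`. -/
def updateConst (τ Λ K c₁ : ℝ) : ℝ :=
  ((1 + 8 * (Λ + τ) / τ) ^ 2 * invConst τ K +
    (16 / τ ^ 2 + 64 * (Λ + τ) / τ ^ 3) * (K * radiusConst τ Λ K)) +
  (invConst τ K + 4 / (c₁ * τ) * (invConst τ K * (Λ + τ) + 2 / τ * (K * radiusConst τ Λ K)))

/-- The constant in `norm_stage2_sub_ge_le`. -/
def stage2Const (τ Λ K c₁ : ℝ) : ℝ :=
  updateConst τ Λ K c₁ * (Λ + 2 * τ) + 2 / τ * (K * radiusConst τ Λ K)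

/-! ### The two quasi-Newton steps -/

namespace Localized

variable {p M : ℕ} {Θ : Set (Vec p)} {θ₀ : Vec p} {δ K τ Λ r ε c₁ : ℝ}
  {f : Fin M → Vec p → ℝ} {Ω : Mat p} {T : Vec p →L[ℝ] Mat p} {θloc : Fin M → Vec p}
  {θge : Vec p} {H : Fin M → Mat p} (h : Localized Θ θ₀ δ K τ Λ r ε f Ω T θloc θge H)
include h

theorem norm_ge_sub_le : ‖θge - θ₀‖ ≤
    geConst τ Λ K * (errSum f θ₀ Ω T θloc + ‖stage0 θloc - θ₀‖) := by
  have hτ := h.hτ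
  refine h.ge_facts.2.1.trans ?_
  rw [geConst, mul_assoc]
  exact mul_le_mul_of_nonneg_left h.norm_mean_gradient_le (by positivity)

theorem norm_mean_hess_le : ‖hess (meanLoss f) θ₀‖ ≤ Λ + τ := by
  have h1 : hess (meanLoss f) θ₀ = Ω + (hess (meanLoss f) θ₀ - Ω) := by abel
  rw [h1]
  refine (norm_add_le _ _).trans (add_le_add h.norm_Ω (h.norm_mean_hess.trans (h.hετ.trans ?_)))
  linarith [h.hτ]

theorem gradient_expansion {ρ : ℝ} {x : Vec p} (hx : ‖x - θ₀‖ ≤ ρ) (hge : ‖θge - θ₀‖ ≤ ρ)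
    (hρ : ρ ≤ δ) :
    ‖gradient (meanLoss f) x - hess (meanLoss f) θ₀ (x - θge)‖ ≤ K * ρ * ‖x - θge‖ := by
  have h1 := h.mean.norm_gradient_sub_le h.hK.le hρ hge hx
  rwa [h.ge_facts.1, sub_zero] at h1

theorem norm_gradient_le {ρ : ℝ} {x : Vec p} (hx : ‖x - θ₀‖ ≤ ρ) (hge : ‖θge - θ₀‖ ≤ ρ)
    (hρ : ρ ≤ δ) (hKρ : K * ρ ≤ τ) :
    ‖gradient (meanLoss f) x‖ ≤ (Λ + 2 * τ) * ‖x - θge‖ := by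
  have h1 := h.gradient_expansion hx hge hρ
  have h2 : gradient (meanLoss f) x = (gradient (meanLoss f) x -
    hess (meanLoss f) θ₀ (x - θge)) + hess (meanLoss f) θ₀ (x - θge) := by abel
  rw [h2]
  refine (norm_add_le _ _).trans ?_
  have h3 := ((hess (meanLoss f) θ₀).le_opNorm (x - θge)).trans
    (mul_le_mul_of_nonneg_right h.norm_mean_hess_le (norm_nonneg _))
  have h4 := mul_le_mul_of_nonneg_right hKρ (norm_nonneg (x - θge))
  linarith

/-- One quasi-Newton step with the matrix `B` contracts the distance to the global estimator. -/
theorem norm_step_sub_ge_le {Q B : Mat p} (hQP : Q * hess (meanLoss f) θ₀ = 1) (hQ : ‖Q‖ ≤ 2 / τ)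
    {ρ b : ℝ} {x : Vec p} (hx : ‖x - θ₀‖ ≤ ρ) (hge : ‖θge - θ₀‖ ≤ ρ)
    (hρ : ρ ≤ δ) (hKρ : K * ρ ≤ τ) (hB : ‖B - Q‖ ≤ b) :
    ‖x - B (gradient (meanLoss f) x) - θge‖ ≤
      (b * (Λ + 2 * τ) + 2 / τ * (K * ρ)) * ‖x - θge‖ := by
  have hτ := h.hτ
  have h1 := h.gradient_expansion hx hge hρ
  have h2 := h.norm_gradient_le hx hge hρ hKρ
  set g := gradient (meanLoss f) x with hg
  set P := hess (meanLoss f) θ₀ with hP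
  have hQPx : ∀ y, Q (P y) = y := fun y => congrArg (fun T : Mat p => T y) hQP
  -- Comparison with the exact step: the first term is the error of the matrix, the second the
  -- nonlinearity of the gradient.
  have e : x - B g - θge = -((B - Q) g) - Q (g - P (x - θge)) := by
    rw [_root_.sub_apply, map_sub, hQPx]; abel
  rw [e]
  refine (norm_sub_le _ _).trans ?_
  rw [norm_neg, add_mul]
  refine add_le_add (((B - Q).le_opNorm _).trans ?_) ((Q.le_opNorm _).trans ?_)
  · rw [mul_assoc]
    exact mul_le_mul hB h2 (norm_nonneg _) ((norm_nonneg _).trans hB)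
  · rw [mul_assoc (2 / τ)]
    exact mul_le_mul hQ h1 (norm_nonneg _) (by positivity)

omit h in
theorem stage1_eq (x : Vec p) : stage1 (meanLoss f) H x =
    x - avg H (gradient (meanLoss f) x) := by
  rw [stage1, avg_apply]

/-- The one-stage estimator improves the initial estimator. -/
theorem norm_stage1_sub_ge_le : ‖stage1 (meanLoss f) H (stage0 θloc) - θge‖ ≤
    stage1Const τ Λ K * (errSum f θ₀ Ω T θloc + ‖stage0 θloc - θ₀‖) *
      ‖stage0 θloc - θge‖ := by
  obtain ⟨Q, hPQ, hQP, hQ⟩ := h.exists_inverse_mean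
  have hτ := h.hτ
  have hK := h.hK
  rw [stage1_eq]
  set a := errSum f θ₀ Ω T θloc + ‖stage0 θloc - θ₀‖ with ha
  have hA : 0 ≤ errSum f θ₀ Ω T θloc := errSum_nonneg
  -- The radius is bounded twice: by `r`, to stay where the expansions hold, and by a multiple of
  -- `a`, to obtain the rate.
  set ρ := max ‖stage0 θloc - θ₀‖ ‖θge - θ₀‖ with hρ
  have hρr : ρ ≤ r := max_le h.norm_stage0_sub h.ge_facts.2.2
  have hge0 : 0 ≤ geConst τ Λ K := mul_nonneg (by positivity) (by linarith [h.Λ_nonneg])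
  have ha0 : 0 ≤ a := add_nonneg hA (norm_nonneg _)
  have hρa : ρ ≤ (1 + geConst τ Λ K) * a := by
    refine max_le ?_ ?_
    · have := mul_nonneg hge0 ha0
      linarith
    · have := h.norm_ge_sub_le
      linarith
  refine (h.norm_step_sub_ge_le hQP hQ (le_max_left _ _) (le_max_right _ _)
    (hρr.trans h.hrδ.le) ((mul_le_mul_of_nonneg_left hρr hK.le).trans (h.hKr.trans (by linarith)))
    (h.norm_avg_H_sub_le hPQ hQ)).trans ?_
  refine mul_le_mul_of_nonneg_right ?_ (norm_nonneg _)
  rw [stage1Const, ← invConst, ← ha]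
  have h1 : 2 / τ * (K * ρ) ≤ 2 / τ * (K * ((1 + geConst τ Λ K) * a)) := by gcongr
  linarith

theorem norm_increment_le : ‖stage1 (meanLoss f) H (stage0 θloc) - stage0 θloc‖ ≤
    incrConst τ Λ * ‖stage0 θloc - θge‖ := by
  have hτ := h.hτ
  have hK := h.hK
  rw [stage1_eq, sub_sub_cancel_left, norm_neg, incrConst, mul_assoc]
  have h1 := h.norm_gradient_le h.norm_stage0_sub h.ge_facts.2.2 h.hrδ.le
    (h.hKr.trans (by linarith))
  exact ((avg H).le_opNorm _).trans (mul_le_mul h.norm_avg_H_le h1 (norm_nonneg _) (by positivity))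

omit h in
theorem norm_stage0_sub_ge : ‖stage0 θloc - θge‖ ≤ ‖stage0 θloc - θ₀‖ + ‖θge - θ₀‖ := by
  have : stage0 θloc - θge = (stage0 θloc - θ₀) - (θge - θ₀) := by abel
  rw [this]
  exact norm_sub_le _ _

variable {S : Strategy}

theorem incrConst_nonneg : 0 ≤ incrConst τ Λ := by
  have hτ := h.hτ
  have hΛ := h.Λ_nonneg
  unfold incrConst
  positivity

theorem geConst_nonneg : 0 ≤ geConst τ Λ K := by
  have hτ := h.hτ
  have hΛ := h.Λ_nonneg
  have hK := h.hK
  unfold geConst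
  positivity

/-- The points of the second step stay in a small neighbourhood of `θ₀`. -/
theorem radius_le :
    ‖stage0 θloc - θ₀‖ + ‖stage1 (meanLoss f) H (stage0 θloc) - stage0 θloc‖ + ‖θge - θ₀‖ ≤
      radiusConst τ Λ K * (errSum f θ₀ Ω T θloc + ‖stage0 θloc - θ₀‖) ∧
    ‖stage0 θloc - θ₀‖ + ‖stage1 (meanLoss f) H (stage0 θloc) - stage0 θloc‖ + ‖θge - θ₀‖ ≤
      (2 + 2 * incrConst τ Λ) * r := by
  have h1 := h.norm_increment_le
  have h2 := norm_stage0_sub_ge (θloc := θloc) (θge := θge) (θ₀ := θ₀)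
  have h3 := h.norm_ge_sub_le
  have h4 := h.norm_stage0_sub
  have h5 := h.ge_facts.2.2
  have hA : 0 ≤ errSum f θ₀ Ω T θloc := errSum_nonneg
  set a := errSum f θ₀ Ω T θloc + ‖stage0 θloc - θ₀‖ with ha
  have hi := h.incrConst_nonneg
  constructor
  · have h6 : ‖stage0 θloc - θge‖ ≤ (1 + geConst τ Λ K) * a := by linarith
    have h7 := mul_le_mul_of_nonneg_left h6 hi
    rw [radiusConst]
    linarith
  · have h6 : ‖stage0 θloc - θge‖ ≤ 2 * r := by linarith
    have h7 := mul_le_mul_of_nonneg_left h6 hi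
    linarith

/-- The updated matrix is close to the inverse of the global Hessian. -/
theorem norm_update_sub_le {Q : Mat p} (hPQ : hess (meanLoss f) θ₀ * Q = 1)
    (hQP : Q * hess (meanLoss f) θ₀ = 1) (hQ : ‖Q‖ ≤ 2 / τ) (hc : 0 < c₁)
    (hs1 : (2 + 2 * incrConst τ Λ) * r ≤ δ) (hs2 : K * ((2 + 2 * incrConst τ Λ) * r) ≤ τ / 4)
    (hs3 : 2 / τ ^ 2 * (2 + K) * r * (Λ + τ) + 2 / τ * (K * ((2 + 2 * incrConst τ Λ) * r)) ≤
      c₁ / 2) :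
    ‖update c₁ S (avg H) (stage1 (meanLoss f) H (stage0 θloc) - stage0 θloc)
        (gradient (meanLoss f) (stage1 (meanLoss f) H (stage0 θloc)) -
          gradient (meanLoss f) (stage0 θloc)) - Q‖ ≤
      updateConst τ Λ K c₁ * (errSum f θ₀ Ω T θloc + ‖stage0 θloc - θ₀‖) := by
  have hτ := h.hτ
  have hK := h.hK
  have hΛ := h.Λ_nonneg
  obtain ⟨hr1, hr2⟩ := h.radius_le
  have hd := h.norm_avg_H_sub_le hPQ hQ
  rw [← invConst] at hd
  have hd' := h.norm_avg_H_sub_le_radius hPQ hQ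
  have hA : 0 ≤ errSum f θ₀ Ω T θloc := errSum_nonneg
  set a := errSum f θ₀ Ω T θloc + ‖stage0 θloc - θ₀‖ with ha
  have ha0 : 0 ≤ a := add_nonneg hA (norm_nonneg _)
  set x := stage0 θloc with hx
  set x' := stage1 (meanLoss f) H x with hx'
  set ρ := ‖x - θ₀‖ + ‖x' - x‖ + ‖θge - θ₀‖ with hρ
  have hρ0 : 0 ≤ ρ := by positivity
  have n1 : ‖x - θ₀‖ ≤ ρ := by
    have := norm_nonneg (x' - x); have := norm_nonneg (θge - θ₀); linarith
  have n2 : ‖x' - θ₀‖ ≤ ρ := by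
    have e : x' - θ₀ = (x' - x) + (x - θ₀) := by abel
    have := norm_add_le (x' - x) (x - θ₀)
    rw [← e] at this
    have := norm_nonneg (θge - θ₀); linarith
  have hKρ : K * ρ ≤ τ / 4 := (mul_le_mul_of_nonneg_left hr2 hK.le).trans hs2
  -- The secant equation holds with error `γ = K ρ` by the mean value inequality on a ball
  -- containing both iterates.
  have N : NearSecant (hess (meanLoss f) θ₀) Q (avg H) (x' - x)
      (gradient (meanLoss f) x' - gradient (meanLoss f) x) τ (Λ + τ) ‖avg H - Q‖ (K * ρ) :=
    { pos := hτ
      coercive := fun u => by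
        refine le_trans ?_ (h.coercive_of_near h.norm_mean_hess u)
        gcongr ?_ * _
        linarith
      mul_inv := hPQ
      inv_mul := hQP
      norm_P := h.norm_mean_hess_le
      norm_Q := hQ
      norm_H := h.norm_avg_H_le
      symm_P := inner_hess_symm (h.mean.smooth θ₀ h.center_mem)
      symm_H := h.avg_H_symm
      dist := le_rfl
      secant := h.mean.norm_gradient_sub_le hK.le (hr2.trans hs1) n1 n2
      γ_le := hKρ
      γ_le' := by linarith
      γ_nonneg := by positivity }
  have hinv : 0 ≤ invConst τ K := by unfold invConst; positivity
  have hrad : 0 ≤ radiusConst τ Λ K := by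
    have := h.incrConst_nonneg
    have := h.geConst_nonneg
    unfold radiusConst; positivity
  have hKρa : K * ρ ≤ K * radiusConst τ Λ K * a := by
    rw [mul_assoc]; exact mul_le_mul_of_nonneg_left hr1 hK.le
  cases S with
  | bfgs =>
    refine N.norm_secant_update_sub_le.trans ?_
    have h1 : (1 + 8 * (Λ + τ) / τ) ^ 2 * ‖avg H - Q‖ ≤
        (1 + 8 * (Λ + τ) / τ) ^ 2 * (invConst τ K * a) := by gcongr
    have h2 : (16 / τ ^ 2 + 64 * (Λ + τ) / τ ^ 3) * (K * ρ) ≤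
        (16 / τ ^ 2 + 64 * (Λ + τ) / τ ^ 3) * (K * radiusConst τ Λ K * a) := by gcongr
    -- `updateConst` adds the constants of the two strategies, so the share of the other one is
    -- merely nonnegative.
    have h3 : 0 ≤ (invConst τ K + 4 / (c₁ * τ) *
        (invConst τ K * (Λ + τ) + 2 / τ * (K * radiusConst τ Λ K))) * a := by positivity
    rw [updateConst, add_mul _ _ a]
    linarith
  | sr1 =>
    -- The smallness required by SR1 is checked with the bound in terms of `r`, since `a` is not
    -- assumed small; the conclusion uses the bound in terms of `a`.
    refine (N.norm_sr1_sub_le hc ?_).trans ?_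
    · refine le_trans (add_le_add ?_ ?_) hs3
      · exact mul_le_mul_of_nonneg_right hd' (by linarith)
      · gcongr
    · have h1 : ‖avg H - Q‖ * (Λ + τ) + 2 / τ * (K * ρ) ≤
          (invConst τ K * (Λ + τ) + 2 / τ * (K * radiusConst τ Λ K)) * a := by
        have h2 : ‖avg H - Q‖ * (Λ + τ) ≤ invConst τ K * a * (Λ + τ) := by gcongr
        have h3 : 2 / τ * (K * ρ) ≤ 2 / τ * (K * radiusConst τ Λ K * a) := by gcongr
        linarith
      have h4 : 4 / (c₁ * τ) * (‖avg H - Q‖ * (Λ + τ) + 2 / τ * (K * ρ)) ≤ 4 / (c₁ * τ) *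
          ((invConst τ K * (Λ + τ) + 2 / τ * (K * radiusConst τ Λ K)) * a) := by gcongr
      have h5 : 0 ≤ ((1 + 8 * (Λ + τ) / τ) ^ 2 * invConst τ K +
        (16 / τ ^ 2 + 64 * (Λ + τ) / τ ^ 3) * (K * radiusConst τ Λ K)) * a := by positivity
      rw [updateConst, add_mul _ _ a]
      linarith

/-- The two-stage estimator improves the one-stage estimator. -/
theorem norm_stage2_sub_ge_le (hc : 0 < c₁)
    (hs1 : (2 + 2 * incrConst τ Λ) * r ≤ δ) (hs2 : K * ((2 + 2 * incrConst τ Λ) * r) ≤ τ / 4)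
    (hs3 : 2 / τ ^ 2 * (2 + K) * r * (Λ + τ) + 2 / τ * (K * ((2 + 2 * incrConst τ Λ) * r)) ≤
      c₁ / 2) :
    ‖stage2 c₁ S (meanLoss f) H (stage0 θloc) (stage1 (meanLoss f) H (stage0 θloc)) - θge‖ ≤
      stage2Const τ Λ K c₁ * (errSum f θ₀ Ω T θloc + ‖stage0 θloc - θ₀‖) *
        ‖stage1 (meanLoss f) H (stage0 θloc) - θge‖ := by
  obtain ⟨Q, hPQ, hQP, hQ⟩ := h.exists_inverse_mean
  have hτ := h.hτ
  have hK := h.hK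
  have hu := h.norm_update_sub_le (S := S) hPQ hQP hQ hc hs1 hs2 hs3
  obtain ⟨hr1, hr2⟩ := h.radius_le
  rw [stage2_eq h.hM]
  set a := errSum f θ₀ Ω T θloc + ‖stage0 θloc - θ₀‖ with ha
  set x := stage0 θloc with hx
  set x' := stage1 (meanLoss f) H x with hx'
  set ρ := ‖x - θ₀‖ + ‖x' - x‖ + ‖θge - θ₀‖ with hρ
  have n2 : ‖x' - θ₀‖ ≤ ρ := by
    have e : x' - θ₀ = (x' - x) + (x - θ₀) := by abel
    have := norm_add_le (x' - x) (x - θ₀)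
    rw [← e] at this
    have := norm_nonneg (θge - θ₀); linarith
  have n3 : ‖θge - θ₀‖ ≤ ρ := by
    have := norm_nonneg (x' - x); have := norm_nonneg (x - θ₀); linarith
  refine (h.norm_step_sub_ge_le hQP hQ n2 n3 (hr2.trans hs1)
    ((mul_le_mul_of_nonneg_left hr2 hK.le).trans (hs2.trans (by linarith))) hu).trans ?_
  refine mul_le_mul_of_nonneg_right ?_ (norm_nonneg _)
  have h1 : 2 / τ * (K * ρ) ≤ 2 / τ * (K * (radiusConst τ Λ K * a)) := by gcongr
  rw [stage2Const]
  linarith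

end Localized

/-! ### Derivatives of measurable families -/

section Measurability

variable {𝓧 : Type*} [MeasurableSpace 𝓧] {p : ℕ} {F : Type*} [NormedAddCommGroup F]
  [NormedSpace ℝ F] [MeasurableSpace F] [BorelSpace F] [SecondCountableTopology F]

omit [MeasurableSpace F] [BorelSpace F] [SecondCountableTopology F] in
theorem sum_smulRight_single (L : Vec p →L[ℝ] F) :
    ∑ j, (EuclideanSpace.proj j : Vec p →L[ℝ] ℝ).smulRight (L (EuclideanSpace.single j 1)) = L := by
  ext u
  rw [_root_.sum_apply]
  conv_rhs => rw [← (EuclideanSpace.basisFun (Fin p) ℝ).sum_repr u]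
  simp [map_sum]

theorem measurable_of_measurable_single {L : 𝓧 → Vec p →L[ℝ] F}
    (h : ∀ j, Measurable fun z => L z (EuclideanSpace.single j 1)) : Measurable L := by
  have hc : Continuous fun w : Fin p → F =>
      ∑ j, (EuclideanSpace.proj j : Vec p →L[ℝ] ℝ).smulRight (w j) :=
    continuous_finsetSum _ fun j _ =>
      ((ContinuousLinearMap.smulRightL ℝ (Vec p) F (EuclideanSpace.proj j)).continuous).comp
        (continuous_apply j)
  have h1 := hc.measurable.comp (measurable_pi_lambda _ h)
  rwa [funext fun z => (sum_smulRight_single (L z)).symm]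

/-- The derivative of a measurable family of differentiable functions is measurable. -/
theorem measurable_fderiv_family_apply {f : 𝓧 → Vec p → F} {θ : Vec p}
    (hd : ∀ z, DifferentiableAt ℝ (f z) θ) (hm : ∀ᶠ x in 𝓝 θ, Measurable fun z => f z x)
    (u : Vec p) : Measurable fun z => fderiv ℝ (f z) θ u := by
  have hc : Tendsto (fun k : ℕ => (k : ℝ)) atTop atTop := tendsto_natCast_atTop_atTop
  have hs : Tendsto (fun k : ℕ => θ + (k : ℝ)⁻¹ • u) atTop (𝓝 θ) := by
    simpa using (tendsto_inv_atTop_nhds_zero_nat (𝕜 := ℝ).smul_const u).const_add θ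
  obtain ⟨k₀, hk₀⟩ := eventually_atTop.1 (hs.eventually hm)
  -- The derivative is a limit of difference quotients. The shift by `k₀` keeps the evaluation
  -- points where measurability is known.
  refine measurable_of_tendsto_metrizable
    (f := fun (k : ℕ) z => ((k + k₀ : ℕ) : ℝ) • (f z (θ + ((k + k₀ : ℕ) : ℝ)⁻¹ • u) - f z θ))
    (fun k => ((hk₀ _ (Nat.le_add_left _ _)).sub hm.self_of_nhds).const_smul _) ?_
  rw [tendsto_pi_nhds]
  intro z
  have h1 := (hd z).hasFDerivAt.lim u (tendsto_norm_atTop_atTop.comp hc)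
  exact h1.comp (tendsto_add_atTop_nat k₀)

theorem measurable_fderiv_family {f : 𝓧 → Vec p → F} {θ : Vec p}
    (hd : ∀ z, DifferentiableAt ℝ (f z) θ) (hm : ∀ᶠ x in 𝓝 θ, Measurable fun z => f z x) :
    Measurable fun z => fderiv ℝ (f z) θ :=
  measurable_of_measurable_single fun _ => measurable_fderiv_family_apply hd hm _

/-- Differentiation under the integral sign for a measurable family with dominated derivatives. -/
theorem fderiv_integral_family [CompleteSpace F] {μ : Measure 𝓧} {f : 𝓧 → Vec p → F} {θ : Vec p}
    {δ : ℝ} {bound : 𝓧 → ℝ} (hδ : 0 < δ)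
    (hd : ∀ z, ∀ x ∈ Metric.ball θ δ, DifferentiableAt ℝ (f z) x)
    (hm : ∀ x ∈ Metric.ball θ δ, Measurable fun z => f z x) (hi : Integrable (fun z => f z θ) μ)
    (hb : ∀ z, ∀ x ∈ Metric.ball θ δ, ‖fderiv ℝ (f z) x‖ ≤ bound z) (hbi : Integrable bound μ) :
    (∀ u, fderiv ℝ (fun x => ∫ z, f z x ∂μ) θ u = ∫ z, fderiv ℝ (f z) θ u ∂μ) ∧
      ‖fderiv ℝ (fun x => ∫ z, f z x ∂μ) θ‖ ≤ ∫ z, bound z ∂μ := by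
  have h0 := Metric.mem_ball_self (x := θ) hδ
  have hev := Metric.isOpen_ball.eventually_mem h0
  have hF : AEStronglyMeasurable (fun z => fderiv ℝ (f z) θ) μ :=
    (measurable_fderiv_family (fun z => hd z θ h0)
      (hev.mono fun x hx => hm x hx)).aestronglyMeasurable
  have h1 : HasFDerivAt (fun x => ∫ z, f z x ∂μ) (∫ z, fderiv ℝ (f z) θ ∂μ) θ :=
    hasFDerivAt_integral_of_dominated_of_fderiv_le (𝕜 := ℝ) (F := fun x z => f z x)
      (F' := fun x z => fderiv ℝ (f z) x) (bound := bound) (Metric.isOpen_ball.mem_nhds h0)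
      (hev.mono fun x hx => (hm x hx).aestronglyMeasurable) hi hF
      (Eventually.of_forall fun z x hx => hb z x hx) hbi
      (Eventually.of_forall fun z x hx => (hd z x hx).hasFDerivAt)
  rw [h1.fderiv]
  exact ⟨fun u => ContinuousLinearMap.integral_apply
      (hbi.mono' hF (Eventually.of_forall fun z => hb z θ h0)) u,
    norm_integral_le_of_norm_le hbi (Eventually.of_forall fun z => hb z θ h0)⟩

end Measurability

/-! ### Consequences of the regularity conditions -/

namespace Model.Regular

variable {p : ℕ} {D : Model p} {δ τmin τmax CG CH Cmax : ℝ}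

section

variable (h : D.Regular δ τmin τmax CG CH Cmax)
include h

theorem measurable_gradient {θ : Vec p} (hθ : θ ∈ Metric.closedBall D.θ₀ δ) :
    Measurable fun z => gradient (D.loss z) θ :=
  (rieszMap p).continuous.measurable.comp (measurable_fderiv_family
    (fun z => (h.smooth z θ hθ).differentiableAt (by norm_num)) (Eventually.of_forall h.meas))

/-- Measurability of the gradient is needed on a neighbourhood of `θ`, which is why the ball is open
here. -/
theorem measurable_hess {θ : Vec p} (hθ : θ ∈ Metric.ball D.θ₀ δ) :
    Measurable fun z => hess (D.loss z) θ :=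
  measurable_fderiv_family
    (fun z => (hasFDerivAt_gradient
      (h.smooth z θ (Metric.ball_subset_closedBall hθ))).differentiableAt)
    ((Metric.isOpen_ball.eventually_mem hθ).mono fun _ hx =>
      h.measurable_gradient (Metric.ball_subset_closedBall hx))

theorem measurable_third_apply {θ : Vec p} (hθ : θ ∈ Metric.ball D.θ₀ δ) (u : Vec p) :
    Measurable fun z => third (D.loss z) θ u :=
  measurable_fderiv_family_apply
    (fun z => (hasFDerivAt_hess
      (h.smooth z θ (Metric.ball_subset_closedBall hθ))).differentiableAt)
    ((Metric.isOpen_ball.eventually_mem hθ).mono fun _ hx => h.measurable_hess hx) u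

end

/-- A Lipschitz constant of the second and third derivatives of the loss. -/
def lip (h : D.Regular δ τmin τmax CG CH Cmax) (z : Obs p) : ℝ := |h.lipschitz.choose z|

variable (h : D.Regular δ τmin τmax CG CH Cmax)
include h

theorem measurable_lip : Measurable h.lip := h.lipschitz.choose_spec.1.abs

theorem lip_nonneg (z : Obs p) : 0 ≤ h.lip z := abs_nonneg _

theorem momentLE_lip : MomentLE D.law h.lip Cmax := by
  have := h.lipschitz.choose_spec.2.1
  simpa [MomentLE, lip] using this

theorem norm_hess_sub_le_lip (z : Obs p) {θ θ' : Vec p} (hθ : θ ∈ Metric.closedBall D.θ₀ δ)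
    (hθ' : θ' ∈ Metric.closedBall D.θ₀ δ) :
    ‖hess (D.loss z) θ - hess (D.loss z) θ'‖ ≤ h.lip z * ‖θ - θ'‖ :=
  (h.lipschitz.choose_spec.2.2 z θ hθ θ' hθ').1.trans
    (mul_le_mul_of_nonneg_right (le_abs_self _) (norm_nonneg _))

theorem norm_third_sub_le_lip (z : Obs p) {θ θ' : Vec p} (hθ : θ ∈ Metric.closedBall D.θ₀ δ)
    (hθ' : θ' ∈ Metric.closedBall D.θ₀ δ) :
    ‖third (D.loss z) θ - third (D.loss z) θ'‖ ≤ h.lip z * ‖θ - θ'‖ :=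
  ContinuousLinearMap.opNorm_le_bound _ (mul_nonneg (h.lip_nonneg z) (norm_nonneg _)) fun u =>
    ((h.lipschitz.choose_spec.2.2 z θ hθ θ' hθ').2 u).trans
      (mul_le_mul_of_nonneg_right
        (mul_le_mul_of_nonneg_right (le_abs_self _) (norm_nonneg _)) (norm_nonneg _))

theorem smoothLoss (z : Obs p) : SmoothLoss D.Θ D.θ₀ δ (h.lip z) (D.loss z) where
  smooth := h.smooth z
  convexOn := h.loss_convex z
  hess_lip _ hθ _ hθ' := h.norm_hess_sub_le_lip z hθ hθ'
  third_lip _ hθ _ hθ' := h.norm_third_sub_le_lip z hθ hθ'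

theorem norm_third_le (z : Obs p) {θ : Vec p} (hθ : θ ∈ Metric.ball D.θ₀ δ) :
    ‖third (D.loss z) θ‖ ≤ h.lip z :=
  norm_fderiv_le_of_lip' ℝ (h.lip_nonneg z)
    ((Metric.isOpen_ball.eventually_mem hθ).mono fun _ hx =>
      h.norm_hess_sub_le_lip z (Metric.ball_subset_closedBall hx)
        (Metric.ball_subset_closedBall hθ))

theorem integrable_lip (hCmax : 0 < Cmax) : Integrable h.lip D.law := by
  have := h.prob
  exact h.momentLE_lip.integrable hCmax h.measurable_lip.aestronglyMeasurable

theorem memLp_lip (hCmax : 0 < Cmax) : MemLp h.lip 2 D.law := by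
  have := h.prob
  refine (memLp_two_iff_integrable_sq_norm h.measurable_lip.aestronglyMeasurable).2 ?_
  exact h.momentLE_lip.integrable_sq hCmax h.measurable_lip.aestronglyMeasurable

theorem integral_lip_le (hCmax : 0 < Cmax) : ∫ z, h.lip z ∂D.law ≤ Cmax := by
  have := h.prob
  have h1 := integral_norm_le_of_sq (h.memLp_lip hCmax) hCmax
    (h.momentLE_lip.integral_sq_le hCmax h.measurable_lip.aestronglyMeasurable)
  refine (integral_congr_ae (Eventually.of_forall fun z => ?_)).trans_le h1
  exact (Real.norm_of_nonneg (h.lip_nonneg z)).symm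

theorem integrable_hess (hCH : 0 < CH) {θ : Vec p} (hθ : θ ∈ Metric.ball D.θ₀ δ) :
    Integrable (fun z => hess (D.loss z) θ) D.law := by
  have := h.prob
  have h1 := (h.hess_moment θ (Metric.ball_subset_closedBall hθ)).integrable hCH
    ((h.measurable_hess hθ).sub measurable_const).aestronglyMeasurable
  refine (h1.add (integrable_const (D.Omega θ))).congr (Eventually.of_forall fun z => ?_)
  exact sub_add_cancel (hess (D.loss z) θ) (D.Omega θ)

theorem integrable_gradient (hCG : 0 < CG) {θ : Vec p} (hθ : θ ∈ Metric.closedBall D.θ₀ δ) :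
    Integrable (fun z => gradient (D.loss z) θ) D.law := by
  have := h.prob
  exact (h.grad_moment θ hθ).integrable hCG (h.measurable_gradient hθ).aestronglyMeasurable

theorem fderiv_Omega (hδ : 0 < δ) (hCH : 0 < CH) (hCmax : 0 < Cmax) :
    (∀ u, fderiv ℝ D.Omega D.θ₀ u = ∫ z, third (D.loss z) D.θ₀ u ∂D.law) ∧
      ‖fderiv ℝ D.Omega D.θ₀‖ ≤ Cmax := by
  have h1 := fderiv_integral_family (μ := D.law) (f := fun z => hess (D.loss z)) hδ
    (fun z x hx => (hasFDerivAt_hess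
      (h.smooth z x (Metric.ball_subset_closedBall hx))).differentiableAt)
    (fun x hx => h.measurable_hess hx) (h.integrable_hess hCH (Metric.mem_ball_self hδ))
    (fun z x hx => h.norm_third_le z hx) (h.integrable_lip hCmax)
  exact ⟨h1.1, h1.2.trans (h.integral_lip_le hCmax)⟩

/-- The expected gradient of the loss vanishes at the true parameter. -/
theorem integral_gradient (hδ : 0 < δ) (hCG : 0 < CG) (hCH : 0 < CH) (hCmax : 0 < Cmax) :
    ∫ z, gradient (D.loss z) D.θ₀ ∂D.law = 0 := by
  have := h.prob
  have h0 := Metric.mem_ball_self (x := D.θ₀) hδ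
  have h0' := Metric.mem_closedBall_self (x := D.θ₀) hδ.le
  have h1 := fderiv_integral_family (μ := D.law) (f := D.loss)
    -- A gradient anywhere in the ball is dominated by quantities at `θ₀` through the first-order
    -- expansion, so no supremum over `θ` has to be integrated.
    (bound := fun z => (h.lip z * δ * δ + ‖hess (D.loss z) D.θ₀‖ * δ) +
        ‖gradient (D.loss z) D.θ₀‖) hδ
    (fun z x hx => (h.smooth z x (Metric.ball_subset_closedBall hx)).differentiableAt
      (by norm_num)) (fun x _ => h.meas x) (h.integrable _ (h.ball_subset h0'))
    (fun z x hx => ?_)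
    ((((h.integrable_lip hCmax).mul_const δ).mul_const δ |>.add
        ((h.integrable_hess hCH h0).norm.mul_const δ)).add (h.integrable_gradient hCG h0').norm)
  · have hloc : IsLocalMin (fun θ => ∫ z, D.loss z θ ∂D.law) D.θ₀ := by
      filter_upwards [Metric.isOpen_ball.mem_nhds h0] with x hx
      exact h.isMin (h.ball_subset (Metric.ball_subset_closedBall hx))
    have h2 := h1.1
    rw [hloc.fderiv_eq_zero] at h2
    refine ext_inner_left ℝ fun u => ?_
    rw [← integral_inner (h.integrable_gradient hCG h0'), inner_zero_right]
    refine Eq.trans (integral_congr_ae (Eventually.of_forall fun z => ?_)) (h2 u).symm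
    exact (real_inner_comm _ _).trans (inner_gradient _ _ _)
  · have hx' : ‖x - D.θ₀‖ ≤ δ := by
      rw [Metric.mem_ball, dist_eq_norm] at hx; exact hx.le
    have h1 := (h.smoothLoss z).norm_gradient_sub_le (h.lip_nonneg z) le_rfl (x := D.θ₀) (y := x)
      (by simpa using hδ.le) hx'
    have h2 := (hess (D.loss z) D.θ₀).le_opNorm (x - D.θ₀)
    have h3 : gradient (D.loss z) x = gradient (D.loss z) x - gradient (D.loss z) D.θ₀ -
        hess (D.loss z) D.θ₀ (x - D.θ₀) + hess (D.loss z) D.θ₀ (x - D.θ₀) +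
        gradient (D.loss z) D.θ₀ := by abel
    have h4 : ‖fderiv ℝ (D.loss z) x‖ = ‖gradient (D.loss z) x‖ :=
      ((InnerProductSpace.toDual ℝ (Vec p)).symm.norm_map _).symm
    rw [h4, h3]
    refine (norm_add₃_le).trans (add_le_add (add_le_add (h1.trans ?_) (h2.trans ?_)) le_rfl)
    · have := h.lip_nonneg z
      gcongr
    · gcongr

theorem Omega_symm (hδ : 0 < δ) (hCH : 0 < CH) :
    (D.Omega D.θ₀ : Vec p →ₗ[ℝ] Vec p).IsSymmetric := by
  intro u v
  have h0 := Metric.mem_ball_self (x := D.θ₀) hδ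
  have hi := h.integrable_hess hCH h0
  have h1 : ∀ w, D.Omega D.θ₀ w = ∫ z, hess (D.loss z) D.θ₀ w ∂D.law := fun w =>
    ContinuousLinearMap.integral_apply hi w
  have hw : ∀ w, Integrable (fun z => hess (D.loss z) D.θ₀ w) D.law := fun w =>
    hi.apply_continuousLinearMap w
  change inner ℝ (D.Omega D.θ₀ u) v = inner ℝ u (D.Omega D.θ₀ v)
  rw [h1, h1, real_inner_comm, ← integral_inner (hw u), ← integral_inner (hw v)]
  refine integral_congr_ae (Eventually.of_forall fun z => ?_)
  exact (real_inner_comm _ _).trans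
    (inner_hess_symm (h.smooth z _ (Metric.ball_subset_closedBall h0)) u v)

/-- Parseval in an orthonormal eigenbasis of the symmetric matrix, where each coordinate is scaled
by its eigenvalue. -/
theorem coercive_Omega (hδ : 0 < δ) (hCH : 0 < CH) (u : Vec p) :
    τmin * ‖u‖ ^ 2 ≤ inner ℝ (D.Omega D.θ₀ u) u := by
  have hs := h.Omega_symm hδ hCH
  have hn : Module.finrank ℝ (Vec p) = p := by simp
  rw [← (hs.eigenvectorBasis hn).sum_sq_norm_inner_right u,
    ← (hs.eigenvectorBasis hn).sum_inner_mul_inner, Finset.mul_sum]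
  refine Finset.sum_le_sum fun i _ => ?_
  have h1 : τmin ≤ hs.eigenvalues hn i := (h.eig _ (hs.hasEigenvalue_eigenvalues hn i)).1
  have h2 : inner ℝ (D.Omega D.θ₀ u) (hs.eigenvectorBasis hn i) =
      hs.eigenvalues hn i * inner ℝ (hs.eigenvectorBasis hn i) u := by
    have := hs u (hs.eigenvectorBasis hn i)
    rw [hs.apply_eigenvectorBasis hn i] at this
    refine this.trans ?_
    rw [inner_smul_right, real_inner_comm]
    rfl
  rw [h2, Real.norm_eq_abs, sq_abs]
  rw [mul_assoc, ← sq]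
  exact mul_le_mul_of_nonneg_right h1 (sq_nonneg _)

theorem norm_Omega_le (hδ : 0 < δ) (hCH : 0 < CH) (hτmin : 0 < τmin) (hτmax : 0 < τmax) :
    ‖D.Omega D.θ₀‖ ≤ τmax := by
  have hs := h.Omega_symm hδ hCH
  have hn : Module.finrank ℝ (Vec p) = p := by simp
  refine ContinuousLinearMap.opNorm_le_bound _ hτmax.le fun u => ?_
  refine abs_le_of_sq_le_sq' ?_ (by positivity) |>.2
  rw [mul_pow, ← (hs.eigenvectorBasis hn).sum_sq_norm_inner_right u,
    ← (hs.eigenvectorBasis hn).sum_sq_norm_inner_right, Finset.mul_sum]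
  refine Finset.sum_le_sum fun i _ => ?_
  have h1 : τmin ≤ hs.eigenvalues hn i ∧ hs.eigenvalues hn i ≤ τmax :=
    h.eig _ (hs.hasEigenvalue_eigenvalues hn i)
  have h2 : inner ℝ (hs.eigenvectorBasis hn i) (D.Omega D.θ₀ u) =
      hs.eigenvalues hn i * inner ℝ (hs.eigenvectorBasis hn i) u := by
    have := hs (hs.eigenvectorBasis hn i) u
    rw [hs.apply_eigenvectorBasis hn i] at this
    refine this.symm.trans ?_
    rw [inner_smul_left]
    rfl
  rw [h2, norm_mul, mul_pow]
  have h3 : ‖hs.eigenvalues hn i‖ ≤ τmax := by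
    rw [Real.norm_eq_abs, abs_le]; constructor <;> linarith [h1.1, h1.2]
  gcongr

end Model.Regular

/-- Cauchy–Schwarz in coordinates: the operator norm is at most the Hilbert–Schmidt norm. This is
the only source of powers of `p` in the moment bounds. -/
theorem norm_sq_le_sum_single {p : ℕ} {F : Type*} [NormedAddCommGroup F] [NormedSpace ℝ F]
    (L : Vec p →L[ℝ] F) : ‖L‖ ^ 2 ≤ ∑ j, ‖L (EuclideanSpace.single j 1)‖ ^ 2 := by
  have h0 : 0 ≤ ∑ j, ‖L (EuclideanSpace.single j 1)‖ ^ 2 :=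
    Finset.sum_nonneg fun _ _ => by positivity
  suffices h : ‖L‖ ≤ √(∑ j, ‖L (EuclideanSpace.single j 1)‖ ^ 2) by
    calc ‖L‖ ^ 2 ≤ (√(∑ j, ‖L (EuclideanSpace.single j 1)‖ ^ 2)) ^ 2 := by gcongr
      _ = _ := Real.sq_sqrt h0
  refine L.opNorm_le_bound (Real.sqrt_nonneg _) fun u => ?_
  have h1 : L u = ∑ j, u j • L (EuclideanSpace.single j 1) := by
    conv_lhs => rw [← sum_smulRight_single L, _root_.sum_apply]
    rfl
  rw [h1, EuclideanSpace.norm_eq, mul_comm]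
  refine (norm_sum_le _ _).trans ?_
  simp_rw [norm_smul]
  exact Real.sum_mul_le_sqrt_mul_sqrt _ _ _

/-! ### Second moments of sums of centered matrices -/

section Moments

variable {p : ℕ} {𝓧 ι : Type*} [MeasurableSpace 𝓧] [Fintype ι] {μ : Measure 𝓧}
  [IsProbabilityMeasure μ]

omit [IsProbabilityMeasure μ] in
theorem memLp_apply {A : 𝓧 → Mat p} (h : MemLp A 2 μ) (u : Vec p) :
    MemLp (fun x => A x u) 2 μ :=
  (ContinuousLinearMap.apply ℝ (Vec p) u).comp_memLp' h

omit [IsProbabilityMeasure μ] in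
theorem integral_norm_apply_sq_le {A : 𝓧 → Mat p} (h : MemLp A 2 μ) {u : Vec p} (hu : ‖u‖ = 1)
    {α : ℝ} (hα : ∫ x, ‖A x‖ ^ 2 ∂μ ≤ α ^ 2) : ∫ x, ‖A x u‖ ^ 2 ∂μ ≤ α ^ 2 := by
  refine (integral_mono ((memLp_two_iff_integrable_sq_norm (memLp_apply h u).1).1 (memLp_apply h u))
    ((memLp_two_iff_integrable_sq_norm h.1).1 h) fun x => ?_).trans hα
  have := (A x).le_opNorm u
  rw [hu, mul_one] at this
  change ‖A x u‖ ^ 2 ≤ ‖A x‖ ^ 2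
  gcongr

/-- Each column of the sum is a sum of centered i.i.d. vectors, so orthogonality applies. The `p`
columns account for the factor `p`. -/
theorem integral_norm_sum_mat_sq_le {A : 𝓧 → Mat p} (hA : Measurable A) (h2 : MemLp A 2 μ)
    (h0 : ∫ x, A x ∂μ = 0) {α : ℝ} (hα : ∫ x, ‖A x‖ ^ 2 ∂μ ≤ α ^ 2) :
    ∫ z, ‖∑ i, A (z i)‖ ^ 2 ∂(Measure.pi fun _ : ι => μ) ≤
      Fintype.card ι * (p * α ^ 2) := by
  have h1 := memLp_sum_eval (ι := ι) h2 Finset.univ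
  have hm : ∀ u : Vec p, Measurable fun x => A x u := fun u =>
    (ContinuousLinearMap.apply ℝ (Vec p) u).continuous.measurable.comp hA
  have hj : ∀ j : Fin p, MemLp (fun z : ι → 𝓧 => ∑ i, A (z i) (EuclideanSpace.single j 1)) 2
      (Measure.pi fun _ : ι => μ) := fun j =>
    memLp_sum_eval (memLp_apply h2 _) Finset.univ
  calc ∫ z, ‖∑ i, A (z i)‖ ^ 2 ∂(Measure.pi fun _ : ι => μ)
      ≤ ∫ z, ∑ j : Fin p, ‖∑ i, A (z i) (EuclideanSpace.single j 1)‖ ^ 2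
          ∂(Measure.pi fun _ : ι => μ) := by
        refine integral_mono ((memLp_two_iff_integrable_sq_norm h1.1).1 h1)
          (integrable_finsetSum _ fun j _ => (memLp_two_iff_integrable_sq_norm (hj j).1).1 (hj j))
          fun z => ?_
        refine (norm_sq_le_sum_single _).trans_eq (Finset.sum_congr rfl fun j _ => ?_)
        rw [_root_.sum_apply]
    _ = ∑ j : Fin p, ∫ z, ‖∑ i, A (z i) (EuclideanSpace.single j 1)‖ ^ 2
          ∂(Measure.pi fun _ : ι => μ) :=
        integral_finsetSum _ fun j _ => (memLp_two_iff_integrable_sq_norm (hj j).1).1 (hj j)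
    _ ≤ ∑ _j : Fin p, Fintype.card ι * α ^ 2 := by
        refine Finset.sum_le_sum fun j _ => ?_
        rw [integral_norm_sum_sq_le (hm _) (memLp_apply h2 _) ?_]
        · rw [Finset.card_univ]
          exact mul_le_mul_of_nonneg_left (integral_norm_apply_sq_le h2 (by simp) hα)
            (Nat.cast_nonneg _)
        · rw [← ContinuousLinearMap.integral_apply (h2.integrable (by norm_num)), h0]
          rfl
    _ = _ := by
        rw [Finset.sum_const, Finset.card_univ, Fintype.card_fin, nsmul_eq_mul]
        ring

end Moments

/-! ### Derivatives of empirical losses -/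

section EmpLoss

variable {p : ℕ} {D : Model p} {δ τmin τmax CG CH Cmax : ℝ} {ι : Type*} [Fintype ι]

theorem inv_card_smul_sum_sub [Nonempty ι] {V : Type*} [AddCommGroup V] [Module ℝ V]
    (a : ι → V) (b : V) :
    (Fintype.card ι : ℝ)⁻¹ • ∑ i, a i - b = (Fintype.card ι : ℝ)⁻¹ • ∑ i, (a i - b) := by
  have hc : (Fintype.card ι : ℝ) ≠ 0 := by exact_mod_cast Fintype.card_ne_zero
  rw [Finset.sum_sub_distrib, Finset.sum_const, Finset.card_univ, smul_sub,
    ← Nat.cast_smul_eq_nsmul ℝ, inv_smul_smul₀ hc]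

theorem norm_inv_card_smul_sum_sub_le {V : Type*} [NormedAddCommGroup V]
    [NormedSpace ℝ V] {a b : ι → V} {c : ι → ℝ} {K ρ : ℝ} (hρ : 0 ≤ ρ)
    (hab : ∀ i, ‖a i - b i‖ ≤ c i * ρ) (hc : (Fintype.card ι : ℝ)⁻¹ * ∑ i, c i ≤ K) :
    ‖(Fintype.card ι : ℝ)⁻¹ • ∑ i, a i - (Fintype.card ι : ℝ)⁻¹ • ∑ i, b i‖ ≤ K * ρ := by
  rw [← smul_sub, ← Finset.sum_sub_distrib, norm_smul, norm_inv, Real.norm_natCast]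
  calc (Fintype.card ι : ℝ)⁻¹ * ‖∑ i, (a i - b i)‖ ≤ (Fintype.card ι : ℝ)⁻¹ * ∑ i, c i * ρ := by
        gcongr
        exact norm_sum_le_of_le _ fun i _ => hab i
    _ = ((Fintype.card ι : ℝ)⁻¹ * ∑ i, c i) * ρ := by rw [← Finset.sum_mul, mul_assoc]
    _ ≤ K * ρ := by gcongr

namespace Model.Regular

variable (h : D.Regular δ τmin τmax CG CH Cmax)
include h

theorem gradient_empLoss (z : ι → Obs p) {θ : Vec p} (hθ : θ ∈ Metric.closedBall D.θ₀ δ) :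
    gradient (empLoss D.loss z) θ =
      (Fintype.card ι : ℝ)⁻¹ • ∑ i, gradient (D.loss (z i)) θ :=
  gradient_smul_sum _ fun i => (h.smooth (z i) θ hθ).differentiableAt (by norm_num)

theorem hess_empLoss (z : ι → Obs p) {θ : Vec p} (hθ : θ ∈ Metric.closedBall D.θ₀ δ) :
    hess (empLoss D.loss z) θ = (Fintype.card ι : ℝ)⁻¹ • ∑ i, hess (D.loss (z i)) θ :=
  hess_smul_sum _ fun i => h.smooth (z i) θ hθ

theorem third_empLoss (z : ι → Obs p) {θ : Vec p} (hθ : θ ∈ Metric.closedBall D.θ₀ δ) :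
    third (empLoss D.loss z) θ = (Fintype.card ι : ℝ)⁻¹ • ∑ i, third (D.loss (z i)) θ :=
  third_smul_sum _ fun i => h.smooth (z i) θ hθ

theorem hess_empLoss_sub [Nonempty ι] (z : ι → Obs p) (hδ : 0 < δ) :
    hess (empLoss D.loss z) D.θ₀ - D.Omega D.θ₀ =
      (Fintype.card ι : ℝ)⁻¹ • ∑ i, (hess (D.loss (z i)) D.θ₀ - D.Omega D.θ₀) := by
  rw [h.hess_empLoss z (Metric.mem_closedBall_self hδ.le)]
  exact inv_card_smul_sum_sub _ _

theorem smoothLoss_empLoss (z : ι → Obs p) {K : ℝ}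
    (hK : (Fintype.card ι : ℝ)⁻¹ * ∑ i, h.lip (z i) ≤ K) :
    SmoothLoss D.Θ D.θ₀ δ K (empLoss D.loss z) where
  smooth θ hθ := contDiffAt_const.mul (ContDiffAt.sum fun i _ => h.smooth (z i) θ hθ)
  convexOn := convexOn_smul_sum (by positivity) h.convex fun i => h.loss_convex (z i)
  hess_lip θ hθ θ' hθ' := by
    rw [h.hess_empLoss z hθ, h.hess_empLoss z hθ']
    exact norm_inv_card_smul_sum_sub_le (norm_nonneg _)
      (fun i => h.norm_hess_sub_le_lip (z i) hθ hθ') hK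
  third_lip θ hθ θ' hθ' := by
    rw [h.third_empLoss z hθ, h.third_empLoss z hθ']
    have key := norm_inv_card_smul_sum_sub_le (V := Vec p →L[ℝ] Mat p)
      (a := fun i => third (D.loss (z i)) θ) (b := fun i => third (D.loss (z i)) θ')
      (norm_nonneg (θ - θ'))
      (fun i => h.norm_third_sub_le_lip (z i) hθ hθ') hK
    exact key

theorem memLp_gradient (hδ : 0 < δ) (hCG : 0 < CG) :
    MemLp (fun z => gradient (D.loss z) D.θ₀) 2 D.law ∧
      ∫ z, ‖gradient (D.loss z) D.θ₀‖ ^ 2 ∂D.law ≤ CG ^ 2 := by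
  have := h.prob
  have h0 := Metric.mem_closedBall_self (x := D.θ₀) hδ.le
  have hm := (h.measurable_gradient h0).aestronglyMeasurable (μ := D.law)
  exact ⟨(memLp_two_iff_integrable_sq_norm hm).2 ((h.grad_moment _ h0).integrable_sq hCG hm),
    (h.grad_moment _ h0).integral_sq_le hCG hm⟩

theorem measurable_hess_sub (hδ : 0 < δ) :
    Measurable fun z => hess (D.loss z) D.θ₀ - D.Omega D.θ₀ :=
  (h.measurable_hess (Metric.mem_ball_self hδ)).sub measurable_const

theorem memLp_hess (hδ : 0 < δ) (hCH : 0 < CH) :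
    MemLp (fun z => hess (D.loss z) D.θ₀ - D.Omega D.θ₀) 2 D.law ∧
      ∫ z, ‖hess (D.loss z) D.θ₀ - D.Omega D.θ₀‖ ^ 2 ∂D.law ≤ CH ^ 2 := by
  have := h.prob
  have h0 := Metric.mem_closedBall_self (x := D.θ₀) hδ.le
  have hm := (h.measurable_hess_sub hδ).aestronglyMeasurable (μ := D.law)
  exact ⟨(memLp_two_iff_integrable_sq_norm hm).2 ((h.hess_moment _ h0).integrable_sq hCH hm),
    (h.hess_moment _ h0).integral_sq_le hCH hm⟩

theorem integral_hess_sub (hδ : 0 < δ) (hCH : 0 < CH) :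
    ∫ z, (hess (D.loss z) D.θ₀ - D.Omega D.θ₀) ∂D.law = 0 := by
  have := h.prob
  have h1 : Integrable (fun z => hess (D.loss z) D.θ₀) D.law :=
    h.integrable_hess hCH (Metric.mem_ball_self hδ)
  refine (integral_sub h1 (integrable_const (D.Omega D.θ₀))).trans ?_
  rw [integral_const, probReal_univ, one_smul]
  exact sub_self (D.Omega D.θ₀)

end Model.Regular

/-- The sum of squares of the entries of the centered third derivative. -/
def Model.thirdErr (D : Model p) (T : Vec p →L[ℝ] Mat p) : ℝ :=
  ∑ j : Fin p, ∑ k : Fin p,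
    ‖(T - fderiv ℝ D.Omega D.θ₀) (EuclideanSpace.single j 1) (EuclideanSpace.single k 1)‖ ^ 2

theorem Model.norm_third_sub_sq_le (D : Model p) (T : Vec p →L[ℝ] Mat p) :
    ‖T - fderiv ℝ D.Omega D.θ₀‖ ^ 2 ≤ D.thirdErr T :=
  (norm_sq_le_sum_single (T - fderiv ℝ D.Omega D.θ₀)).trans
    (Finset.sum_le_sum fun _ _ => norm_sq_le_sum_single _)

end EmpLoss

/-! ### Moments of the derivatives of empirical losses -/

section EmpMoments

variable {p : ℕ} {D : Model p} {δ τmin τmax CG CH Cmax : ℝ} {ι : Type*} [Fintype ι] [Nonempty ι]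

theorem norm_inv_smul_sq {V : Type*} [NormedAddCommGroup V] [NormedSpace ℝ V] (k : ℝ) (v : V) :
    ‖k⁻¹ • v‖ ^ 2 = (k ^ 2)⁻¹ * ‖v‖ ^ 2 := by
  rw [norm_smul, mul_pow, norm_inv, inv_pow, Real.norm_eq_abs, sq_abs]

/-- The mean of a function of independent observations inherits a bound on the second moment. -/
theorem integral_inv_mul_le {Ω : Type*} [MeasurableSpace Ω] {P : Measure Ω} {f g : Ω → ℝ}
    {k c : ℝ} (hk : 0 < k) (hfg : ∀ ω, f ω = (k ^ 2)⁻¹ * g ω) (hg : Integrable g P)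
    (hc : ∫ ω, g ω ∂P ≤ k * c) : Integrable f P ∧ ∫ ω, f ω ∂P ≤ c / k := by
  obtain rfl : f = fun ω => (k ^ 2)⁻¹ * g ω := funext hfg
  refine ⟨hg.const_mul _, ?_⟩
  rw [integral_const_mul]
  calc (k ^ 2)⁻¹ * ∫ ω, g ω ∂P ≤ (k ^ 2)⁻¹ * (k * c) := by gcongr
    _ = c / k := by field_simp

namespace Model.Regular

variable (h : D.Regular δ τmin τmax CG CH Cmax)
include h

theorem integral_norm_gradient_sq_le (hδ : 0 < δ) (hCG : 0 < CG) (hCH : 0 < CH)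
    (hCmax : 0 < Cmax) :
    Integrable (fun z : ι → Obs p => ‖gradient (empLoss D.loss z) D.θ₀‖ ^ 2)
      (Measure.pi fun _ => D.law) ∧
    ∫ z : ι → Obs p, ‖gradient (empLoss D.loss z) D.θ₀‖ ^ 2 ∂(Measure.pi fun _ => D.law) ≤
      CG ^ 2 / Fintype.card ι := by
  have := h.prob
  have h0 := Metric.mem_closedBall_self (x := D.θ₀) hδ.le
  obtain ⟨h2, h3⟩ := h.memLp_gradient hδ hCG
  have h4 := memLp_sum_eval (ι := ι) h2 Finset.univ
  refine integral_inv_mul_le (Nat.cast_pos.2 Fintype.card_pos)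
    (fun z => by rw [h.gradient_empLoss z h0, norm_inv_smul_sq])
    ((memLp_two_iff_integrable_sq_norm h4.1).1 h4) ?_
  rw [integral_norm_sum_sq_le (h.measurable_gradient h0) h2
    (h.integral_gradient hδ hCG hCH hCmax), Finset.card_univ]
  gcongr

theorem integral_norm_hess_sq_le (hδ : 0 < δ) (hCH : 0 < CH) :
    Integrable (fun z : ι → Obs p => ‖hess (empLoss D.loss z) D.θ₀ - D.Omega D.θ₀‖ ^ 2)
      (Measure.pi fun _ => D.law) ∧
    ∫ z : ι → Obs p, ‖hess (empLoss D.loss z) D.θ₀ - D.Omega D.θ₀‖ ^ 2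
      ∂(Measure.pi fun _ => D.law) ≤ p * CH ^ 2 / Fintype.card ι := by
  have := h.prob
  obtain ⟨h2, h3⟩ := h.memLp_hess hδ hCH
  have h4 := memLp_sum_eval (ι := ι) h2 Finset.univ
  exact integral_inv_mul_le (Nat.cast_pos.2 Fintype.card_pos)
    (fun z => (congrArg (fun A : Mat p => ‖A‖ ^ 2) (h.hess_empLoss_sub z hδ)).trans
      (norm_inv_smul_sq (V := Mat p) _ _))
    ((memLp_two_iff_integrable_sq_norm h4.1).1 h4)
    (integral_norm_sum_mat_sq_le (h.measurable_hess_sub hδ) h2 (h.integral_hess_sub hδ hCH) h3)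

/-- Differentiation under the integral centers the third derivative. A summand is at most `lip +
Cmax`, whose square is at most `2 lip² + 2 Cmax²`; hence `4 Cmax²`. -/
theorem integral_third_apply_sq_le (hδ : 0 < δ) (hCH : 0 < CH) (hCmax : 0 < Cmax) {u v : Vec p}
    (hu : ‖u‖ = 1) (hv : ‖v‖ = 1) :
    Integrable (fun z : ι → Obs p =>
      ‖(third (empLoss D.loss z) D.θ₀ - fderiv ℝ D.Omega D.θ₀) u v‖ ^ 2)
      (Measure.pi fun _ => D.law) ∧
    ∫ z : ι → Obs p, ‖(third (empLoss D.loss z) D.θ₀ - fderiv ℝ D.Omega D.θ₀) u v‖ ^ 2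
      ∂(Measure.pi fun _ => D.law) ≤ 4 * Cmax ^ 2 / Fintype.card ι := by
  have := h.prob
  have h0 := Metric.mem_ball_self (x := D.θ₀) hδ
  set T' := fderiv ℝ D.Omega D.θ₀ with hT'
  obtain ⟨hT1, hT2⟩ := h.fderiv_Omega hδ hCH hCmax
  have hmu : Measurable fun z => third (D.loss z) D.θ₀ u :=
    h.measurable_third_apply h0 u
  have hm : Measurable fun z => third (D.loss z) D.θ₀ u v - T' u v :=
    ((ContinuousLinearMap.apply ℝ (Vec p) v).continuous.measurable.comp hmu).sub measurable_const
  have hb1 : ∀ z, ‖third (D.loss z) D.θ₀ u‖ ≤ h.lip z := fun z => by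
    have := ((third (D.loss z) D.θ₀).le_opNorm u).trans
      (mul_le_mul_of_nonneg_right (h.norm_third_le z h0) (norm_nonneg _))
    rwa [hu, mul_one] at this
  have hb2 : ∀ z, ‖third (D.loss z) D.θ₀ u v‖ ≤ h.lip z := fun z => by
    have := ((third (D.loss z) D.θ₀ u).le_opNorm v).trans
      (mul_le_mul_of_nonneg_right (hb1 z) (norm_nonneg _))
    rwa [hv, mul_one] at this
  have hi : Integrable (fun z => third (D.loss z) D.θ₀ u) D.law :=
    (h.integrable_lip hCmax).mono' hmu.aestronglyMeasurable (Eventually.of_forall hb1)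
  have hi' : Integrable (fun z => third (D.loss z) D.θ₀ u v) D.law :=
    hi.apply_continuousLinearMap v
  have hT'uv : T' u v = ∫ z, third (D.loss z) D.θ₀ u v ∂D.law := by
    rw [hT1 u]; exact ContinuousLinearMap.integral_apply hi v
  have hb : ∀ z, ‖third (D.loss z) D.θ₀ u v - T' u v‖ ≤ h.lip z + Cmax := fun z => by
    refine (norm_sub_le _ _).trans (add_le_add (hb2 z) ?_)
    rw [hT'uv]
    exact (norm_integral_le_of_norm_le (h.integrable_lip hCmax)
      (Eventually.of_forall hb2)).trans (h.integral_lip_le hCmax)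
  have hl : MemLp (fun z => h.lip z + Cmax) 2 D.law :=
    (h.memLp_lip hCmax).add (memLp_const Cmax)
  have h2 : MemLp (fun z => third (D.loss z) D.θ₀ u v - T' u v) 2 D.law :=
    hl.mono' hm.aestronglyMeasurable (Eventually.of_forall hb)
  have h2' : ∫ z, ‖third (D.loss z) D.θ₀ u v - T' u v‖ ^ 2 ∂D.law ≤ 4 * Cmax ^ 2 := by
    have hls : Integrable (fun z => ‖h.lip z‖ ^ 2) D.law :=
      (memLp_two_iff_integrable_sq_norm (h.memLp_lip hCmax).1).1 (h.memLp_lip hCmax)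
    have hls' : ∫ z, ‖h.lip z‖ ^ 2 ∂D.law ≤ Cmax ^ 2 :=
      h.momentLE_lip.integral_sq_le hCmax h.measurable_lip.aestronglyMeasurable
    calc ∫ z, ‖third (D.loss z) D.θ₀ u v - T' u v‖ ^ 2 ∂D.law
        ≤ ∫ z, (2 * ‖h.lip z‖ ^ 2 + 2 * Cmax ^ 2) ∂D.law := by
          refine integral_mono ((memLp_two_iff_integrable_sq_norm h2.1).1 h2)
            ((hls.const_mul 2).add (integrable_const _)) fun z => ?_
          have h5 := pow_le_pow_left₀ (norm_nonneg _) (hb z) 2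
          rw [Real.norm_eq_abs, sq_abs]
          change ‖third (D.loss z) D.θ₀ u v - T' u v‖ ^ 2 ≤ 2 * h.lip z ^ 2 + 2 * Cmax ^ 2
          nlinarith [sq_nonneg (h.lip z - Cmax)]
      _ = 2 * ∫ z, ‖h.lip z‖ ^ 2 ∂D.law + 2 * Cmax ^ 2 := by
          rw [integral_add (hls.const_mul 2) (integrable_const _), integral_const_mul,
            integral_const, probReal_univ, one_smul]
      _ ≤ 4 * Cmax ^ 2 := by linarith
  have hz : ∫ z, (third (D.loss z) D.θ₀ u v - T' u v) ∂D.law = 0 := by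
    rw [integral_sub hi' (integrable_const _), integral_const, probReal_univ, one_smul, hT'uv,
      sub_self]
  have h4 := memLp_sum_eval (ι := ι) h2 Finset.univ
  refine integral_inv_mul_le (Nat.cast_pos.2 Fintype.card_pos) (fun z => ?_)
    ((memLp_two_iff_integrable_sq_norm h4.1).1 h4) ?_
  · have h5 : (third (empLoss D.loss z) D.θ₀ - T') u v =
        (Fintype.card ι : ℝ)⁻¹ • ∑ i, (third (D.loss (z i)) D.θ₀ u v - T' u v) := by
      rw [← inv_card_smul_sum_sub, h.third_empLoss z (Metric.mem_closedBall_self hδ.le)]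
      change ((Fintype.card ι : ℝ)⁻¹ • (∑ i, third (D.loss (z i)) D.θ₀) u) v - T' u v = _
      rw [_root_.sum_apply, _root_.smul_apply, _root_.sum_apply]
    rw [h5, norm_inv_smul_sq]
  · rw [integral_norm_sum_sq_le hm h2 hz, Finset.card_univ]
    gcongr

theorem integral_thirdErr_le (hδ : 0 < δ) (hCH : 0 < CH) (hCmax : 0 < Cmax) :
    Integrable (fun z : ι → Obs p => D.thirdErr (third (empLoss D.loss z) D.θ₀))
      (Measure.pi fun _ => D.law) ∧
    ∫ z : ι → Obs p, D.thirdErr (third (empLoss D.loss z) D.θ₀)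
      ∂(Measure.pi fun _ => D.law) ≤ p ^ 2 * (4 * Cmax ^ 2) / Fintype.card ι := by
  have := h.prob
  have h1 := fun j k : Fin p => h.integral_third_apply_sq_le (ι := ι) hδ hCH hCmax
    (u := EuclideanSpace.single j 1) (v := EuclideanSpace.single k 1) (by simp) (by simp)
  have h2 : ∀ j : Fin p, Integrable (fun z : ι → Obs p => ∑ k : Fin p,
      ‖(third (empLoss D.loss z) D.θ₀ - fderiv ℝ D.Omega D.θ₀) (EuclideanSpace.single j 1)
        (EuclideanSpace.single k 1)‖ ^ 2) (Measure.pi fun _ => D.law) := fun j =>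
    integrable_finsetSum _ fun k _ => (h1 j k).1
  refine ⟨integrable_finsetSum _ fun j _ => h2 j, ?_⟩
  unfold Model.thirdErr
  rw [integral_finsetSum _ fun j _ => h2 j]
  calc _ ≤ ∑ _j : Fin p, ∑ _k : Fin p, 4 * Cmax ^ 2 / Fintype.card ι := by
        refine Finset.sum_le_sum fun j _ => ?_
        rw [integral_finsetSum _ fun k _ => (h1 j k).1]
        exact Finset.sum_le_sum fun k _ => (h1 j k).2
    _ = _ := by
        simp only [Finset.sum_const, Finset.card_univ, Fintype.card_fin, nsmul_eq_mul]
        ring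

/-- The first part is the U-statistic bound for the Hessian errors and `R` applied to the gradients.
It is of order one over the sample size, whatever the dimension. -/
theorem integral_secondOrder_le (hδ : 0 < δ) (hCG : 0 < CG) (hCH : 0 < CH) (hCmax : 0 < Cmax)
    {R : Mat p} {ρ : ℝ} (hρ : 0 < ρ) (hR : ‖R‖ ≤ ρ) :
    Integrable (fun z : ι → Obs p =>
      secondOrder (empLoss D.loss z) D.θ₀ (D.Omega D.θ₀) R) (Measure.pi fun _ => D.law) ∧
    ∫ z : ι → Obs p, secondOrder (empLoss D.loss z) D.θ₀ (D.Omega D.θ₀) R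
      ∂(Measure.pi fun _ => D.law) ≤ (3 * (CH * (ρ * CG)) + CG ^ 2) / Fintype.card ι := by
  have := h.prob
  have h0 := Metric.mem_closedBall_self (x := D.θ₀) hδ.le
  obtain ⟨hA, hA'⟩ := h.memLp_hess hδ hCH
  obtain ⟨hg, hg'⟩ := h.memLp_gradient hδ hCG
  have hb : MemLp (fun z => R (gradient (D.loss z) D.θ₀)) 2 D.law := R.comp_memLp' hg
  have hb' : ∫ z, ‖R (gradient (D.loss z) D.θ₀)‖ ^ 2 ∂D.law ≤ (ρ * CG) ^ 2 := by
    have hgi := (memLp_two_iff_integrable_sq_norm hg.1).1 hg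
    calc _ ≤ ∫ z, ρ ^ 2 * ‖gradient (D.loss z) D.θ₀‖ ^ 2 ∂D.law := by
          refine integral_mono ((memLp_two_iff_integrable_sq_norm hb.1).1 hb)
            (hgi.const_mul _) fun z => ?_
          change ‖R (gradient (D.loss z) D.θ₀)‖ ^ 2 ≤ ρ ^ 2 * ‖gradient (D.loss z) D.θ₀‖ ^ 2
          rw [← mul_pow]
          gcongr
          exact (R.le_opNorm _).trans (by gcongr)
      _ ≤ _ := by
          rw [integral_const_mul, mul_pow]
          gcongr
  have hb0 : ∫ z, R (gradient (D.loss z) D.θ₀) ∂D.law = 0 := by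
    rw [R.integral_comp_comm (hg.integrable (by norm_num)),
      h.integral_gradient hδ hCG hCH hCmax, map_zero]
  obtain ⟨h1, h2⟩ := integral_norm_mean_apply_mean_le (ι := ι) (h.measurable_hess_sub hδ)
    (R.continuous.measurable.comp (h.measurable_gradient h0)) hA hb (h.integral_hess_sub hδ hCH)
    hb0 hCH (mul_pos hρ hCG) hA' hb'
  have h7 : ∀ z : ι → Obs p, ‖(hess (empLoss D.loss z) D.θ₀ - D.Omega D.θ₀)
      (R (gradient (empLoss D.loss z) D.θ₀))‖ = ((Fintype.card ι : ℝ) ^ 2)⁻¹ *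
      ‖(∑ i, (hess (D.loss (z i)) D.θ₀ - D.Omega D.θ₀))
        (∑ i, R (gradient (D.loss (z i)) D.θ₀))‖ := fun z => by
    rw [h.hess_empLoss_sub z hδ, h.gradient_empLoss z h0, map_smul, map_sum, _root_.smul_apply,
      map_smul, smul_smul, norm_smul, norm_mul, norm_inv, Real.norm_natCast, sq, mul_inv]
  obtain ⟨h3, h4⟩ := integral_inv_mul_le (c := 3 * (CH * (ρ * CG)))
    (Nat.cast_pos.2 Fintype.card_pos) h7 h1 (h2.trans_eq (by ring))
  obtain ⟨h5, h6⟩ := h.integral_norm_gradient_sq_le (ι := ι) hδ hCG hCH hCmax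
  refine ⟨h3.add h5, ?_⟩
  unfold secondOrder
  rw [integral_add h3 h5, add_div]
  exact add_le_add h4 h6

end Model.Regular

end EmpMoments

/-! ### Probability of a good sample -/

section GoodSample

theorem measure_norm_sum_gt_le_of_integral_le {E : Type*} [NormedAddCommGroup E]
    [MeasurableSpace E] [BorelSpace E] [SecondCountableTopology E] {𝓧 ι : Type*}
    [MeasurableSpace 𝓧] [Fintype ι] [Nonempty ι] (μ : Measure 𝓧) [IsProbabilityMeasure μ]
    {φ : 𝓧 → E} (hφ : Measurable φ) {a ε K : ℝ} (hε : 0 < ε) (hK : 0 < K) (hm : MomentLE μ φ K)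
    (ha : ∫ z, ‖∑ i, φ (z i)‖ ∂(Measure.pi fun _ : ι => μ) ≤ Fintype.card ι * a) :
    (Measure.pi fun _ : ι => μ).real {z | Fintype.card ι * (a + ε) < ‖∑ i, φ (z i)‖} ≤
      tailConst ε K / (Fintype.card ι : ℝ) ^ 7 := by
  refine (measureReal_mono (fun z hz => ?_)).trans (measure_norm_sum_gt_le μ hφ hε hK hm)
  rw [Set.mem_ofPred_eq] at hz ⊢
  linarith

/-- The constant in the probability that a sample is not good. -/
def goodConst (ε CG CH Cmax : ℝ) : ℝ :=
  tailConst (ε / 2) CG + tailConst (ε / 2) CH + tailConst 1 Cmax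

variable {p : ℕ} {D : Model p} {δ τmin τmax CG CH Cmax : ℝ} {ι : Type*} [Fintype ι]

namespace Model.Regular

/-- The derivatives of the empirical loss at `θ₀` are accurate up to `ε`, and the empirical
Lipschitz constant is bounded. -/
def Good (h : D.Regular δ τmin τmax CG CH Cmax) (ε : ℝ) (z : ι → Obs p) : Prop :=
  ‖gradient (empLoss D.loss z) D.θ₀‖ ≤ ε ∧ ‖hess (empLoss D.loss z) D.θ₀ - D.Omega D.θ₀‖ ≤ ε ∧
    (Fintype.card ι : ℝ)⁻¹ * ∑ i, h.lip (z i) ≤ Cmax + 1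

variable [Nonempty ι] (h : D.Regular δ τmin τmax CG CH Cmax)
include h

/-- The size conditions keep the expected norms of the mean gradient and of the mean Hessian error
below `ε / 2`. The other `ε / 2` is left to the tail inequality, as is the slack `1` for the mean
Lipschitz constant. -/
theorem measure_not_good_le (hδ : 0 < δ) (hCG : 0 < CG) (hCH : 0 < CH) (hCmax : 0 < Cmax) {ε : ℝ}
    (hε : 0 < ε) (hG : 4 * CG ^ 2 ≤ ε ^ 2 * Fintype.card ι)
    (hH : 4 * (p * CH ^ 2) ≤ ε ^ 2 * Fintype.card ι) :
    (Measure.pi fun _ : ι => D.law).real {z | ¬ h.Good ε z} ≤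
      goodConst ε CG CH Cmax / (Fintype.card ι : ℝ) ^ 7 := by
  have := h.prob
  have h0 := Metric.mem_closedBall_self (x := D.θ₀) hδ.le
  set k : ℝ := (Fintype.card ι : ℝ) with hk
  have hk0 : 0 < k := by rw [hk]; exact_mod_cast Fintype.card_pos
  have hε2 : 0 < ε / 2 := by positivity
  have hs : 0 < k * (ε / 2) := by positivity
  obtain ⟨hg, hg'⟩ := h.memLp_gradient hδ hCG
  obtain ⟨hA, hA'⟩ := h.memLp_hess hδ hCH
  have b1 : (Measure.pi fun _ : ι => D.law).real
      {z | k * (ε / 2 + ε / 2) < ‖∑ i, gradient (D.loss (z i)) D.θ₀‖} ≤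
      tailConst (ε / 2) CG / k ^ 7 := by
    refine measure_norm_sum_gt_le_of_integral_le D.law (h.measurable_gradient h0) hε2 hCG
      (h.grad_moment _ h0) (integral_norm_le_of_sq (memLp_sum_eval hg Finset.univ) hs ?_)
    rw [integral_norm_sum_sq_le (h.measurable_gradient h0) hg
      (h.integral_gradient hδ hCG hCH hCmax), Finset.card_univ]
    calc k * ∫ z, ‖gradient (D.loss z) D.θ₀‖ ^ 2 ∂D.law ≤ k * CG ^ 2 := by gcongr
      _ ≤ k * (ε ^ 2 * k / 4) := by gcongr; linarith
      _ = _ := by ring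
  have b2 : (Measure.pi fun _ : ι => D.law).real
      {z | k * (ε / 2 + ε / 2) < ‖∑ i, (hess (D.loss (z i)) D.θ₀ - D.Omega D.θ₀)‖} ≤
      tailConst (ε / 2) CH / k ^ 7 := by
    refine measure_norm_sum_gt_le_of_integral_le D.law (h.measurable_hess_sub hδ) hε2 hCH
      (h.hess_moment _ h0) (integral_norm_le_of_sq (memLp_sum_eval hA Finset.univ) hs ?_)
    refine (integral_norm_sum_mat_sq_le (h.measurable_hess_sub hδ) hA
      (h.integral_hess_sub hδ hCH) hA').trans ?_
    calc k * (p * CH ^ 2) ≤ k * (ε ^ 2 * k / 4) := by gcongr; linarith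
      _ = _ := by ring
  have b3 : (Measure.pi fun _ : ι => D.law).real
      {z | k * (Cmax + 1) < ‖∑ i, h.lip (z i)‖} ≤ tailConst 1 Cmax / k ^ 7 := by
    refine measure_norm_sum_gt_le_of_integral_le D.law h.measurable_lip one_pos hCmax
      h.momentLE_lip ?_
    have hi : ∀ i : ι, Integrable (fun z : ι → Obs p => h.lip (z i))
        (Measure.pi fun _ : ι => D.law) := fun i =>
      integrable_comp_eval (h.integrable_lip hCmax)
    have he : ∀ i : ι, ∫ z : ι → Obs p, h.lip (z i) ∂(Measure.pi fun _ : ι => D.law) ≤ Cmax :=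
      fun i => (integral_comp_eval (i := i) (f := h.lip) (μ := fun _ : ι => D.law)
        h.measurable_lip.aestronglyMeasurable).trans_le (h.integral_lip_le hCmax)
    calc ∫ z : ι → Obs p, ‖∑ i, h.lip (z i)‖ ∂(Measure.pi fun _ : ι => D.law)
        = ∫ z : ι → Obs p, ∑ i, h.lip (z i) ∂(Measure.pi fun _ : ι => D.law) :=
          integral_congr_ae (Eventually.of_forall fun z =>
            Real.norm_of_nonneg (Finset.sum_nonneg fun i _ => h.lip_nonneg (z i)))
      _ = ∑ i, ∫ z : ι → Obs p, h.lip (z i) ∂(Measure.pi fun _ : ι => D.law) :=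
          integral_finsetSum _ fun i _ => hi i
      _ ≤ ∑ _i : ι, Cmax := Finset.sum_le_sum fun i _ => he i
      _ = k * Cmax := by rw [Finset.sum_const, Finset.card_univ, nsmul_eq_mul]
  rw [goodConst, add_div, add_div]
  refine le_trans (measureReal_mono (s₂ := ({z | k * (ε / 2 + ε / 2) <
      ‖∑ i, gradient (D.loss (z i)) D.θ₀‖} ∪ {z | k * (ε / 2 + ε / 2) <
      ‖∑ i, (hess (D.loss (z i)) D.θ₀ - D.Omega D.θ₀)‖}) ∪
      {z | k * (Cmax + 1) < ‖∑ i, h.lip (z i)‖}) fun z hz => ?_) ?_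
  · by_contra hc
    simp only [Set.mem_union, Set.mem_ofPred_eq, not_or, not_lt, add_halves] at hc hz
    obtain ⟨⟨h1, h2⟩, h3⟩ := hc
    refine hz ⟨?_, ?_, ?_⟩
    · rw [h.gradient_empLoss z h0, norm_smul, norm_inv, Real.norm_natCast]
      rwa [inv_mul_le_iff₀ hk0]
    · rw [h.hess_empLoss_sub z hδ, norm_smul, norm_inv, Real.norm_natCast]
      rwa [inv_mul_le_iff₀ hk0]
    · rw [inv_mul_le_iff₀ hk0]
      exact (le_abs_self _).trans h3
  · exact (measureReal_union_le _ _).trans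
      (add_le_add ((measureReal_union_le _ _).trans (add_le_add b1 b2)) b3)

end Model.Regular

end GoodSample

/-! ### Positivity of constants and the bound for the two chained steps -/

section Constants

variable {τ Λ K c₁ : ℝ} (hτ : 0 < τ) (hΛ : 0 < Λ) (hK : 0 < K)
include hτ hΛ hK

theorem stage1Const_pos : 0 < stage1Const τ Λ K := by
  unfold stage1Const invConst geConst; positivity

theorem stage2Const_pos (hc : 0 < c₁) : 0 < stage2Const τ Λ K c₁ := by
  unfold stage2Const updateConst radiusConst incrConst invConst geConst; positivity

end Constants

/-- The constant in `Localized.norm_stage0_sub_ge_le`. -/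
def stage0Const (τ K : ℝ) : ℝ := (2 + 8 * K / τ ^ 2) / τ

namespace Localized

variable {p M : ℕ} {Θ : Set (Vec p)} {θ₀ : Vec p} {δ K τ Λ r ε c₁ : ℝ}
  {f : Fin M → Vec p → ℝ} {Ω : Mat p} {T : Vec p →L[ℝ] Mat p} {θloc : Fin M → Vec p}
  {θge : Vec p} {H : Fin M → Mat p} (h : Localized Θ θ₀ δ K τ Λ r ε f Ω T θloc θge H)
include h

/-- The third-derivative term is split by Young's inequality with a free weight. In expectation `t`
is of order `p² / n` and the squared gradient of order `1 / n`, so `q = p + 1` balances both at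
order `p / n`. -/
theorem errSum_le_avg {t : Fin M → ℝ} (ht : ∀ m, ‖third (f m) θ₀ - T‖ ^ 2 ≤ t m) {q : ℝ}
    (hq : 1 ≤ q) : errSum f θ₀ Ω T θloc ≤ avg fun m => ‖hess (f m) θ₀ - Ω‖ ^ 2 + q⁻¹ * t m +
      8 / τ ^ 2 * q * ‖gradient (f m) θ₀‖ ^ 2 := by
  refine avg_mono fun m => ?_
  have hτ := h.hτ
  have hq0 : 0 < q := by linarith
  set u := ‖θloc m - θ₀‖ with hu
  have h1 : u ^ 2 ≤ 4 / τ ^ 2 * ‖gradient (f m) θ₀‖ ^ 2 := by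
    have := pow_le_pow_left₀ (norm_nonneg _) (h.loc_facts m).2.1 2
    refine this.trans_eq ?_
    ring
  have h2 := (third (f m) θ₀ - T).le_opNorm (θloc m - θ₀)
  have h3 : ‖third (f m) θ₀ - T‖ * u ≤ q⁻¹ * ‖third (f m) θ₀ - T‖ ^ 2 + q * u ^ 2 := by
    have h4 : 0 ≤ q⁻¹ * (‖third (f m) θ₀ - T‖ - q * u) ^ 2 := by positivity
    have h5 : q⁻¹ * (‖third (f m) θ₀ - T‖ - q * u) ^ 2 =
        q⁻¹ * ‖third (f m) θ₀ - T‖ ^ 2 - 2 * (‖third (f m) θ₀ - T‖ * u) + q * u ^ 2 := by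
      field_simp
      ring
    have h6 : 0 ≤ ‖third (f m) θ₀ - T‖ * u := by positivity
    linarith
  have h4 : q⁻¹ * ‖third (f m) θ₀ - T‖ ^ 2 ≤ q⁻¹ * t m :=
    mul_le_mul_of_nonneg_left (ht m) (by positivity)
  have h5 : u ^ 2 + q * u ^ 2 ≤ 8 / τ ^ 2 * q * ‖gradient (f m) θ₀‖ ^ 2 := by
    calc u ^ 2 + q * u ^ 2 ≤ 2 * q * u ^ 2 := by nlinarith [sq_nonneg u]
      _ ≤ 2 * q * (4 / τ ^ 2 * ‖gradient (f m) θ₀‖ ^ 2) := by gcongr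
      _ = _ := by ring
  linarith

variable {S : Strategy}

/-- The rate of the two-stage estimator in terms of bounds on averaged second-order terms. -/
theorem norm_stage2_sub_ge_le_of_bounds (hΛ : 0 < Λ) (hc : 0 < c₁)
    (hs1 : (2 + 2 * incrConst τ Λ) * r ≤ δ) (hs2 : K * ((2 + 2 * incrConst τ Λ) * r) ≤ τ / 4)
    (hs3 : 2 / τ ^ 2 * (2 + K) * r * (Λ + τ) + 2 / τ * (K * ((2 + 2 * incrConst τ Λ) * r)) ≤
      c₁ / 2) {R : Mat p} (hRΩ : R * Ω = 1) (hR : ‖R‖ ≤ 1 / τ) {x y g : ℝ}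
    (hx : errSum f θ₀ Ω T θloc ≤ x)
    (hy : (avg fun m => secondOrder (f m) θ₀ Ω R) + secondOrder (meanLoss f) θ₀ Ω R ≤ y)
    (hg : ‖gradient (meanLoss f) θ₀‖ ^ 2 ≤ g) :
    ‖stage2 c₁ S (meanLoss f) H (stage0 θloc) (stage1 (meanLoss f) H (stage0 θloc)) - θge‖ ≤
      stage2Const τ Λ K c₁ * stage1Const τ Λ K * stage0Const τ K *
        (3 * (x ^ 2 + (stage0Const τ K * y) ^ 2 + 4 / τ ^ 2 * g) * y) := by
  have hτ := h.hτ
  have hK := h.hK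
  have hκ1 := stage1Const_pos hτ hΛ hK
  have hκ2 := stage2Const_pos hτ hΛ hK hc
  have hκ0 : 0 < stage0Const τ K := by unfold stage0Const; positivity
  set a := errSum f θ₀ Ω T θloc + ‖stage0 θloc - θ₀‖ with ha
  have hE : 0 ≤ errSum f θ₀ Ω T θloc := errSum_nonneg
  have hb : ‖stage0 θloc - θge‖ ≤ stage0Const τ K * y :=
    (h.norm_stage0_sub_ge_le hRΩ hR).trans (mul_le_mul_of_nonneg_left hy hκ0.le)
  have hy0 : 0 ≤ stage0Const τ K * y := (norm_nonneg _).trans hb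
  have ha0 : 0 ≤ a := by positivity
  -- Passing through `θge` exploits that the initial estimator is much closer to it than to `θ₀`,
  -- while `θge - θ₀` has the rate of the full sample.
  have h1 : a ≤ x + stage0Const τ K * y + 2 / τ * ‖gradient (meanLoss f) θ₀‖ := by
    have h2 : ‖stage0 θloc - θ₀‖ ≤ ‖stage0 θloc - θge‖ + ‖θge - θ₀‖ := by
      simpa using norm_add_le (stage0 θloc - θge) (θge - θ₀)
    have h3 := h.ge_facts.2.1
    linarith
  have h2 : a ^ 2 ≤ 3 * (x ^ 2 + (stage0Const τ K * y) ^ 2 + 4 / τ ^ 2 * g) := by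
    have h3 := pow_le_pow_left₀ ha0 h1 2
    have h4 : (2 / τ * ‖gradient (meanLoss f) θ₀‖) ^ 2 ≤ 4 / τ ^ 2 * g := by
      calc _ = 4 / τ ^ 2 * ‖gradient (meanLoss f) θ₀‖ ^ 2 := by ring
        _ ≤ _ := by gcongr
    nlinarith [sq_nonneg (x - stage0Const τ K * y),
      sq_nonneg (x - 2 / τ * ‖gradient (meanLoss f) θ₀‖),
      sq_nonneg (stage0Const τ K * y - 2 / τ * ‖gradient (meanLoss f) θ₀‖)]
  calc _ ≤ stage2Const τ Λ K c₁ * a *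
        ‖stage1 (meanLoss f) H (stage0 θloc) - θge‖ := h.norm_stage2_sub_ge_le hc hs1 hs2 hs3
    _ ≤ stage2Const τ Λ K c₁ * a * (stage1Const τ Λ K * a * ‖stage0 θloc - θge‖) := by
        gcongr
        exact h.norm_stage1_sub_ge_le
    _ = stage2Const τ Λ K c₁ * stage1Const τ Λ K * (a ^ 2 * ‖stage0 θloc - θge‖) := by ring
    _ ≤ stage2Const τ Λ K c₁ * stage1Const τ Λ K *
        (3 * (x ^ 2 + (stage0Const τ K * y) ^ 2 + 4 / τ ^ 2 * g) * (stage0Const τ K * y)) := by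
        gcongr
        exact (sq_nonneg a).trans h2
    _ = _ := by ring

end Localized

/-! ### From good samples to the deterministic setting -/

section Localization

/-- Admissible values of the radius `r` and the accuracy `ε` in `Localized`. -/
structure Radii (δ K τ Λ c₁ r ε : ℝ) : Prop where
  hr : 0 < r
  hrδ : r < δ
  hKr : K * r ≤ τ / 8
  hs1 : (2 + 2 * incrConst τ Λ) * r ≤ δ
  hs2 : K * ((2 + 2 * incrConst τ Λ) * r) ≤ τ / 4
  hs3 : 2 / τ ^ 2 * (2 + K) * r * (Λ + τ) + 2 / τ * (K * ((2 + 2 * incrConst τ Λ) * r)) ≤ c₁ / 2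
  hε : 0 < ε
  hετ : ε ≤ τ / 8
  hεr : ε < τ / 2 * r
  hεr' : ε ≤ r

theorem eventually_mul_lt (c : ℝ) {b : ℝ} (hb : 0 < b) : ∀ᶠ r in 𝓝[>] (0 : ℝ), c * r < b := by
  have h1 : Tendsto (fun r : ℝ => c * r) (𝓝[>] 0) (𝓝 0) := by
    have : Tendsto (fun r : ℝ => c * r) (𝓝 0) (𝓝 (c * 0)) := tendsto_id.const_mul c
    rw [mul_zero] at this
    exact this.mono_left nhdsWithin_le_nhds
  exact h1.eventually_lt_const hb

/-- All conditions on `r` are linear with a positive right-hand side, so they hold for every small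
positive `r`. Afterwards `ε` is chosen small relative to `r`. -/
theorem exists_radii {δ K τ Λ c₁ : ℝ} (hδ : 0 < δ) (hτ : 0 < τ) (hc : 0 < c₁) :
    ∃ r ε, Radii δ K τ Λ c₁ r ε := by
  obtain ⟨r, ⟨⟨⟨⟨⟨h1, h2⟩, h3⟩, h4⟩, h5⟩, hr⟩⟩ := (((((eventually_mul_lt 1 hδ).and
    (eventually_mul_lt K (show 0 < τ / 8 by positivity))).and
    (eventually_mul_lt (2 + 2 * incrConst τ Λ) hδ)).and
    (eventually_mul_lt (K * (2 + 2 * incrConst τ Λ)) (show 0 < τ / 4 by positivity))).and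
    (eventually_mul_lt (2 / τ ^ 2 * (2 + K) * (Λ + τ) + 2 / τ * (K * (2 + 2 * incrConst τ Λ)))
      (show 0 < c₁ / 2 by positivity))).and (self_mem_nhdsWithin (a := (0 : ℝ))) |>.exists
  obtain ⟨ε, ⟨⟨⟨h6, h7⟩, h8⟩, hε⟩⟩ := (((eventually_mul_lt 1 (show 0 < τ / 8 by positivity)).and
    (eventually_mul_lt 1 (show 0 < τ / 2 * r by positivity))).and
    (eventually_mul_lt 1 hr)).and (self_mem_nhdsWithin (a := (0 : ℝ))) |>.exists
  exact ⟨r, ε, hr, by linarith, h2.le, h3.le, by linarith, by linarith, hε, by linarith,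
    by linarith, by linarith⟩

variable {p M n : ℕ} {D : Model p} {δ τmin τmax CG CH Cmax c₁ : ℝ}

theorem globalLoss_eq_meanLoss (ℓ : Obs p → Vec p → ℝ) (z : Fin M → Fin n → Obs p) :
    globalLoss ℓ z = meanLoss (localLoss ℓ z) := by
  funext θ
  simp only [globalLoss, meanLoss, localLoss, empLoss, Fintype.card_prod, Fintype.card_fin,
    Fintype.sum_prod_type, ← Finset.mul_sum, Nat.cast_mul, mul_inv, mul_assoc]

namespace Model.Regular

/-- The local iterations enter only through their limit, which convergence identifies with the
inverse of the local Hessian. -/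
theorem localized (h : D.Regular δ τmin τmax CG CH Cmax) (hδ : 0 < δ) (hτmin : 0 < τmin)
    (hτmax : 0 < τmax) (hCH : 0 < CH) (hCmax : 0 < Cmax) {r ε : ℝ}
    (hR : Radii δ (Cmax + 1) τmin τmax c₁ r ε) (hM : 0 < M) {z : Fin M → Fin n → Obs p}
    (hz : ∀ m, h.Good ε (z m)) {θloc θinit : Fin M → Vec p} {Hinit : Fin M → Mat p} {θge : Vec p}
    {S : Strategy} (hloc : ∀ m, IsArgmin (localLoss D.loss z m) D.Θ (θloc m))
    (hge : IsArgmin (globalLoss D.loss z) D.Θ θge)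
    (hH : HessConverges c₁ S D.loss z θloc θinit Hinit) :
    Localized D.Θ D.θ₀ δ (Cmax + 1) τmin τmax r ε (localLoss D.loss z) (D.Omega D.θ₀)
      (fderiv ℝ D.Omega D.θ₀) θloc θge
      (fun m => qnLimit c₁ S (localLoss D.loss z m) (θinit m) (Hinit m)) where
  hM := hM
  hτ := hτmin
  hK := by positivity
  hr := hR.hr
  hrδ := hR.hrδ
  hKr := hR.hKr
  hετ := hR.hετ
  hεr := hR.hεr
  hεr' := hR.hεr'
  convex := h.convex
  ball := h.ball_subset
  loss m := h.smoothLoss_empLoss (z m) (hz m).2.2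
  coercive := h.coercive_Omega hδ hCH
  norm_Ω := h.norm_Omega_le hδ hCH hτmin hτmax
  norm_T := ((h.fderiv_Omega hδ hCH hCmax).2).trans (by linarith)
  norm_gradient m := (hz m).1
  norm_hess m := (hz m).2.1
  argmin_loc := hloc
  argmin_ge := globalLoss_eq_meanLoss D.loss z ▸ hge
  mul_inv m := by
    have h1 : qnLimit c₁ S (localLoss D.loss z m) (θinit m) (Hinit m) =
        Ring.inverse (hess (localLoss D.loss z m) (θloc m)) := (hH m).2.limUnder_eq
    rw [h1]
    exact Ring.mul_inverse_cancel _ (hH m).1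

end Model.Regular

end Localization

/-! ### Markov's inequality and averages -/

section Probability

theorem integral_comp_le_of_hasLaw {Ω 𝓧 : Type*} [MeasurableSpace Ω] [MeasurableSpace 𝓧]
    {P : Measure Ω} {ν : Measure 𝓧} {X : Ω → 𝓧} (hX : HasLaw X ν P) {f : 𝓧 → ℝ} {c : ℝ}
    (hf : Integrable f ν ∧ ∫ x, f x ∂ν ≤ c) :
    Integrable (fun ω => f (X ω)) P ∧ ∫ ω, f (X ω) ∂P ≤ c := by
  refine ⟨?_, (hX.integral_comp hf.1.1).trans_le hf.2⟩
  have h1 : Integrable f (P.map X) := by rw [hX.map_eq]; exact hf.1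
  exact h1.comp_aemeasurable hX.aemeasurable

theorem measure_gt_le_of_integral_le {Ω : Type*} [MeasurableSpace Ω] {P : Measure Ω}
    [IsProbabilityMeasure P] {f : Ω → ℝ} (h0 : ∀ ω, 0 ≤ f ω) {c η : ℝ} (hc : 0 < c) (hη : 0 < η)
    (hf : Integrable f P ∧ ∫ ω, f ω ∂P ≤ c) : P {ω | c / η < f ω} ≤ ENNReal.ofReal η := by
  have h1 := (mul_meas_ge_le_integral_of_nonneg (Eventually.of_forall h0) hf.1 (c / η)).trans hf.2
  have h2 : P.real {ω | c / η < f ω} ≤ η := by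
    refine (measureReal_mono (s₂ := {ω | c / η ≤ f ω})
      fun ω (hω : c / η < f ω) => le_of_lt hω).trans ?_
    rw [div_mul_eq_mul_div, div_le_iff₀ hη] at h1
    exact le_of_mul_le_mul_left h1 hc
  rw [← ofReal_measureReal]
  exact ENNReal.ofReal_le_ofReal h2

theorem integral_avg_le {Ω : Type*} [MeasurableSpace Ω] {P : Measure Ω} {M : ℕ} (hM : 0 < M)
    {f : Fin M → Ω → ℝ} {c : ℝ} (hf : ∀ m, Integrable (f m) P ∧ ∫ ω, f m ω ∂P ≤ c) :
    Integrable (fun ω => avg fun m => f m ω) P ∧ ∫ ω, avg (fun m => f m ω) ∂P ≤ c := by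
  refine ⟨(integrable_finsetSum _ fun m _ => (hf m).1).const_mul (M : ℝ)⁻¹, ?_⟩
  have h1 : ∫ ω, avg (fun m => f m ω) ∂P = avg fun m => ∫ ω, f m ω ∂P := by
    simp only [avg, smul_eq_mul]
    rw [integral_const_mul, integral_finsetSum _ fun m _ => (hf m).1]
  rw [h1]
  exact avg_le_of_le hM fun m => (hf m).2

end Probability

/-! ### Probability bounds for a fixed sample size -/

section FixedSampleSize

variable {p M n : ℕ} {D : Model p} {δ τmin τmax CG CH Cmax c₁ : ℝ} {Ω : Type*}
  [MeasurableSpace Ω] {P : Measure Ω} {Z : Ω → Fin M → Fin n → Obs p}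

theorem hasLaw_worker (hlaw : ∀ m i, HasLaw (fun ω => Z ω m i) D.law P)
    (hind : iIndepFun (fun (k : Fin M × Fin n) ω => Z ω k.1 k.2) P) (m : Fin M) :
    HasLaw (fun ω => Z ω m) (Measure.pi fun _ => D.law) P :=
  (hind.precomp (Prod.mk_right_injective m)).hasLaw_pi fun i => hlaw m i

theorem hasLaw_all (hlaw : ∀ m i, HasLaw (fun ω => Z ω m i) D.law P)
    (hind : iIndepFun (fun (k : Fin M × Fin n) ω => Z ω k.1 k.2) P) :
    HasLaw (fun ω (k : Fin M × Fin n) => Z ω k.1 k.2) (Measure.pi fun _ => D.law) P :=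
  hind.hasLaw_pi fun k => hlaw k.1 k.2

/-- A bound on the error term of one worker. -/
def Model.workerErr {ι : Type*} [Fintype ι] (D : Model p) (τ : ℝ) (z : ι → Obs p) : ℝ :=
  ‖hess (empLoss D.loss z) D.θ₀ - D.Omega D.θ₀‖ ^ 2 +
    ((p : ℝ) + 1)⁻¹ * D.thirdErr (third (empLoss D.loss z) D.θ₀) +
    8 / τ ^ 2 * ((p : ℝ) + 1) * ‖gradient (empLoss D.loss z) D.θ₀‖ ^ 2

theorem Model.thirdErr_nonneg (T : Vec p →L[ℝ] Mat p) : 0 ≤ D.thirdErr T :=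
  Finset.sum_nonneg fun _ _ => Finset.sum_nonneg fun _ _ => sq_nonneg _

theorem Model.workerErr_nonneg {ι : Type*} [Fintype ι] (τ : ℝ) (z : ι → Obs p) :
    0 ≤ D.workerErr τ z := by
  have := D.thirdErr_nonneg (third (empLoss D.loss z) D.θ₀)
  unfold Model.workerErr
  positivity

/-- The constant in the expectation of `Model.workerErr`. -/
def workerErrConst (τ CG CH Cmax : ℝ) : ℝ := CH ^ 2 + 4 * Cmax ^ 2 + 8 / τ ^ 2 * CG ^ 2

/-- The constant in the expectation of `secondOrder`. -/
def secondOrderConst (τ CG CH : ℝ) : ℝ := 3 * (CH * (1 / τ * CG)) + CG ^ 2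

theorem secondOrder_nonneg (f : Vec p → ℝ) (θ₀ : Vec p) (A R : Mat p) :
    0 ≤ secondOrder f θ₀ A R := by
  unfold secondOrder; positivity

namespace Model.Regular

variable (h : D.Regular δ τmin τmax CG CH Cmax)
include h

theorem integral_workerErr_le {ι : Type*} [Fintype ι] [Nonempty ι] (hδ : 0 < δ) (hCG : 0 < CG)
    (hCH : 0 < CH) (hCmax : 0 < Cmax) (τ : ℝ) :
    Integrable (fun z : ι → Obs p => D.workerErr τ z) (Measure.pi fun _ => D.law) ∧
    ∫ z : ι → Obs p, D.workerErr τ z ∂(Measure.pi fun _ => D.law) ≤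
      workerErrConst τ CG CH Cmax * (p + 1) / Fintype.card ι := by
  obtain ⟨a1, a2⟩ := h.integral_norm_hess_sq_le (ι := ι) hδ hCH
  obtain ⟨b1, b2⟩ := h.integral_thirdErr_le (ι := ι) hδ hCH hCmax
  obtain ⟨c1, c2⟩ := h.integral_norm_gradient_sq_le (ι := ι) hδ hCG hCH hCmax
  have b1' := b1.const_mul ((p : ℝ) + 1)⁻¹
  have c1' := c1.const_mul (8 / τ ^ 2 * ((p : ℝ) + 1))
  have ab : Integrable (fun z : ι → Obs p =>
      ‖hess (empLoss D.loss z) D.θ₀ - D.Omega D.θ₀‖ ^ 2 +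
        ((p : ℝ) + 1)⁻¹ * D.thirdErr (third (empLoss D.loss z) D.θ₀))
      (Measure.pi fun _ => D.law) := a1.add b1'
  refine ⟨ab.add c1', ?_⟩
  unfold Model.workerErr
  rw [integral_add ab c1', integral_add a1 b1', integral_const_mul, integral_const_mul]
  have hk : (0 : ℝ) < Fintype.card ι := Nat.cast_pos.2 Fintype.card_pos
  have hp : (0 : ℝ) ≤ p := Nat.cast_nonneg _
  have a3 : p * CH ^ 2 / Fintype.card ι ≤ CH ^ 2 * (p + 1) / Fintype.card ι := by
    rw [mul_comm (p : ℝ)]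
    gcongr
    linarith
  have b3 : ((p : ℝ) + 1)⁻¹ * (p ^ 2 * (4 * Cmax ^ 2) / Fintype.card ι) ≤
      4 * Cmax ^ 2 * (p + 1) / Fintype.card ι := by
    rw [inv_mul_le_iff₀ (by positivity)]
    calc (p : ℝ) ^ 2 * (4 * Cmax ^ 2) / Fintype.card ι
        ≤ ((p : ℝ) + 1) ^ 2 * (4 * Cmax ^ 2) / Fintype.card ι := by gcongr; linarith
      _ = _ := by ring
  calc _ ≤ p * CH ^ 2 / Fintype.card ι +
        ((p : ℝ) + 1)⁻¹ * (p ^ 2 * (4 * Cmax ^ 2) / Fintype.card ι) +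
        8 / τ ^ 2 * ((p : ℝ) + 1) * (CG ^ 2 / Fintype.card ι) := by gcongr
    _ ≤ CH ^ 2 * (p + 1) / Fintype.card ι + 4 * Cmax ^ 2 * (p + 1) / Fintype.card ι +
        8 / τ ^ 2 * ((p : ℝ) + 1) * (CG ^ 2 / Fintype.card ι) := by gcongr
    _ = _ := by unfold workerErrConst; ring

variable (hlaw : ∀ m i, HasLaw (fun ω => Z ω m i) D.law P)
  (hind : iIndepFun (fun (k : Fin M × Fin n) ω => Z ω k.1 k.2) P)
include hlaw hind

/-- With large probability the samples of all workers are good. -/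
theorem measure_exists_not_good_le (hδ : 0 < δ) (hCG : 0 < CG) (hCH : 0 < CH) (hCmax : 0 < Cmax)
    (hn : 0 < n) {ε : ℝ} (hε : 0 < ε) (hG : 4 * CG ^ 2 ≤ ε ^ 2 * n)
    (hH : 4 * (p * CH ^ 2) ≤ ε ^ 2 * n) :
    P {ω | ¬ ∀ m, h.Good ε (Z ω m)} ≤
      ENNReal.ofReal (goodConst ε CG CH Cmax * (((n * M : ℕ) : ℝ) / (n : ℝ) ^ 8)) := by
  have := h.prob
  have : Nonempty (Fin n) := ⟨⟨0, hn⟩⟩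
  have hn' : (0 : ℝ) < n := by exact_mod_cast hn
  have h1 : ∀ m, P {ω | ¬ h.Good ε (Z ω m)} ≤
      ENNReal.ofReal (goodConst ε CG CH Cmax / (n : ℝ) ^ 7) := fun m => by
    have h2 := h.measure_not_good_le (ι := Fin n) hδ hCG hCH hCmax hε
      (by rwa [Fintype.card_fin]) (by rwa [Fintype.card_fin])
    rw [Fintype.card_fin] at h2
    -- This inequality holds for arbitrary sets, so the event of a good sample need not be
    -- measurable.
    refine le_trans (Measure.le_map_apply (hasLaw_worker hlaw hind m).aemeasurable
      {z | ¬ h.Good ε z}) ?_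
    rw [(hasLaw_worker hlaw hind m).map_eq, ← ofReal_measureReal]
    exact ENNReal.ofReal_le_ofReal h2
  have h2 : {ω | ¬ ∀ m, h.Good ε (Z ω m)} = ⋃ m, {ω | ¬ h.Good ε (Z ω m)} := by
    ext ω; simp
  rw [h2]
  refine (measure_iUnion_fintype_le _ _).trans ((Finset.sum_le_sum fun m _ => h1 m).trans ?_)
  rw [Finset.sum_const, Finset.card_univ, Fintype.card_fin, nsmul_eq_mul,
    ← ENNReal.ofReal_natCast, ← ENNReal.ofReal_mul (Nat.cast_nonneg _)]
  refine ENNReal.ofReal_le_ofReal (le_of_eq ?_)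
  push_cast
  field_simp

/-- The averaged second-order terms are of the expected order, with probability at least
`1 - 3η`. -/
theorem measure_secondOrder_le [IsProbabilityMeasure P] (hδ : 0 < δ) (hCG : 0 < CG) (hCH : 0 < CH) (hCmax : 0 < Cmax)
    (hτ : 0 < τmin) (hn : 0 < n) (hM : 0 < M) {R : Mat p} (hR : ‖R‖ ≤ 1 / τmin) {η : ℝ}
    (hη : 0 < η) :
    P {ω | ¬ ((avg fun m => D.workerErr τmin (Z ω m)) ≤
        workerErrConst τmin CG CH Cmax * (p + 1) / n / η ∧
      (avg fun m => secondOrder (localLoss D.loss (Z ω) m) D.θ₀ (D.Omega D.θ₀) R) +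
        secondOrder (globalLoss D.loss (Z ω)) D.θ₀ (D.Omega D.θ₀) R ≤
        2 * secondOrderConst τmin CG CH / n / η ∧
      ‖gradient (globalLoss D.loss (Z ω)) D.θ₀‖ ^ 2 ≤ CG ^ 2 / ((n * M : ℕ) : ℝ) / η)} ≤
      ENNReal.ofReal (3 * η) := by
  have := h.prob
  have : Nonempty (Fin n) := ⟨⟨0, hn⟩⟩
  have : Nonempty (Fin M) := ⟨⟨0, hM⟩⟩
  have hn' : (0 : ℝ) < n := by exact_mod_cast hn
  have hM' : (1 : ℝ) ≤ M := by exact_mod_cast hM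
  have hτ' : 0 < 1 / τmin := by positivity
  have hC : 0 < secondOrderConst τmin CG CH := by unfold secondOrderConst; positivity
  have hW := fun m => integral_comp_le_of_hasLaw (hasLaw_worker hlaw hind m)
    (h.integral_workerErr_le hδ hCG hCH hCmax τmin)
  have hS := fun m => integral_comp_le_of_hasLaw (hasLaw_worker hlaw hind m)
    (h.integral_secondOrder_le hδ hCG hCH hCmax hτ' hR)
  have hS' := integral_comp_le_of_hasLaw (hasLaw_all hlaw hind)
    (h.integral_secondOrder_le hδ hCG hCH hCmax hτ' hR)
  have hG := integral_comp_le_of_hasLaw (hasLaw_all hlaw hind)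
    (h.integral_norm_gradient_sq_le hδ hCG hCH hCmax)
  simp only [Fintype.card_fin, Fintype.card_prod] at hW hS hS' hG
  obtain ⟨s1, s2⟩ := integral_avg_le hM hS
  have hY : Integrable (fun ω =>
      (avg fun m => secondOrder (localLoss D.loss (Z ω) m) D.θ₀ (D.Omega D.θ₀) R) +
        secondOrder (globalLoss D.loss (Z ω)) D.θ₀ (D.Omega D.θ₀) R) P ∧
      ∫ ω, ((avg fun m => secondOrder (localLoss D.loss (Z ω) m) D.θ₀ (D.Omega D.θ₀) R) +
        secondOrder (globalLoss D.loss (Z ω)) D.θ₀ (D.Omega D.θ₀) R) ∂P ≤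
        2 * secondOrderConst τmin CG CH / n := by
    refine ⟨s1.add hS'.1, (integral_add s1 hS'.1).trans_le ((add_le_add s2 hS'.2).trans ?_)⟩
    -- The global sample is at least as large as a local one, so its second-order term is absorbed
    -- by a factor 2.
    have h1 : secondOrderConst τmin CG CH / ((M * n : ℕ) : ℝ) ≤
        secondOrderConst τmin CG CH / n := by
      push_cast
      gcongr
      nlinarith
    have h2 : 2 * secondOrderConst τmin CG CH / n =
      secondOrderConst τmin CG CH / n + secondOrderConst τmin CG CH / n := by ring
    rw [h2]
    exact add_le_add le_rfl h1
  have hG' : Integrable (fun ω => ‖gradient (globalLoss D.loss (Z ω)) D.θ₀‖ ^ 2) P ∧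
      ∫ ω, ‖gradient (globalLoss D.loss (Z ω)) D.θ₀‖ ^ 2 ∂P ≤ CG ^ 2 / ((n * M : ℕ) : ℝ) := by
    rw [mul_comm n M]; exact hG
  have m1 := measure_gt_le_of_integral_le
    (fun ω => avg_nonneg fun m => D.workerErr_nonneg τmin (Z ω m))
    (by unfold workerErrConst; positivity) hη (integral_avg_le hM hW)
  have m2 := measure_gt_le_of_integral_le
    (fun ω => add_nonneg (avg_nonneg fun m => secondOrder_nonneg _ _ _ _)
      (secondOrder_nonneg _ _ _ _)) (by positivity) hη hY
  have m3 := measure_gt_le_of_integral_le (fun ω => sq_nonneg _) (by positivity) hη hG'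
  refine (measure_mono fun ω hω => ?_).trans ((measure_union_le _ _).trans
    ((add_le_add ((measure_union_le _ _).trans (add_le_add m1 m2)) m3).trans_eq ?_))
  · by_contra hc
    simp only [Set.mem_union, Set.mem_ofPred_eq, not_or, not_lt] at hc
    exact hω ⟨hc.1.1, hc.1.2, hc.2⟩
  · rw [← ENNReal.ofReal_add hη.le hη.le, ← ENNReal.ofReal_add (by positivity) hη.le]
    congr 1
    ring

end Model.Regular

end FixedSampleSize

/-! ### Limits of the rates -/

section Asymptotics

theorem natCast_le_add_mul_sqrt_log (p : ℕ) : (p : ℝ) ≤ 3 + p * √(Real.log p) := by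
  have h0 : (0 : ℝ) ≤ p * √(Real.log p) := by positivity
  rcases le_or_gt p 3 with h | h
  · have : (p : ℝ) ≤ 3 := by exact_mod_cast h
    linarith
  · have h3 : (3 : ℝ) ≤ p := by exact_mod_cast h.le
    have h1 : 1 ≤ Real.log p := by
      rw [Real.le_log_iff_exp_le (by linarith)]
      linarith [Real.exp_one_lt_d9]
    have h2 : 1 ≤ √(Real.log p) := Real.one_le_sqrt.2 h1
    nlinarith

/-- For `p ≥ 2` one has `log p ≥ 0.69` and `(3/2)⁴ ≤ 16 * 0.69³`. For `p ≤ 1` the logarithmic term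
vanishes and the constant 16 takes over, which is where the separate condition on `N / n⁶` is used.
-/
theorem succ_pow_four_le (p : ℕ) :
    ((p : ℝ) + 1) ^ 4 ≤ 16 + 16 * ((p : ℝ) ^ 4 * Real.log p ^ 3) := by
  rcases lt_or_ge p 2 with h | h
  · interval_cases p <;> norm_num
  · have h2 : (2 : ℝ) ≤ p := by exact_mod_cast h
    have h1 : (0.69 : ℝ) ≤ Real.log p :=
      le_trans (by linarith [Real.log_two_gt_d9]) (Real.log_le_log (by norm_num) h2)
    have h3 : (0.69 : ℝ) ^ 3 ≤ Real.log p ^ 3 := by gcongr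
    have h4 : ((p : ℝ) + 1) ^ 4 ≤ (3 / 2 * p) ^ 4 := by gcongr; linarith
    have h5 : (0 : ℝ) ≤ (p : ℝ) ^ 4 := by positivity
    nlinarith [mul_le_mul_of_nonneg_left h3 h5]

theorem tendsto_div_natCast {p : ℕ → ℕ}
    (h : Tendsto (fun n => (p n : ℝ) * √(Real.log (p n)) / n) atTop (𝓝 0)) :
    Tendsto (fun n => (p n : ℝ) / n) atTop (𝓝 0) := by
  have h1 := (tendsto_const_div_atTop_nhds_zero_nat (3 : ℝ)).add h
  rw [add_zero] at h1
  refine squeeze_zero (fun n => by positivity) (fun n => ?_) h1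
  rw [← add_div]
  gcongr
  exact natCast_le_add_mul_sqrt_log (p n)

variable {p N : ℕ → ℕ}

theorem tendsto_sqrt_mul_sq_div
    (h1 : Tendsto (fun n => (N n : ℝ) * (p n : ℝ) ^ 4 * Real.log (p n) ^ 3 / (n : ℝ) ^ 6) atTop
      (𝓝 0)) (h2 : Tendsto (fun n => (N n : ℝ) / (n : ℝ) ^ 6) atTop (𝓝 0)) :
    Tendsto (fun n => √(N n : ℝ) * ((p n : ℝ) + 1) ^ 2 / (n : ℝ) ^ 3) atTop (𝓝 0) := by
  have h3 := (h2.const_mul 16).add (h1.const_mul 16)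
  simp only [mul_zero, add_zero] at h3
  have h4 : Tendsto (fun n => (N n : ℝ) * ((p n : ℝ) + 1) ^ 4 / (n : ℝ) ^ 6) atTop (𝓝 0) := by
    refine squeeze_zero (fun n => by positivity) (fun n => ?_) h3
    calc (N n : ℝ) * ((p n : ℝ) + 1) ^ 4 / (n : ℝ) ^ 6
        ≤ (N n : ℝ) * (16 + 16 * ((p n : ℝ) ^ 4 * Real.log (p n) ^ 3)) / (n : ℝ) ^ 6 := by
          gcongr
          exact succ_pow_four_le (p n)
      _ = _ := by ring
  have h5 := h4.sqrt
  rw [Real.sqrt_zero] at h5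
  refine h5.congr fun n => ?_
  have e1 : √((n : ℝ) ^ 6) = (n : ℝ) ^ 3 := by
    rw [show (n : ℝ) ^ 6 = ((n : ℝ) ^ 3) ^ 2 by ring, Real.sqrt_sq (by positivity)]
  have e2 : √(((p n : ℝ) + 1) ^ 4) = ((p n : ℝ) + 1) ^ 2 := by
    rw [show ((p n : ℝ) + 1) ^ 4 = (((p n : ℝ) + 1) ^ 2) ^ 2 by ring, Real.sqrt_sq (by positivity)]
  rw [Real.sqrt_div' _ (by positivity), Real.sqrt_mul (by positivity), e1, e2]

/-- Bounded by `1 / n`, so the contribution of the global estimator's own error needs no growth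
condition on `N`. -/
theorem tendsto_sqrt_div_mul :
    Tendsto (fun n => √(N n : ℝ) / ((N n : ℝ) * n)) atTop (𝓝 0) := by
  refine squeeze_zero (fun n => by positivity) (fun n => ?_)
    (tendsto_const_div_atTop_nhds_zero_nat (1 : ℝ))
  rw [← div_div]
  gcongr
  rcases Nat.eq_zero_or_pos (N n) with h | h
  · simp [h]
  · have h1 : (1 : ℝ) ≤ N n := by exact_mod_cast h
    rw [div_le_one (by positivity)]
    exact Real.sqrt_le_self_iff.2 (Or.inr h1)

/-- The bound of `Localized.norm_stage2_sub_ge_le_of_bounds`, for second-order terms of their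
typical size, is of smaller order than `N⁻¹ᐟ²`. -/
theorem tendsto_sqrt_mul_bound
    (h1 : Tendsto (fun n => (N n : ℝ) * (p n : ℝ) ^ 4 * Real.log (p n) ^ 3 / (n : ℝ) ^ 6) atTop
      (𝓝 0)) (h2 : Tendsto (fun n => (N n : ℝ) / (n : ℝ) ^ 6) atTop (𝓝 0)) (C W s c₀ G t η : ℝ) :
    Tendsto (fun n => √(N n : ℝ) * (C * (3 * ((W * (p n + 1) / n / η) ^ 2 +
      (c₀ * (s / n / η)) ^ 2 + t * (G / N n / η)) * (s / n / η)))) atTop (𝓝 0) := by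
  have a1 := (tendsto_sqrt_mul_sq_div h1 h2).const_mul (C * (3 * (W ^ 2 / η ^ 2 * (s / η))))
  have a2 := h2.sqrt.const_mul (C * (3 * (c₀ ^ 2 * (s / η) ^ 3)))
  have a3 := (tendsto_sqrt_div_mul (N := N)).const_mul (C * (3 * (t * (G / η) * (s / η))))
  have a4 := (a1.add a2).add a3
  -- The bound expands into three terms: the error term gives `√N (p + 1)² / n³`, the distance of
  -- `stage0` to `θge` gives `√N / n³`, and the global gradient gives `√N / (N n)`.
  simp only [Real.sqrt_zero, mul_zero, add_zero] at a4
  refine a4.congr fun n => ?_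
  have e1 : √((N n : ℝ) / (n : ℝ) ^ 6) = √(N n : ℝ) / (n : ℝ) ^ 3 := by
    rw [Real.sqrt_div' _ (by positivity), show (n : ℝ) ^ 6 = ((n : ℝ) ^ 3) ^ 2 by ring,
      Real.sqrt_sq (by positivity)]
  rw [e1]
  ring

theorem tendsto_zero_of_eventually_le_add {a b : ℕ → ENNReal} (hb : Tendsto b atTop (𝓝 0))
    (h : ∀ η : ℝ, 0 < η → ∀ᶠ n in atTop, a n ≤ b n + ENNReal.ofReal η) :
    Tendsto a atTop (𝓝 0) := by
  rw [ENNReal.tendsto_nhds_zero] at hb ⊢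
  intro ε hε
  have hε2 : 0 < ε / 2 := ENNReal.half_pos hε.ne'
  obtain ⟨η, hη0, hη⟩ := ENNReal.lt_iff_exists_nnreal_btwn.1 hε2
  filter_upwards [hb _ hε2, h η (by exact_mod_cast hη0)] with n h1 h2
  rw [ENNReal.ofReal_coe_nnreal] at h2
  exact h2.trans ((add_le_add h1 hη.le).trans_eq (ENNReal.add_halves ε))

end Asymptotics

/-! ### Assembly on the good event -/

namespace Model.Regular

variable {p M n : ℕ} {D : Model p} {δ τmin τmax CG CH Cmax c₁ r ε : ℝ}
  (h : D.Regular δ τmin τmax CG CH Cmax) {z : Fin M → Fin n → Obs p}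
  {θloc θinit : Fin M → Vec p} {Hinit : Fin M → Mat p} {θge : Vec p} {S S' : Strategy}
include h

theorem norm_est2_sub_ge_le (hδ : 0 < δ) (hτmin : 0 < τmin) (hτmax : 0 < τmax) (hCH : 0 < CH)
    (hCmax : 0 < Cmax) (hc₁ : 0 < c₁) (hR : Radii δ (Cmax + 1) τmin τmax c₁ r ε) (hM : 0 < M)
    (hz : ∀ m, h.Good ε (z m)) (hloc : ∀ m, IsArgmin (localLoss D.loss z m) D.Θ (θloc m))
    (hge : IsArgmin (globalLoss D.loss z) D.Θ θge)
    (hH : HessConverges c₁ S D.loss z θloc θinit Hinit) :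
    ‖est2 c₁ S S' D.loss z θloc θinit Hinit - θge‖ ≤ stage2Const τmin τmax (Cmax + 1) c₁ *
      (D.errTerm z θloc + ‖stage0 θloc - D.θ₀‖) *
      ‖est1 c₁ S D.loss z θloc θinit Hinit - θge‖ := by
  have hL := h.localized hδ hτmin hτmax hCH hCmax hR hM hz hloc hge hH
  rw [est2, est1, globalLoss_eq_meanLoss]
  exact hL.norm_stage2_sub_ge_le hc₁ hR.hs1 hR.hs2 hR.hs3

theorem norm_est2_sub_ge_le_of_bounds (hδ : 0 < δ) (hτmin : 0 < τmin) (hτmax : 0 < τmax)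
    (hCH : 0 < CH) (hCmax : 0 < Cmax) (hc₁ : 0 < c₁)
    (hR : Radii δ (Cmax + 1) τmin τmax c₁ r ε) (hM : 0 < M) (hz : ∀ m, h.Good ε (z m))
    (hloc : ∀ m, IsArgmin (localLoss D.loss z m) D.Θ (θloc m))
    (hge : IsArgmin (globalLoss D.loss z) D.Θ θge)
    (hH : HessConverges c₁ S D.loss z θloc θinit Hinit) {R : Mat p}
    (hRΩ : R * D.Omega D.θ₀ = 1) (hR' : ‖R‖ ≤ 1 / τmin) {x y g : ℝ}
    (hb : (avg fun m => D.workerErr τmin (z m)) ≤ x ∧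
      (avg fun m => secondOrder (localLoss D.loss z m) D.θ₀ (D.Omega D.θ₀) R) +
        secondOrder (globalLoss D.loss z) D.θ₀ (D.Omega D.θ₀) R ≤ y ∧
      ‖gradient (globalLoss D.loss z) D.θ₀‖ ^ 2 ≤ g) :
    ‖est2 c₁ S S' D.loss z θloc θinit Hinit - θge‖ ≤
      stage2Const τmin τmax (Cmax + 1) c₁ * stage1Const τmin τmax (Cmax + 1) *
        stage0Const τmin (Cmax + 1) *
        (3 * (x ^ 2 + (stage0Const τmin (Cmax + 1) * y) ^ 2 + 4 / τmin ^ 2 * g) * y) := by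
  have hL := h.localized hδ hτmin hτmax hCH hCmax hR hM hz hloc hge hH
  rw [est2, est1, globalLoss_eq_meanLoss]
  rw [globalLoss_eq_meanLoss] at hb
  have hE := hL.errSum_le_avg (fun m => D.norm_third_sub_sq_le _) (q := (p : ℝ) + 1)
    (by linarith [(Nat.cast_nonneg p : (0 : ℝ) ≤ p)])
  exact hL.norm_stage2_sub_ge_le_of_bounds hτmax hc₁ hR.hs1 hR.hs2 hR.hs3 hRΩ hR'
    (hE.trans hb.1) hb.2.1 hb.2.2

end Model.Regular

end DQN
end
theorem theorem2 (δ τmin τmax CG CH Cmax c₁ : ℝ)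
    (hδ : 0 < δ) (hτmin : 0 < τmin) (hτmax : 0 < τmax) (hCG : 0 < CG) (hCH : 0 < CH)
    (hCmax : 0 < Cmax) (hc₁ : 0 < c₁) (hc₁' : c₁ < 1) :
    ∃ κ₂ : ℝ, 0 < κ₂ ∧
      ∀ -- for every local sample size `n`: the dimension, the number of workers,
        -- a probability space and a model
        (p M : ℕ → ℕ) (_ : ∀ n, 0 < M n)
        (𝓞 : ℕ → Type*) (_ : ∀ n, MeasurableSpace (𝓞 n))
        (P : ∀ n, Measure (𝓞 n)) (_ : ∀ n, IsProbabilityMeasure (P n))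
        (D : ∀ n, DQN.Model (p n))
        (_ : ∀ n, (D n).Regular δ τmin τmax CG CH Cmax)
        -- the observations of the workers are independent with the law of the model
        (Z : ∀ n, 𝓞 n → Fin (M n) → Fin n → DQN.Obs (p n))
        (_ : ∀ n m i, HasLaw (fun ω => Z n ω m i) (D n).law (P n))
        (_ : ∀ n, iIndepFun (fun (k : Fin (M n) × Fin n) ω => Z n ω k.1 k.2) (P n))
        -- the local estimators and the global estimator
        (θloc : ∀ n, 𝓞 n → Fin (M n) → DQN.Vec (p n))
        (_ : ∀ n ω m, DQN.IsArgmin (DQN.localLoss (D n).loss (Z n ω) m) (D n).Θ (θloc n ω m))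
        (θge : ∀ n, 𝓞 n → DQN.Vec (p n))
        (_ : ∀ n ω, DQN.IsArgmin (DQN.globalLoss (D n).loss (Z n ω)) (D n).Θ (θge n ω))
        -- the strategies, and the starting points of the local iterations
        (S S' : DQN.Strategy)
        (θinit : ∀ n, 𝓞 n → Fin (M n) → DQN.Vec (p n))
        (Hinit : ∀ n, 𝓞 n → Fin (M n) → DQN.Mat (p n))
        (_ : Tendsto (fun n => P n {ω | ¬ DQN.HessConverges c₁ S (D n).loss (Z n ω) (θloc n ω)
          (θinit n ω) (Hinit n ω)}) atTop (𝓝 0))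
        -- dimensionality
        (_ : Tendsto (fun n => (p n : ℝ) * √(Real.log (p n)) / n) atTop (𝓝 0))
        -- `N = n M` is of smaller order than `n ^ 8`
        (_ : Tendsto (fun n => ((n * M n : ℕ) : ℝ) / (n : ℝ) ^ 8) atTop (𝓝 0)),
        let est1 := fun n ω =>
          DQN.est1 c₁ S (D n).loss (Z n ω) (θloc n ω) (θinit n ω) (Hinit n ω)
        let est2 := fun n ω =>
          DQN.est2 c₁ S S' (D n).loss (Z n ω) (θloc n ω) (θinit n ω) (Hinit n ω)
        Tendsto (fun n => P n {ω | ¬ (‖est2 n ω - θge n ω‖ ≤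
            κ₂ * ((D n).errTerm (Z n ω) (θloc n ω) + ‖DQN.stage0 (θloc n ω) - (D n).θ₀‖)
              * ‖est1 n ω - θge n ω‖)}) atTop (𝓝 0) ∧
        (Tendsto (fun n => ((n * M n : ℕ) : ℝ) * (p n : ℝ) ^ 4 * Real.log (p n) ^ 3
            / (n : ℝ) ^ 6) atTop (𝓝 0) →
          -- automatic from the previous line if `p n ≥ 2`
          Tendsto (fun n => ((n * M n : ℕ) : ℝ) / (n : ℝ) ^ 6) atTop (𝓝 0) →
          ∀ ε : ℝ, 0 < ε →
            Tendsto (fun n => P n {ω | ε < √((n * M n : ℕ) : ℝ) * ‖est2 n ω - θge n ω‖})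
              atTop (𝓝 0)) := by
  have hK : 0 < Cmax + 1 := by positivity
  obtain ⟨r, ε, hR⟩ := DQN.exists_radii (K := Cmax + 1) (Λ := τmax) hδ hτmin hc₁
  refine ⟨DQN.stage2Const τmin τmax (Cmax + 1) c₁, DQN.stage2Const_pos hτmin hτmax hK hc₁, ?_⟩
  intro p M hM 𝓞 _ P _ D h Z hlaw hind θloc hloc θge hge S S' θinit Hinit hH hp hN est1 est2
  have hε := hR.hε
  have hpn := DQN.tendsto_div_natCast hp
  have hn : ∀ᶠ n : ℕ in atTop, 0 < n ∧ 4 * CG ^ 2 ≤ ε ^ 2 * n ∧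
      4 * (p n * CH ^ 2) ≤ ε ^ 2 * n := by
    have h1 : Tendsto (fun n : ℕ => ε ^ 2 * (n : ℝ)) atTop atTop :=
      tendsto_natCast_atTop_atTop.const_mul_atTop (by positivity)
    filter_upwards [eventually_gt_atTop 0, h1.eventually_ge_atTop (4 * CG ^ 2),
      hpn.eventually_le_const (show 0 < ε ^ 2 / (4 * CH ^ 2) by positivity)] with n h2 h3 h4
    refine ⟨h2, h3, ?_⟩
    rw [div_le_div_iff₀ (by exact_mod_cast h2) (by positivity)] at h4
    linarith
  -- A bound for the probability that some sample is not good or some local iteration fails to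
  -- converge; it serves both claims.
  set bad : ℕ → ENNReal := fun n =>
    ENNReal.ofReal (DQN.goodConst ε CG CH Cmax * (((n * M n : ℕ) : ℝ) / (n : ℝ) ^ 8)) +
      P n {ω | ¬ DQN.HessConverges c₁ S (D n).loss (Z n ω) (θloc n ω) (θinit n ω) (Hinit n ω)}
    with hbad
  have hbad0 : Tendsto bad atTop (𝓝 0) := by
    have h1 := ENNReal.tendsto_ofReal (hN.const_mul (DQN.goodConst ε CG CH Cmax))
    rw [mul_zero, ENNReal.ofReal_zero] at h1
    have h2 := h1.add hH
    rwa [add_zero] at h2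
  have hbadle : ∀ᶠ n in atTop, P n ({ω | ¬ ∀ m, (h n).Good ε (Z n ω m)} ∪
      {ω | ¬ DQN.HessConverges c₁ S (D n).loss (Z n ω) (θloc n ω) (θinit n ω) (Hinit n ω)}) ≤
      bad n := by
    filter_upwards [hn] with n ⟨h1, h2, h3⟩
    exact (measure_union_le _ _).trans (add_le_add ((h n).measure_exists_not_good_le (hlaw n)
      (hind n) hδ hCG hCH hCmax h1 hε h2 h3) le_rfl)
  constructor
  · refine tendsto_of_tendsto_of_tendsto_of_le_of_le' tendsto_const_nhds hbad0
      (Eventually.of_forall fun _ => zero_le) (hbadle.mono fun n hb => ?_)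
    refine (measure_mono fun ω hω => ?_).trans hb
    by_contra hc
    simp only [Set.mem_union, Set.mem_ofPred_eq, not_or, not_not] at hc
    exact hω ((h n).norm_est2_sub_ge_le hδ hτmin hτmax hCH hCmax hc₁ hR (hM n) hc.1
      (hloc n ω) (hge n ω) hc.2)
  · intro h1 h2 ε' hε'
    refine DQN.tendsto_zero_of_eventually_le_add hbad0 fun η₃ hη₃ => ?_
    -- Markov's inequality is applied to three quantities, each exceeding its mean bound divided by
    -- `η` with probability at most `η`. For fixed `η` the resulting bound times `√N` tends to zero.
    set η := η₃ / 3 with hη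
    have hη0 : 0 < η := by positivity
    have h3 := DQN.tendsto_sqrt_mul_bound (N := fun n => n * M n) h1 h2
      (DQN.stage2Const τmin τmax (Cmax + 1) c₁ * DQN.stage1Const τmin τmax (Cmax + 1) *
        DQN.stage0Const τmin (Cmax + 1)) (DQN.workerErrConst τmin CG CH Cmax)
      (2 * DQN.secondOrderConst τmin CG CH) (DQN.stage0Const τmin (Cmax + 1)) (CG ^ 2)
      (4 / τmin ^ 2) η
    filter_upwards [hbadle, hn, h3.eventually_le_const hε'] with n hb ⟨h4, _⟩ h5
    obtain ⟨R, -, hRΩ, hR'⟩ := DQN.exists_inverse_of_coercive hτmin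
      ((h n).coercive_Omega hδ hCH)
    have h6 := (h n).measure_secondOrder_le (hlaw n) (hind n) hδ hCG hCH hCmax hτmin h4 (hM n)
      hR' hη0
    rw [show 3 * η = η₃ by rw [hη]; ring] at h6
    refine (measure_mono fun ω hω => ?_).trans
      ((measure_union_le _ _).trans (add_le_add hb h6))
    by_contra hc
    simp only [Set.mem_union, Set.mem_ofPred_eq, not_or, not_not] at hc
    have h7 := (h n).norm_est2_sub_ge_le_of_bounds (S' := S') hδ hτmin hτmax hCH hCmax hc₁ hR
      (hM n) hc.1.1 (hloc n ω) (hge n ω) hc.1.2 hRΩ hR' hc.2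
    exact absurd hω (not_lt.2 ((mul_le_mul_of_nonneg_left h7 (Real.sqrt_nonneg _)).trans h5))
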